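/- Let $\mathbb k$ be an algebraically closed field of characteristic $0$ and let $C$ be a premodular category over $\mathbb k$, i.e. a ribbon fusion category, with braiding $c$ and twist $\theta$. Let $o(C)$ be a finite set of representatives of the isomorphism classes of simple objects. Let $n\ge 0$ and let $\sigma\in S_{2n}$ be an involution without fixed points (an admissible gluing). For an orbit $[i]$ of $\sigma$ write $[i]'<[i]''$ for its two elements. **The category $Z_\sigma(C)$.** A half-braiding for $X\in C$ is a natural isomorphism $\gamma_Z\colon Z\otimes X\to X\otimes Z$ with $\gamma_{Z\otimes W}=(\gamma_Z\otimes 1)(1\otimes\gamma_W)$. An object of $Z_\sigma(C)$ is a pair $(X,\gamma)$ with $\gamma=\{\gamma_{[i]}\}$ a family of half-braidings for $X$, one for each of the $n$ orbits, such that for any two distinct orbits and all $Z_1,Z_2\in C$, as maps $Z_2\otimes Z_1\otimes X\to X\otimes Z_2\otimes Z_1$: 1. if $[i]'<[i]''<[j]'<[j]''$, then, with $\tilde\gamma_{[i],Z}=c_{Z,X}\,c_{X,Z}\,\gamma_{[i],Z}$, $$(\gamma_{[j],Z_2}\otimes 1)(1\otimes\tilde\gamma_{[i],Z_1})=(1\otimes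 c_{Z_1,Z_2})(\tilde\gamma_{[i],Z_1}\otimes 1)(1\otimes\gamma_{[j],Z_2})(c_{Z_1,Z_2}^{-1}\otimes 1);$$ 2. if $[i]'<[j]'<[i]''<[j]''$, then $$(\gamma_{[j],Z_2}\otimes 1)(1\otimes\gamma_{[i],Z_1})=(1\otimes c_{Z_2,Z_1}^{-1})(\gamma_{[i],Z_1}\otimes 1)(1\otimes\gamma_{[j],Z_2})(c_{Z_1,Z_2}^{-1}\otimes 1);$$ 3. if $[i]'<[j]'<[j]''<[i]''$, then $$(\gamma_{[j],Z_2}\otimes 1)(1\otimes\gamma_{[i],Z_1})=(1\otimes c_{Z_1,Z_2})(\gamma_{[i],Z_1}\otimes 1)(1\otimes\gamma_{[j],Z_2})(c_{Z_1,Z_2}^{-1}\otimes 1).$$ A morphism $(X,\gamma)\to(Y,\beta)$ is an $f\in\mathrm{Hom}_C(X,Y)$ with $\beta_{[i],Z}(1\otimes f)=(f\otimes 1)\gamma_{[i],Z}$ for all $[i]$ and $Z$; such $f$ form a linear subspace of $\mathrm{Hom}_C(X,Y)$. Let $F_\sigma\colon Z_\sigma(C)\to C$, $(X,\gamma)\mapsto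 X$, be the forgetful functor. **The functor $I_\sigma$.** For $X\in C$ put $$X_\sigma=\bigoplus X_1\otimes\cdots\otimes X_n\otimes X\otimes X_{n+1}\otimes\cdots\otimes X_{2n},$$ where the sum runs over all assignments of an element $Y_{[i]}\in o(C)$ to each orbit $[i]$, with $X_{[i]'}=Y_{[i]}$ and $X_{[i]''}=Y_{[i]}^{\star}$. The induced half-braiding $\gamma_{[i],Z}\colon Z\otimes X_\sigma\to X_\sigma\otimes Z$ is as follows: $Z$ passes every factor $A$ to the left of the position $[i]'$ by $c_{A,Z}^{-1}$; then, for every $Y'\in o(C)$, one applies $$\sum_l \varphi_l\otimes(\varphi^l)^\sharp$$ to the factors $Z\otimes Y_{[i]}$ and $Y_{[i]}^\star$ at the positions $[i]'$ and $[i]''$ (all factors in between are unchanged), where $\varphi_l$ and $\varphi^l$ are bases of $\mathrm{Hom}_C(Z\otimes Y_{[i]},Y')$ and $\mathrm{Hom}_C(Y',Z\otimes Y_{[i]})$ with $\varphi_l\varphi^m=\delta_{lm}1_{Y'}$ and $(\varphi^l)^\sharp\colon Y_{[i]}^\star\to Y'^\star\otimes Z$ is the mate of $\varphi^l$ with respect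 to the pivotal structure of $C$; finally the strand $Z$ that comes out at $[i]''$ passes every factor $A$ to the right of that position by $c_{A,Z}^{-1}$. For $f\colon X\to Y$ let $\overline f\colon X_\sigma\to Y_\sigma$ be $\mathrm{id}^{\otimes n}\otimes f\otimes\mathrm{id}^{\otimes n}$ on each summand. **Theorem.** $I_\sigma(X)=(X_\sigma,\gamma)$ is an object of $Z_\sigma(C)$ for every $X$, and $I_\sigma(f)=\overline f$ is a morphism of $Z_\sigma(C)$ for every $f$, so $I_\sigma\colon C\to Z_\sigma(C)$ is a functor. The functors $I_\sigma$ and $F_\sigma$ are ambidextrous adjoint: $I_\sigma$ is both a left adjoint and a right adjoint of $F_\sigma$. Moreover the two adjunctions can be chosen such that the bimonad $T=I_\sigma F_\sigma$ on $Z_\sigma(C)$ (a monad through $F_\sigma\dashv I_\sigma$, with unit $\eta\colon 1\to T$; a comonad through $I_\sigma\dashv F_\sigma$, with counit $\eta'\colon T\to 1$) has unity trace, i.e. $\eta'\circ\eta=1$. For this choice, and for all $\bar X=(X,\gamma)$, $\bar Y=(Y,\beta)$ in $Z_\sigma(C)$, the composition of the adjunction isomorphism $\mathrm{Hom}_C(X,Y)\cong\mathrm{Hom}_{Z_\sigma(C)}(\bar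 X,T\bar Y)$ with $\eta'_{\bar Y}\circ(-)$ is a linear projection $\pi_{\bar X,\bar Y}$ of $\mathrm{Hom}_C(X,Y)$ onto its subspace $\mathrm{Hom}_{Z_\sigma(C)}(\bar X,\bar Y)$, and it is natural: $\pi_{\bar X',\bar Y'}(h\circ f\circ g)=h\circ\pi_{\bar X,\bar Y}(f)\circ g$ for all morphisms $g\colon\bar X'\to\bar X$, $h\colon\bar Y\to\bar Y'$ of $Z_\sigma(C)$ and all $f\in\mathrm{Hom}_C(X,Y)$. -/

import Mathlib

open CategoryTheory MonoidalCategory Limits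

noncomputable section

namespace HigherGenera

attribute [local instance] Abelian.hasFiniteBiproducts

universe v u w

/-! ### Premodular categories -/

/-- A ribbon structure on a braided rigid category: a natural automorphism `θ` of the identity
functor with `θ_{X ⊗ Y} = (θ_X ⊗ θ_Y) ∘ c_{Y,X} ∘ c_{X,Y}` and `θ_{X*} = (θ_X)*`.
(`Xᘁ` has `Xᘁ ⊗ X ⟶ 𝟙` and `𝟙 ⟶ X ⊗ Xᘁ`.) -/
class RibbonCategory (C : Type u) [Category.{v} C] [MonoidalCategory C] [BraidedCategory C]
    [RigidCategory C] where
  twist : ∀ X : C, X ≅ X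
  twist_naturality : ∀ {X Y : C} (f : X ⟶ Y), f ≫ (twist Y).hom = (twist X).hom ≫ f
  twist_tensor : ∀ X Y : C, (twist (X ⊗ Y)).hom =
    (β_ X Y).hom ≫ (β_ Y X).hom ≫ ((twist X).hom ⊗ₘ (twist Y).hom)
  twist_dual : ∀ X : C, (twist Xᘁ).hom = ((twist X).hom)ᘁ

/-- A finite set `o(C)` of representatives of the isomorphism classes of simple objects. -/
structure SimpleReps (C : Type u) [Category.{v} C] [HasZeroMorphisms C] where
  card : ℕ
  obj : Fin card → C
  simple : ∀ a, Simple (obj a)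
  eq_of_iso : ∀ a b, Nonempty (obj a ≅ obj b) → a = b
  exists_iso : ∀ X : C, Simple X → ∃ a, Nonempty (X ≅ obj a)

/-- The conditions that make a `k`-linear abelian rigid monoidal category a fusion category:
finite-dimensional morphism spaces, semisimplicity, finitely many simple objects up to
isomorphism, and `End(𝟙) = k`. -/
class FusionCategory (k : Type w) (C : Type u) [Field k] [Category.{v} C] [Abelian C]
    [Linear k C] [MonoidalCategory C] [MonoidalPreadditive C] [MonoidalLinear k C]
    [RigidCategory C] : Prop where
  finite_hom : ∀ X Y : C, FiniteDimensional k (X ⟶ Y)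
  semisimple : ∀ X : C, ∃ (m : ℕ) (T : Fin m → C),
    (∀ i, Simple (T i)) ∧ Nonempty (X ≅ ⨁ T)
  finite_simples : Nonempty (SimpleReps C)
  end_unit : Module.finrank k (𝟙_ C ⟶ 𝟙_ C) = 1

/-! ### Admissible gluings -/

/-- An admissible gluing of rank `n`: a fixed-point-free involution of a set with `2n` elements
(here `0, …, 2n - 1`). -/
structure AdmissibleGluing (n : ℕ) where
  toPerm : Equiv.Perm (Fin (2 * n))
  involutive : ∀ i, toPerm (toPerm i) = i
  fixedPointFree : ∀ i, toPerm i ≠ i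

/-- The orbits of the gluing. The orbit `[i]` is represented by its smaller element `[i]'`;
its larger element is `[i]'' = σ [i]'`. -/
abbrev AdmissibleGluing.Orbit {n : ℕ} (σ : AdmissibleGluing n) : Type :=
  {i : Fin (2 * n) // i < σ.toPerm i}

/-- The smaller element of an orbit. -/
def AdmissibleGluing.lo {n : ℕ} (σ : AdmissibleGluing n) (i : σ.Orbit) : Fin (2 * n) := i.1

/-- The larger element of an orbit. -/
def AdmissibleGluing.hi {n : ℕ} (σ : AdmissibleGluing n) (i : σ.Orbit) : Fin (2 * n) :=
  σ.toPerm i.1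

section Center

variable {C : Type u} [Category.{v} C] [MonoidalCategory C]

/-! ### Half-braidings and the categorical center of higher genera -/

/-- `(a ⊗ 1) ∘ (1 ⊗ b)`: first move `Z₁` past `X` by `b`, then move `Z₂` past `X` by `a`. -/
def stack {X Z₁ Z₂ : C} (a : Z₂ ⊗ X ⟶ X ⊗ Z₂) (b : Z₁ ⊗ X ⟶ X ⊗ Z₁) :
    (Z₂ ⊗ Z₁) ⊗ X ⟶ X ⊗ (Z₂ ⊗ Z₁) :=
  (α_ Z₂ Z₁ X).hom ≫ Z₂ ◁ b ≫ (α_ Z₂ X Z₁).inv ≫ a ▷ Z₁ ≫ (α_ X Z₂ Z₁).hom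

/-- `γ_Z : Z ⊗ X ⟶ X ⊗ Z` is a half-braiding for `X`: a natural isomorphism
`(-) ⊗ X ≅ X ⊗ (-)` that satisfies the hexagon axiom. -/
structure IsHalfBraiding (X : C) (γ : ∀ Z : C, Z ⊗ X ⟶ X ⊗ Z) : Prop where
  isIso : ∀ Z, IsIso (γ Z)
  naturality : ∀ {Z W : C} (f : Z ⟶ W), f ▷ X ≫ γ W = γ Z ≫ X ◁ f
  hexagon : ∀ Z W : C, γ (Z ⊗ W) = stack (γ Z) (γ W)

variable [BraidedCategory C]

/-- `γ̃_Z = c_{Z,X} ∘ c_{X,Z} ∘ γ_Z`. -/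
def tildeTwist {X Z : C} (g : Z ⊗ X ⟶ X ⊗ Z) : Z ⊗ X ⟶ X ⊗ Z :=
  g ≫ (β_ X Z).hom ≫ (β_ Z X).hom

/-- The commutative relation for `[i]' < [i]'' < [j]' < [j]''`. -/
def Comm₁ (X : C) (γi γj : ∀ Z : C, Z ⊗ X ⟶ X ⊗ Z) : Prop :=
  ∀ Z₁ Z₂ : C, stack (γj Z₂) (tildeTwist (γi Z₁)) =
    (β_ Z₁ Z₂).inv ▷ X ≫ stack (tildeTwist (γi Z₁)) (γj Z₂) ≫ X ◁ (β_ Z₁ Z₂).hom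

/-- The commutative relation for `[i]' < [j]' < [i]'' < [j]''`. -/
def Comm₂ (X : C) (γi γj : ∀ Z : C, Z ⊗ X ⟶ X ⊗ Z) : Prop :=
  ∀ Z₁ Z₂ : C, stack (γj Z₂) (γi Z₁) =
    (β_ Z₁ Z₂).inv ▷ X ≫ stack (γi Z₁) (γj Z₂) ≫ X ◁ (β_ Z₂ Z₁).inv

/-- The commutative relation for `[i]' < [j]' < [j]'' < [i]''`. -/
def Comm₃ (X : C) (γi γj : ∀ Z : C, Z ⊗ X ⟶ X ⊗ Z) : Prop :=
  ∀ Z₁ Z₂ : C, stack (γj Z₂) (γi Z₁) =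
    (β_ Z₁ Z₂).inv ▷ X ≫ stack (γi Z₁) (γj Z₂) ≫ X ◁ (β_ Z₁ Z₂).hom

variable {n : ℕ} (σ : AdmissibleGluing n)

/-- `(X, γ)` is a `σ`-pair: each `γ_{[i]}` is a half-braiding for `X`, and they satisfy the
pairwise commutative relations. -/
structure IsSigmaPair (X : C) (γ : σ.Orbit → ∀ Z : C, Z ⊗ X ⟶ X ⊗ Z) : Prop where
  halfBraiding : ∀ i, IsHalfBraiding X (γ i)
  comm₁ : ∀ i j, σ.lo i < σ.hi i → σ.hi i < σ.lo j → σ.lo j < σ.hi j → Comm₁ X (γ i) (γ j)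
  comm₂ : ∀ i j, σ.lo i < σ.lo j → σ.lo j < σ.hi i → σ.hi i < σ.hi j → Comm₂ X (γ i) (γ j)
  comm₃ : ∀ i j, σ.lo i < σ.lo j → σ.lo j < σ.hi j → σ.hi j < σ.hi i → Comm₃ X (γ i) (γ j)

/-- A morphism of `C` compatible with all the half-braidings: `β_Z (1 ⊗ f) = (f ⊗ 1) γ_Z`. -/
def IsSigmaHom {X Y : C} (γ : σ.Orbit → ∀ Z : C, Z ⊗ X ⟶ X ⊗ Z)
    (β : σ.Orbit → ∀ Z : C, Z ⊗ Y ⟶ Y ⊗ Z) (f : X ⟶ Y) : Prop :=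
  ∀ i Z, Z ◁ f ≫ β i Z = γ i Z ≫ f ▷ Z

variable (C) in
/-- The objects of the categorical center of higher genera `Z_σ(C)`. -/
structure SigmaCenter where
  X : C
  γ : σ.Orbit → ∀ Z : C, Z ⊗ X ⟶ X ⊗ Z
  isSigmaPair : IsSigmaPair σ X γ

variable {σ}

/-- The morphisms of `Z_σ(C)`. -/
@[ext]
structure SigmaCenter.Hom (x y : SigmaCenter C σ) where
  f : x.X ⟶ y.X
  isSigmaHom : IsSigmaHom σ x.γ y.γ f

/-- The category `Z_σ(C)`; identities and composition are those of `C`. -/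
instance : Category (SigmaCenter C σ) where
  Hom x y := SigmaCenter.Hom x y
  id x := ⟨𝟙 x.X, fun i Z => by simp⟩
  comp f g := ⟨f.f ≫ g.f, fun i Z => by
    rw [MonoidalCategory.whiskerLeft_comp, Category.assoc, g.isSigmaHom,
      ← Category.assoc, f.isSigmaHom, Category.assoc, comp_whiskerRight]⟩
  id_comp f := SigmaCenter.Hom.ext (Category.id_comp f.f)
  comp_id f := SigmaCenter.Hom.ext (Category.comp_id f.f)
  assoc f g h := SigmaCenter.Hom.ext (Category.assoc f.f g.f h.f)

variable (C σ) in
/-- The forgetful functor `F_σ : Z_σ(C) ⥤ C`. -/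
def forgetful : SigmaCenter C σ ⥤ C where
  obj x := x.X
  map f := f.f

end Center

/-- `Hom_{Z_σ(C)}(x, y)` as a linear subspace of `Hom_C(x, y)`. -/
def sigmaHomSubmodule (k : Type w) {C : Type u} [Field k] [Category.{v} C] [Preadditive C]
    [Linear k C] [MonoidalCategory C] [MonoidalPreadditive C] [MonoidalLinear k C]
    [BraidedCategory C] {n : ℕ} {σ : AdmissibleGluing n} (x y : SigmaCenter C σ) :
    Submodule k (x.X ⟶ y.X) where
  carrier := {f | IsSigmaHom σ x.γ y.γ f}
  zero_mem' := fun i Z => by simp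
  add_mem' := fun {f g} hf hg i Z => by
    have h1 := hf i Z
    have h2 := hg i Z
    simp [h1, h2]
  smul_mem' := fun c f hf i Z => by
    have h1 := hf i Z
    simp [h1]

/-! ### Dual bases -/

section DualBases

variable (k : Type w) {C : Type u} [Field k] [Category.{v} C] [Preadditive C] [Linear k C]

/-- Dual bases of `Hom(W, S)` and `Hom(S, W)` for a simple object `S`, normalised by
`φ_i ∘ φ^j = δ_{ij} 1_S`. As the trace of `1_S` is `dim S`, the morphism `φ^j` is `dim S` times
the `j`-th dual basis vector for the trace pairing `(φ, ψ) ↦ tr (φ ∘ ψ)`. -/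
structure DualBases (W S : C) where
  card : ℕ
  φ : Module.Basis (Fin card) k (W ⟶ S)
  φdual : Module.Basis (Fin card) k (S ⟶ W)
  pairing : ∀ i j, φdual j ≫ φ i = if i = j then 𝟙 S else 0

end DualBases

theorem DualBases.nonempty (k : Type w) {C : Type u} [Field k] [IsAlgClosed k] [Category.{v} C]
    [Abelian C] [Linear k C] [MonoidalCategory C] [MonoidalPreadditive C] [MonoidalLinear k C]
    [RigidCategory C] [FusionCategory k C] (W S : C) [Simple S] :
    Nonempty (DualBases k W S) := by
  classical
  have : ∀ X Y : C, FiniteDimensional k (X ⟶ Y) := FusionCategory.finite_hom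
  let e : k ≃ₗ[k] (S ⟶ S) := LinearEquiv.ofBijective
    (LinearMap.toSpanSingleton k (S ⟶ S) (𝟙 S))
    ⟨fun a b h => smul_left_injective k (id_nonzero S) (by simpa using h), fun f => by
      obtain ⟨c, hc⟩ := endomorphism_simple_eq_smul_id k f
      exact ⟨c, by simpa using hc⟩⟩
  have he : ∀ f : S ⟶ S, e.symm f • 𝟙 S = f := fun f => e.apply_symm_apply f
  let p : (S ⟶ W) →ₗ[k] (W ⟶ S) →ₗ[k] k := LinearMap.mk₂ k (fun g f => e.symm (g ≫ f))
    (by intros; simp) (by intros; simp) (by intros; simp) (by intros; simp)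
  have hp : ∀ g f, p g f = e.symm (g ≫ f) := fun _ _ => rfl
  have hpz : ∀ (g : S ⟶ W) (f : W ⟶ S), p g f = 0 → g ≫ f = 0 := fun g f h => by
    rw [hp] at h
    simpa using h
  obtain ⟨m, T, hT, ⟨t⟩⟩ := FusionCategory.semisimple (k := k) W
  have h1 : Function.Injective p := by
    rw [injective_iff_map_eq_zero]
    intro g hg
    have : g ≫ t.hom = 0 := by
      apply biproduct.hom_ext
      intro a
      by_contra hne
      have := hT a
      have hne' : g ≫ t.hom ≫ biproduct.π T a ≠ 0 := by simpa using hne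
      have := isIso_of_hom_simple hne'
      have h0 := hpz g (t.hom ≫ biproduct.π T a ≫ inv (g ≫ t.hom ≫ biproduct.π T a))
        (by rw [hg]; rfl)
      apply id_nonzero S
      rw [← h0, ← IsIso.hom_inv_id (g ≫ t.hom ≫ biproduct.π T a)]
      simp only [Category.assoc]
    simpa using this
  have h2 : Function.Injective p.flip := by
    rw [injective_iff_map_eq_zero]
    intro f hf
    have : t.inv ≫ f = 0 := by
      apply biproduct.hom_ext'
      intro a
      by_contra hne
      have := hT a
      have hne' : biproduct.ι T a ≫ t.inv ≫ f ≠ 0 := by simpa using hne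
      have := isIso_of_hom_simple hne'
      have h0 := hpz (inv (biproduct.ι T a ≫ t.inv ≫ f) ≫ biproduct.ι T a ≫ t.inv) f
        (by
          have := LinearMap.congr_fun hf
            (inv (biproduct.ι T a ≫ t.inv ≫ f) ≫ biproduct.ι T a ≫ t.inv)
          simpa only [LinearMap.flip_apply, LinearMap.zero_apply] using this)
      apply id_nonzero S
      rw [← h0, ← IsIso.inv_hom_id (biproduct.ι T a ≫ t.inv ≫ f)]
      simp only [Category.assoc]
    simpa using this
  have : p.IsPerfPair := LinearMap.IsPerfPair.of_injective h1 h2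
  let b := Module.finBasis k (W ⟶ S)
  refine ⟨⟨_, b, b.dualBasis.map p.toPerfPair.symm, fun i j => ?_⟩⟩
  have h3 : p (p.toPerfPair.symm (b.dualBasis j)) (b i) = b.dualBasis j (b i) := by
    rw [LinearMap.apply_symm_toPerfPair_self]
  rw [hp, Module.Basis.dualBasis_apply_self] at h3
  rw [Module.Basis.map_apply, ← he (_ ≫ _), h3]
  split_ifs <;> simp

/-- A choice of dual bases. -/
def dualBases (k : Type w) {C : Type u} [Field k] [IsAlgClosed k] [Category.{v} C]
    [Abelian C] [Linear k C] [MonoidalCategory C] [MonoidalPreadditive C] [MonoidalLinear k C]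
    [RigidCategory C] [FusionCategory k C] (W S : C) (hS : Simple S) : DualBases k W S :=
  have := hS
  Classical.choice (DualBases.nonempty k W S)

/-! ### Words: the summands of `X_σ` -/

/-- The tensor factors of a summand of `X_σ`: for each orbit a first slot, a second slot, and
one slot for `X` itself. -/
inductive Slot (K : Type) : Type
  | first (i : K) : Slot K
  | second (i : K) : Slot K
  | base : Slot K

/-- The slot at the position `p ∈ {0, …, 2n - 1}`. -/
def AdmissibleGluing.slot {n : ℕ} (σ : AdmissibleGluing n) (p : Fin (2 * n)) : Slot σ.Orbit :=
  if h : p < σ.toPerm p then .first ⟨p, h⟩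
  else .second ⟨σ.toPerm p, by
    rw [σ.involutive]
    exact lt_of_le_of_ne (not_lt.mp h) (σ.fixedPointFree p)⟩

/-- The slots of `X_1 ⊗ ⋯ ⊗ X_n ⊗ X ⊗ X_{n+1} ⊗ ⋯ ⊗ X_{2n}` from left to right. -/
def AdmissibleGluing.word {n : ℕ} (σ : AdmissibleGluing n) : List (Slot σ.Orbit) :=
  ((List.finRange (2 * n)).map σ.slot).take n ++
    Slot.base :: ((List.finRange (2 * n)).map σ.slot).drop n

section Words

variable {C : Type u} [Category.{v} C] [Preadditive C] [MonoidalCategory C] [RigidCategory C]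
  (R : SimpleReps C) {K : Type}

/-- The tensor factor in a slot: for a coloring `y` of the orbits by representatives of simple
objects, the first slot of the orbit `i` carries `y i`, the second one carries the dual of `y i`. -/
def slotObj (y : K → Fin R.card) (X : C) : Slot K → C
  | .first i => R.obj (y i)
  | .second i => (R.obj (y i))ᘁ
  | .base => X

/-- The tensor product of a word of slots, bracketed to the right and ending in the unit object:
`A_1 ⊗ (A_2 ⊗ (⋯ ⊗ (A_m ⊗ 𝟙)))`. -/
def wordObj (y : K → Fin R.card) (X : C) : List (Slot K) → C
  | [] => 𝟙_ C
  | s :: t => slotObj R y X s ⊗ wordObj y X t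

/-- `id` in the slots of the orbits, `f` in the base slot. -/
def slotMap (y : K → Fin R.card) {X Y : C} (f : X ⟶ Y) :
    ∀ s : Slot K, slotObj R y X s ⟶ slotObj R y Y s
  | .first i => 𝟙 (R.obj (y i))
  | .second i => 𝟙 ((R.obj (y i))ᘁ)
  | .base => f

/-- `id ⊗ ⋯ ⊗ f ⊗ ⋯ ⊗ id`. -/
def wordMap (y : K → Fin R.card) {X Y : C} (f : X ⟶ Y) :
    ∀ t : List (Slot K), wordObj R y X t ⟶ wordObj R y Y t
  | [] => 𝟙 (𝟙_ C)
  | s :: t => slotMap R y f s ⊗ₘ wordMap y f t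

theorem wordMap_id (y : K → Fin R.card) (X : C) (t : List (Slot K)) :
    wordMap R y (𝟙 X) t = 𝟙 (wordObj R y X t) := by
  induction t with
  | nil => rfl
  | cons s t ih =>
    have h : slotMap R y (𝟙 X) s = 𝟙 (slotObj R y X s) := by cases s <;> rfl
    simp only [wordMap, wordObj, ih, h, id_tensorHom_id]

theorem wordMap_comp (y : K → Fin R.card) {X Y Z : C} (f : X ⟶ Y) (g : Y ⟶ Z)
    (t : List (Slot K)) :
    wordMap R y (f ≫ g) t = wordMap R y f t ≫ wordMap R y g t := by
  induction t with
  | nil => exact (Category.id_comp (𝟙 (𝟙_ C))).symm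
  | cons s t ih =>
    have h : slotMap R y (f ≫ g) s = slotMap R y f s ≫ slotMap R y g s := by
      cases s with
      | first i => exact (Category.id_comp (𝟙 (R.obj (y i)))).symm
      | second i => exact (Category.id_comp (𝟙 ((R.obj (y i))ᘁ))).symm
      | base => rfl
    simp only [wordMap, ih, h]
    exact (tensorHom_comp_tensorHom _ _ _ _).symm

/-- The component between two colorings of the identity of `⨁_a S_a`. -/
def delta (a b : Fin R.card) : R.obj a ⟶ R.obj b :=
  if h : a = b then eqToHom (congrArg R.obj h) else 0

/-- The identity of a slot if the two colorings agree there, and `0` otherwise. -/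
def slotDelta (y y' : K → Fin R.card) (X : C) :
    ∀ s : Slot K, slotObj R y X s ⟶ slotObj R y' X s
  | .first i => delta R (y i) (y' i)
  | .second i => (delta R (y' i) (y i))ᘁ
  | .base => 𝟙 X

/-- The identity of a word if the two colorings agree on it, and `0` otherwise. -/
def wordDelta (y y' : K → Fin R.card) (X : C) :
    ∀ t : List (Slot K), wordObj R y X t ⟶ wordObj R y' X t
  | [] => 𝟙 (𝟙_ C)
  | s :: t => slotDelta R y y' X s ⊗ₘ wordDelta y y' X t

/-! ### The induced half-braidings -/

variable [BraidedCategory C]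

/-- The strand `Z` passes a tensor factor from left to right by the inverse braiding
`c_{A,Z}⁻¹ : Z ⊗ A ⟶ A ⊗ Z`, while `f` is applied to that factor. -/
def cross (Z : C) {A B : C} (f : A ⟶ B) : Z ⊗ A ⟶ B ⊗ Z :=
  (β_ A Z).inv ≫ f ▷ Z

variable [RibbonCategory C]

/-- The evaluation `Y ⊗ Y* ⟶ 𝟙` given by the pivotal structure of a ribbon category. -/
def pivotalEv (Y : C) : Y ⊗ Yᘁ ⟶ 𝟙_ C :=
  (RibbonCategory.twist Y).hom ▷ Yᘁ ≫ (β_ Y Yᘁ).hom ≫ ε_ Y Yᘁ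

/-- The coevaluation `𝟙 ⟶ Y* ⊗ Y` given by the pivotal structure of a ribbon category. -/
def pivotalCoev (Y : C) : 𝟙_ C ⟶ Yᘁ ⊗ Y :=
  η_ Y Yᘁ ≫ (β_ Yᘁ Y).inv ≫ Yᘁ ◁ (RibbonCategory.twist Y).inv

/-- The mate `Y* ⟶ Y'* ⊗ Z` of a morphism `ψ : Y' ⟶ Z ⊗ Y`. -/
def emission {Y Y' Z : C} (ψ : Y' ⟶ Z ⊗ Y) : Yᘁ ⟶ Y'ᘁ ⊗ Z :=
  (λ_ (Yᘁ)).inv ≫ pivotalCoev Y' ▷ Yᘁ ≫ (α_ (Y'ᘁ) Y' (Yᘁ)).hom ≫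
    Y'ᘁ ◁ (ψ ▷ Yᘁ ≫ (α_ Z Y (Yᘁ)).hom ≫ Z ◁ pivotalEv Y ≫ (ρ_ Z).hom)

variable [DecidableEq K]

/-- The strand `Z` is inside the handle `i`: the factors up to the second slot of `i` are left
unchanged, the strand comes out of that slot by `emission ψ`, and then passes the remaining
factors. (In a word without that slot the value is `0`; this case does not occur in the words
of admissible gluings.) -/
def strandOut (i : K) {y y' : K → Fin R.card} (X : C) {Z : C}
    (ψ : R.obj (y' i) ⟶ Z ⊗ R.obj (y i)) :
    ∀ t : List (Slot K), wordObj R y X t ⟶ wordObj R y' X t ⊗ Z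
  | [] => 0
  | .second j :: t =>
      if h : j = i then
        (emission (Y := R.obj (y j)) (Y' := R.obj (y' j)) (by subst h; exact ψ)
            ▷ wordObj R y X t) ≫
          (α_ ((R.obj (y' j))ᘁ) Z (wordObj R y X t)).hom ≫
          (R.obj (y' j))ᘁ ◁ cross Z (wordDelta R y y' X t) ≫
          (α_ ((R.obj (y' j))ᘁ) (wordObj R y' X t) Z).inv
      else
        (slotDelta R y y' X (.second j) ⊗ₘ strandOut i X ψ t) ≫
          (α_ ((R.obj (y' j))ᘁ) (wordObj R y' X t) Z).inv
  | .first j :: t =>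
      (slotDelta R y y' X (.first j) ⊗ₘ strandOut i X ψ t) ≫
        (α_ (R.obj (y' j)) (wordObj R y' X t) Z).inv
  | .base :: t =>
      X ◁ strandOut i X ψ t ≫ (α_ X (wordObj R y' X t) Z).inv

/-- The strand `Z` comes from the left, passes the factors before the first slot of the orbit
`i`, is absorbed there by `φ : Z ⊗ Y ⟶ Y'`, and comes out of the second slot. (In a word
without the first slot the value is `0`; this case does not occur in the words of admissible
gluings.) -/
def strandIn (i : K) {y y' : K → Fin R.card} (X : C) {Z : C}
    (φ : Z ⊗ R.obj (y i) ⟶ R.obj (y' i)) (ψ : R.obj (y' i) ⟶ Z ⊗ R.obj (y i)) :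
    ∀ t : List (Slot K), Z ⊗ wordObj R y X t ⟶ wordObj R y' X t ⊗ Z
  | [] => 0
  | .first j :: t =>
      if h : j = i then
        (α_ Z (R.obj (y j)) (wordObj R y X t)).inv ≫
          ((show Z ⊗ R.obj (y j) ⟶ R.obj (y' j) by subst h; exact φ) ⊗ₘ
            strandOut R i X ψ t) ≫
          (α_ (R.obj (y' j)) (wordObj R y' X t) Z).inv
      else
        (α_ Z (R.obj (y j)) (wordObj R y X t)).inv ≫
          cross Z (slotDelta R y y' X (.first j)) ▷ wordObj R y X t ≫
          (α_ (R.obj (y' j)) Z (wordObj R y X t)).hom ≫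
          R.obj (y' j) ◁ strandIn i X φ ψ t ≫
          (α_ (R.obj (y' j)) (wordObj R y' X t) Z).inv
  | .second j :: t =>
      (α_ Z ((R.obj (y j))ᘁ) (wordObj R y X t)).inv ≫
        cross Z (slotDelta R y y' X (.second j)) ▷ wordObj R y X t ≫
        (α_ ((R.obj (y' j))ᘁ) Z (wordObj R y X t)).hom ≫
        (R.obj (y' j))ᘁ ◁ strandIn i X φ ψ t ≫
        (α_ ((R.obj (y' j))ᘁ) (wordObj R y' X t) Z).inv
  | .base :: t =>
      (α_ Z X (wordObj R y X t)).inv ≫ cross Z (𝟙 X) ▷ wordObj R y X t ≫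
        (α_ X Z (wordObj R y X t)).hom ≫ X ◁ strandIn i X φ ψ t ≫
        (α_ X (wordObj R y' X t) Z).inv

end Words

/-! ### The induction functor -/

section Object

variable {C : Type u} [Category.{v} C] [Abelian C] [MonoidalCategory C] [RigidCategory C]
  {n : ℕ} (σ : AdmissibleGluing n) (R : SimpleReps C)

/-- `X_σ`, the direct sum over all colorings of the `n` orbits by `o(C)` of
`X_1 ⊗ ⋯ ⊗ X_n ⊗ X ⊗ X_{n+1} ⊗ ⋯ ⊗ X_{2n}`. -/
def inducedObj (X : C) : C :=
  ⨁ fun y : σ.Orbit → Fin R.card => wordObj R y X σ.word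

/-- `f̄ = id ⊗ f ⊗ id` on every summand. -/
def inducedMap {X Y : C} (f : X ⟶ Y) : inducedObj σ R X ⟶ inducedObj σ R Y :=
  biproduct.map fun y : σ.Orbit → Fin R.card => wordMap R y f σ.word

theorem inducedMap_id (X : C) : inducedMap σ R (𝟙 X) = 𝟙 (inducedObj σ R X) := by
  refine biproduct.hom_ext' _ _ fun y => ?_
  simp [inducedMap, inducedObj, wordMap_id]

theorem inducedMap_comp {X Y Z : C} (f : X ⟶ Y) (g : Y ⟶ Z) :
    inducedMap σ R (f ≫ g) = inducedMap σ R f ≫ inducedMap σ R g := by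
  have h : (biproduct.map fun y : σ.Orbit → Fin R.card => wordMap R y (f ≫ g) σ.word) =
      (biproduct.map fun y : σ.Orbit → Fin R.card => wordMap R y f σ.word) ≫
        biproduct.map fun y : σ.Orbit → Fin R.card => wordMap R y g σ.word := by
    refine biproduct.hom_ext' _ _ fun y => ?_
    rw [biproduct.ι_map, biproduct.ι_map_assoc, biproduct.ι_map, wordMap_comp, Category.assoc]
  exact h

end Object

section Induction

variable (k : Type w) {C : Type u} [Field k] [IsAlgClosed k] [Category.{v} C] [Abelian C]
  [Linear k C] [MonoidalCategory C] [MonoidalPreadditive C] [MonoidalLinear k C]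
  [BraidedCategory C] [RigidCategory C] [RibbonCategory C] [FusionCategory k C]
  {n : ℕ} (σ : AdmissibleGluing n) (R : SimpleReps C)

/-- The `i`-th induced half-braiding `Z ⊗ X_σ ⟶ X_σ ⊗ Z`. Its component from the summand `y` to
the summand `y'` is the sum, over dual bases of `Hom(Z ⊗ y i, y' i)` and `Hom(y' i, Z ⊗ y i)`, of
the morphisms in which the strand `Z` is absorbed in the first slot of the orbit `i` and comes out
of its second slot; it is `0` unless `y` and `y'` agree on the other orbits. -/
def inducedHalfBraiding (X : C) (i : σ.Orbit) (Z : C) :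
    Z ⊗ inducedObj σ R X ⟶ inducedObj σ R X ⊗ Z :=
  ∑ y : σ.Orbit → Fin R.card, ∑ y' : σ.Orbit → Fin R.card,
    Z ◁ biproduct.π (fun y : σ.Orbit → Fin R.card => wordObj R y X σ.word) y ≫
      (∑ l, strandIn R i (y := y) (y' := y') X
        ((dualBases k (Z ⊗ R.obj (y i)) (R.obj (y' i)) (R.simple (y' i))).φ l)
        ((dualBases k (Z ⊗ R.obj (y i)) (R.obj (y' i)) (R.simple (y' i))).φdual l) σ.word) ≫
      biproduct.ι (fun y : σ.Orbit → Fin R.card => wordObj R y X σ.word) y' ▷ Z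

/-- The induction functor `I_σ : C ⥤ Z_σ(C)`, given that the induced half-braidings form a
`σ`-pair and that the induced morphisms are compatible with them. -/
def induction
    (hobj : ∀ X : C, IsSigmaPair σ (inducedObj σ R X) (inducedHalfBraiding k σ R X))
    (hmap : ∀ {X Y : C} (f : X ⟶ Y), IsSigmaHom σ (inducedHalfBraiding k σ R X)
      (inducedHalfBraiding k σ R Y) (inducedMap σ R f)) :
    C ⥤ SigmaCenter C σ where
  obj X := ⟨inducedObj σ R X, inducedHalfBraiding k σ R X, hobj X⟩
  map f := ⟨inducedMap σ R f, hmap f⟩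
  map_id X := SigmaCenter.Hom.ext (inducedMap_id σ R X)
  map_comp f g := SigmaCenter.Hom.ext (inducedMap_comp σ R f g)

end Induction

/-! ### Ambidextrous adjunctions -/

/-- `I` is both a left adjoint and a right adjoint of `F`. -/
structure AmbidextrousAdjunction {C : Type*} {D : Type*} [Category C] [Category D]
    (I : C ⥤ D) (F : D ⥤ C) where
  left : I ⊣ F
  right : F ⊣ I

namespace AmbidextrousAdjunction

variable {C : Type*} {D : Type*} [Category C] [Category D] {I : C ⥤ D} {F : D ⥤ C}
  (A : AmbidextrousAdjunction I F)

/-- The endofunctor `T = I F` of `D` is a monad through `F ⊣ I` and a comonad through `I ⊣ F`.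
This bimonad has unity trace if the composition `1 ⟶ T ⟶ 1` of the unit of the monad and the
counit of the comonad is the identity. -/
def HasUnityTrace : Prop :=
  ∀ x : D, A.right.toMonad.η.app x ≫ A.left.toComonad.ε.app x = 𝟙 x

/-- The map `Hom_C(F x, F y) ⟶ Hom_D(x, y)` obtained by composing the adjunction isomorphism
`Hom_C(F x, F y) = Hom_D(x, T y)` with the counit `T y ⟶ y`. -/
def proj (x y : D) (f : F.obj x ⟶ F.obj y) : x ⟶ y :=
  A.right.homEquiv x (F.obj y) f ≫ A.left.toComonad.ε.app y

end AmbidextrousAdjunction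

end HigherGenera

end

/-! Read a morphism `Z ⊗ A ⟶ B ⊗ W` as a square which a strand crosses from left to right. Between
two summands of `X_σ` the induced half-braiding is a sum over dual bases of horizontal products of
squares, one per slot: a crossing, an absorption or an emission. By the interchange law
`vstack_hcomp` two strands are compared slot by slot, and each local comparison is naturality of the
braiding. For one handle this gives the hexagon, because composites of dual bases through all
intermediate simple objects form a complete system again (`component_comp`). For two handles the
order of the two emissions decides which crossing remains at the right end; this gives the second
and third commutative relations. For separated handles, the first strand is braided back to the left
after its exit, so that it no longer meets the second handle; the double braiding in the first
relation records this.

Both adjunctions come from one averaging operator. Compositions below are in diagrammatic order. For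
an orbit with half-braidings γ, β of X, Y, and f : X ⟶ Y, put P(f) = D⁻¹ Σ_a d_a ptr_a(γ_a⁻¹ (a ⊗ f)
β_a), where ptr_a closes the strand a to a loop and D = Σ_a d_a². The handle slide (`handle_slide`)
makes P(f) compatible with γ and β. Compatibility with another orbit survives P, because the
commutative relations let the strand of that orbit pass the loop (`average_isHom_of_ne`). A
compatible f is fixed, since the loops then contribute Σ_a d_a² = D. So the product π of the
operators P over all orbits (`sigmaProjection`) is a natural projection onto the morphisms of
`Z_σ(C)`. That D ≠ 0 holds in characteristic 0 because D is an eigenvalue of the Gram matrix of the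
fusion coefficients, whose determinant is a nonzero integer (`globalDim_ne_zero`).

Let ι and ϖ be the inclusion and projection of the summand of `X_σ` with trivial colors, a copy of
X. In an average of maps through this summand only the term of the unit object survives restriction
to it, as there are no nonzero maps a ⊗ 𝟙 ⟶ 𝟙 for a nontrivial simple a. Conversely the
half-braidings carry the trivial summand onto every other one (`eq_zero_of_colorProj_comp`). With m
orbits and c = D⁻ᵐ this yields π(ϖ ι) = c, ι π(ϖ f) = c f and π(f ι) ϖ = c f. Hence g ↦ ι g has the
inverse f ↦ c⁻¹ π(ϖ f), and f ↦ π(f ι) has the inverse g ↦ c⁻¹ g ϖ: these are the two adjunctions.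
The projection built from them is π(f ι) c⁻¹ π(ϖ) = π(f), and unity trace is the case π(1) = 1. -/

open CategoryTheory MonoidalCategory Limits

noncomputable section

namespace HigherGenera

set_option linter.unusedSectionVars false

attribute [local instance] Abelian.hasFiniteBiproducts

universe v u w

/-! ### Calculus of squares in a monoidal category -/

section Squares

variable {C : Type u} [Category.{v} C] [MonoidalCategory C]

/-- Horizontal composition of squares: the strand leaving the first square enters the second. -/
def hcomp {Z W V A B A' B' : C} (f : Z ⊗ A ⟶ B ⊗ W) (g : W ⊗ A' ⟶ B' ⊗ V) :
    Z ⊗ (A ⊗ A') ⟶ (B ⊗ B') ⊗ V :=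
  (α_ Z A A').inv ≫ f ▷ A' ≫ (α_ B W A').hom ≫ B ◁ g ≫ (α_ B B' V).inv

/-- Vertical composition of squares, `b` first. -/
def vstack {Z₁ Z₂ W₁ W₂ A B D : C} (a : Z₂ ⊗ B ⟶ D ⊗ W₂) (b : Z₁ ⊗ A ⟶ B ⊗ W₁) :
    (Z₂ ⊗ Z₁) ⊗ A ⟶ D ⊗ (W₂ ⊗ W₁) :=
  (α_ Z₂ Z₁ A).hom ≫ Z₂ ◁ b ≫ (α_ Z₂ B W₁).inv ≫ a ▷ W₁ ≫ (α_ D W₂ W₁).hom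

theorem stack_eq_vstack {X Z₁ Z₂ : C} (a : Z₂ ⊗ X ⟶ X ⊗ Z₂) (b : Z₁ ⊗ X ⟶ X ⊗ Z₁) :
    stack a b = vstack a b := rfl

/-- The upper left square and the lower right square touch disjoint strands, so whisker exchange
swaps them. All comparisons of two strands rest on this interchange law. -/
theorem vstack_hcomp {Z₁ Z₂ W₁ W₂ V₁ V₂ A B D A' B' D' : C}
    (a : Z₂ ⊗ B ⟶ D ⊗ W₂) (a' : W₂ ⊗ B' ⟶ D' ⊗ V₂)
    (b : Z₁ ⊗ A ⟶ B ⊗ W₁) (b' : W₁ ⊗ A' ⟶ B' ⊗ V₁) :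
    vstack (hcomp a a') (hcomp b b') = hcomp (vstack a b) (vstack a' b') := by
  calc
    _ = 𝟙 _ ⊗≫ Z₂ ◁ b ▷ A' ⊗≫ ((Z₂ ⊗ B) ◁ b' ≫ a ▷ (B' ⊗ V₁)) ⊗≫ D ◁ a' ▷ V₁ ⊗≫ 𝟙 _ := by
      dsimp only [vstack, hcomp]
      monoidal
    _ = 𝟙 _ ⊗≫ Z₂ ◁ b ▷ A' ⊗≫ (a ▷ (W₁ ⊗ A') ≫ (D ⊗ W₂) ◁ b') ⊗≫ D ◁ a' ▷ V₁ ⊗≫ 𝟙 _ := by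
      rw [whisker_exchange]
    _ = _ := by
      dsimp only [vstack, hcomp]
      monoidal

theorem whiskerRight_hcomp {Y Z W V A B A' B' : C} (p : Y ⟶ Z) (f : Z ⊗ A ⟶ B ⊗ W)
    (g : W ⊗ A' ⟶ B' ⊗ V) : p ▷ (A ⊗ A') ≫ hcomp f g = hcomp (p ▷ A ≫ f) g := by
  dsimp only [hcomp]
  monoidal

theorem hcomp_whiskerLeft {Z W V U A B A' B' : C} (f : Z ⊗ A ⟶ B ⊗ W)
    (g : W ⊗ A' ⟶ B' ⊗ V) (r : V ⟶ U) :
    hcomp f g ≫ (B ⊗ B') ◁ r = hcomp f (g ≫ B' ◁ r) := by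
  dsimp only [hcomp]
  monoidal

/-- A morphism on the strand between two squares may be attributed to either of them; in this way a
relation is handed from one slot to the next. -/
theorem hcomp_slide {Z W W' V A B A' B' : C} (f : Z ⊗ A ⟶ B ⊗ W) (q : W ⟶ W')
    (g : W' ⊗ A' ⟶ B' ⊗ V) : hcomp (f ≫ B ◁ q) g = hcomp f (q ▷ A' ≫ g) := by
  dsimp only [hcomp]
  monoidal

theorem whiskerLeft_hcomp {Z W V A B A' B' D D' : C} (m : D ⟶ A) (m' : D' ⟶ A')
    (f : Z ⊗ A ⟶ B ⊗ W) (g : W ⊗ A' ⟶ B' ⊗ V) :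
    Z ◁ (m ⊗ₘ m') ≫ hcomp f g = hcomp (Z ◁ m ≫ f) (W ◁ m' ≫ g) := by
  calc
    _ = 𝟙 _ ⊗≫ Z ◁ m ▷ D' ⊗≫ ((Z ⊗ A) ◁ m' ≫ f ▷ A') ⊗≫ B ◁ g ⊗≫ 𝟙 _ := by
      rw [MonoidalCategory.tensorHom_def]
      dsimp only [hcomp]
      monoidal
    _ = _ := by
      rw [whisker_exchange]
      dsimp only [hcomp]
      monoidal

theorem hcomp_whiskerRight {Z W V A B A' B' D D' : C} (m : B ⟶ D) (m' : B' ⟶ D')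
    (f : Z ⊗ A ⟶ B ⊗ W) (g : W ⊗ A' ⟶ B' ⊗ V) :
    hcomp f g ≫ (m ⊗ₘ m') ▷ V = hcomp (f ≫ m ▷ W) (g ≫ m' ▷ V) := by
  calc
    _ = 𝟙 _ ⊗≫ f ▷ A' ⊗≫ (B ◁ g ≫ m ▷ (B' ⊗ V)) ⊗≫ D ◁ m' ▷ V ⊗≫ 𝟙 _ := by
      rw [MonoidalCategory.tensorHom_def]
      dsimp only [hcomp]
      monoidal
    _ = _ := by
      rw [whisker_exchange]
      dsimp only [hcomp]
      monoidal

theorem whiskerLeft_vstack {Z₁ Z₂ W₁ W₂ A A' B D : C} (m : A' ⟶ A)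
    (a : Z₂ ⊗ B ⟶ D ⊗ W₂) (b : Z₁ ⊗ A ⟶ B ⊗ W₁) :
    (Z₂ ⊗ Z₁) ◁ m ≫ vstack a b = vstack a (Z₁ ◁ m ≫ b) := by
  dsimp only [vstack]
  monoidal

theorem vstack_whiskerRight {Z₁ Z₂ W₁ W₂ A B D D' : C} (m : D ⟶ D')
    (a : Z₂ ⊗ B ⟶ D ⊗ W₂) (b : Z₁ ⊗ A ⟶ B ⊗ W₁) :
    vstack a b ≫ m ▷ (W₂ ⊗ W₁) = vstack (a ≫ m ▷ W₂) b := by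
  dsimp only [vstack]
  monoidal

end Squares

/-! ### Crossing squares and naturality of the braiding -/

section Braided

variable {C : Type u} [Category.{v} C] [MonoidalCategory C] [BraidedCategory C]

theorem cross_comp_whiskerRight {Z A B D : C} (f : A ⟶ B) (g : B ⟶ D) :
    cross Z f ≫ g ▷ Z = cross Z (f ≫ g) := by
  simp [cross]

theorem whiskerLeft_comp_cross {Z A B D : C} (f : A ⟶ B) (g : B ⟶ D) :
    Z ◁ f ≫ cross Z g = cross Z (f ≫ g) := by
  simp [cross, BraidedCategory.braiding_inv_naturality_right_assoc]

theorem whiskerRight_comp_cross {Z W A B : C} (f : A ⟶ B) (h : Z ⟶ W) :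
    h ▷ A ≫ cross W f = cross Z f ≫ B ◁ h := by
  simp [cross, BraidedCategory.braiding_inv_naturality_left_assoc, whisker_exchange]

theorem braiding_inv_eq_hcomp (A A' Z : C) :
    (β_ (A ⊗ A') Z).inv = hcomp (β_ A Z).inv (β_ A' Z).inv := by
  simp [hcomp]

theorem cross_tensorHom {Z A B A' B' : C} (f : A ⟶ B) (g : A' ⟶ B') :
    cross Z (f ⊗ₘ g) = hcomp (cross Z f) (cross Z g) := by
  rw [cross, braiding_inv_eq_hcomp, hcomp_whiskerRight, cross, cross]

/-- The strand `V` passes under a whole square. -/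
theorem vstack_cross_left {V W W' A A₁ B B₁ : C} (f : W ⊗ A ⟶ B ⊗ W') (f' : W ⊗ A₁ ⟶ B₁ ⊗ W')
    (h : A ⟶ A₁) (g : B ⟶ B₁) (e : f ≫ g ▷ W' = W ◁ h ≫ f') :
    vstack (cross V g) f ≫ B₁ ◁ (β_ W' V).inv =
      (β_ W V).inv ▷ A ≫ vstack f' (cross V h) := by
  calc
    _ = (α_ V W A).hom ≫ (V ◁ (f ≫ g ▷ W') ≫ (β_ (B₁ ⊗ W') V).inv) ≫ (α_ _ _ _).hom := by
      rw [MonoidalCategory.whiskerLeft_comp, Category.assoc, Category.assoc,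
        BraidedCategory.braiding_inv_naturality_right_assoc, braiding_inv_eq_hcomp]
      calc
        _ = 𝟙 _ ⊗≫ V ◁ f ⊗≫ (β_ B V).inv ▷ W' ⊗≫ (g ▷ (V ⊗ W') ≫ B₁ ◁ (β_ W' V).inv) ⊗≫ 𝟙 _ := by
          dsimp only [vstack, cross]
          monoidal
        _ = _ := by
          rw [← whisker_exchange]
          dsimp only [hcomp]
          monoidal
    _ = _ := by
      rw [BraidedCategory.braiding_inv_naturality_right, e, braiding_inv_eq_hcomp]
      dsimp only [vstack, hcomp, cross]
      simp only [comp_whiskerRight, Category.assoc, MonoidalCategory.whiskerLeft_comp]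
      simp only [whisker_assoc, Category.assoc]
      simp

/-- The strand `V` passes under a whole square, in the other order. -/
theorem vstack_cross_right {V W W' A A₁ B B₁ : C} (f : W ⊗ A ⟶ B ⊗ W') (f' : W ⊗ A₁ ⟶ B₁ ⊗ W')
    (h : A ⟶ A₁) (g : B ⟶ B₁) (e : W ◁ h ≫ f' = f ≫ g ▷ W') :
    vstack f' (cross V h) ≫ B₁ ◁ (β_ W' V).hom =
      (β_ W V).hom ▷ A ≫ vstack (cross V g) f := by
  rw [← cancel_epi ((β_ W V).inv ▷ A), ← reassoc_of% (vstack_cross_left f f' h g e.symm)]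
  simp [← comp_whiskerRight_assoc, ← MonoidalCategory.whiskerLeft_comp]

theorem cross_unit {A B : C} (f : A ⟶ B) : cross (𝟙_ C) f = (λ_ A).hom ≫ f ≫ (ρ_ B).inv := by
  simp [cross, braiding_inv_tensorUnit_right]

end Braided

/-! ### Additivity and linearity of horizontal composition -/

section Additive

variable {C : Type u} [Category.{v} C] [Preadditive C] [MonoidalCategory C] [MonoidalPreadditive C]

theorem hcomp_zero_left {Z W V A B A' B' : C} (g : W ⊗ A' ⟶ B' ⊗ V) :
    hcomp (0 : Z ⊗ A ⟶ B ⊗ W) g = 0 := by simp [hcomp]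

theorem hcomp_zero_right {Z W V A B A' B' : C} (f : Z ⊗ A ⟶ B ⊗ W) :
    hcomp f (0 : W ⊗ A' ⟶ B' ⊗ V) = 0 := by simp [hcomp]

theorem hcomp_add_left {Z W V A B A' B' : C} (f f' : Z ⊗ A ⟶ B ⊗ W) (g : W ⊗ A' ⟶ B' ⊗ V) :
    hcomp (f + f') g = hcomp f g + hcomp f' g := by simp [hcomp]

theorem hcomp_add_right {Z W V A B A' B' : C} (f : Z ⊗ A ⟶ B ⊗ W) (g g' : W ⊗ A' ⟶ B' ⊗ V) :
    hcomp f (g + g') = hcomp f g + hcomp f g' := by simp [hcomp]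

variable {k : Type w} [Field k] [Linear k C] [MonoidalLinear k C]

theorem hcomp_smul_left {Z W V A B A' B' : C} (c : k) (f : Z ⊗ A ⟶ B ⊗ W)
    (g : W ⊗ A' ⟶ B' ⊗ V) : hcomp (c • f) g = c • hcomp f g := by simp [hcomp]

theorem hcomp_smul_right {Z W V A B A' B' : C} (c : k) (f : Z ⊗ A ⟶ B ⊗ W)
    (g : W ⊗ A' ⟶ B' ⊗ V) : hcomp f (c • g) = c • hcomp f g := by simp [hcomp]

end Additive

/-! ### Tensor products along words -/

section Products

variable {C : Type u} [Category.{v} C] [MonoidalCategory C] {S : Type} {O O' O'' : S → C}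

/-- The tensor product of a word of objects, bracketed to the right and ending in the unit. -/
@[reducible] def prodObj (O : S → C) : List S → C
  | [] => 𝟙_ C
  | s :: t => O s ⊗ prodObj O t

/-- The tensor product along a word of a family of morphisms. -/
def prodMap (m : ∀ s, O s ⟶ O' s) : ∀ t, prodObj O t ⟶ prodObj O' t
  | [] => 𝟙 (𝟙_ C)
  | s :: t => m s ⊗ₘ prodMap m t

theorem prodMap_cons (m : ∀ s, O s ⟶ O' s) (s : S) (t : List S) :
    prodMap m (s :: t) = m s ⊗ₘ prodMap m t := rfl

theorem prodMap_congr {m m' : ∀ s, O s ⟶ O' s} {t : List S} (h : ∀ s ∈ t, m s = m' s) :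
    prodMap m t = prodMap m' t := by
  induction t with
  | nil => rfl
  | cons s t ih =>
    rw [prodMap_cons, prodMap_cons, h s (by simp), ih fun s hs => h s (by simp [hs])]

theorem prodMap_comp (m : ∀ s, O s ⟶ O' s) (m' : ∀ s, O' s ⟶ O'' s) (t : List S) :
    prodMap m t ≫ prodMap m' t = prodMap (fun s => m s ≫ m' s) t := by
  induction t with
  | nil => simp [prodMap]
  | cons s t ih =>
    rw [prodMap_cons, prodMap_cons, tensorHom_comp_tensorHom, ih]
    rfl

theorem prodMap_id (t : List S) : prodMap (fun s => 𝟙 (O s)) t = 𝟙 (prodObj O t) := by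
  induction t with
  | nil => rfl
  | cons s t ih => rw [prodMap_cons, ih, id_tensorHom_id]

theorem prodMap_eq_zero [Preadditive C] [MonoidalPreadditive C] {m : ∀ s, O s ⟶ O' s}
    {t : List S} {s : S} (hs : s ∈ t) (h : m s = 0) : prodMap m t = 0 := by
  induction t with
  | nil => simp at hs
  | cons s' t ih =>
    rw [prodMap_cons]
    rcases List.mem_cons.mp hs with rfl | hs
    · rw [h, MonoidalPreadditive.zero_tensor]
    · rw [ih hs, MonoidalPreadditive.tensor_zero]

theorem isIso_prodMap {m : ∀ s, O s ⟶ O' s} {t : List S} (hm : ∀ s ∈ t, IsIso (m s)) :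
    IsIso (prodMap m t) := by
  induction t with
  | nil => exact inferInstanceAs (IsIso (𝟙 (𝟙_ C)))
  | cons s t ih =>
    have := hm s (by simp)
    have := ih fun s hs => hm s (by simp [hs])
    rw [prodMap_cons]
    infer_instance

end Products

/-! ### Strands running through one handle of a word -/

section Sweeps

variable {C : Type u} [Category.{v} C] [Preadditive C] [MonoidalCategory C] [BraidedCategory C]
  {S : Type} {O O' O'' : S → C}

open Classical in
/-- A strand `W` comes out of the slot `q` and passes under the rest of the word. -/
def sweepOut (m : ∀ s, O s ⟶ O' s) (q : S) {W : C} (χ : O q ⟶ O' q ⊗ W) :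
    ∀ t : List S, 𝟙_ C ⊗ prodObj O t ⟶ prodObj O' t ⊗ W
  -- The default value 0 is reached only if the slot `q` does not occur in the word.
  | [] => 0
  | s :: t =>
    if h : s = q then by
      subst h
      exact hcomp ((λ_ _).hom ≫ χ) (cross W (prodMap m t))
    -- Inside the handle the strand is taken to be the unit object, so that an untouched slot is a
    -- crossing square too and all slots have the same form.
    else hcomp (cross (𝟙_ C) (m s)) (sweepOut m q χ t)

open Classical in
/-- A strand `Z` passes under the slots before `p`, is absorbed in `p`, and a strand `W` comes
out of the slot `q` and passes under the rest of the word. -/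
def sweepIn (m : ∀ s, O s ⟶ O' s) (p q : S) {Z W : C} (φ : Z ⊗ O p ⟶ O' p)
    (χ : O q ⟶ O' q ⊗ W) : ∀ t : List S, Z ⊗ prodObj O t ⟶ prodObj O' t ⊗ W
  | [] => 0
  | s :: t =>
    if h : s = p then by
      subst h
      exact hcomp (φ ≫ (ρ_ _).inv) (sweepOut m q χ t)
    else hcomp (cross Z (m s)) (sweepIn m p q φ χ t)

section

variable (m : ∀ s, O s ⟶ O' s) (p q : S) {Z W : C} (φ : Z ⊗ O p ⟶ O' p)
    (χ : O q ⟶ O' q ⊗ W)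

theorem sweepOut_self (t : List S) : sweepOut m q χ (q :: t) =
    hcomp ((λ_ _).hom ≫ χ) (cross W (prodMap m t)) := by
  rw [sweepOut, dif_pos rfl]

theorem sweepOut_ne {s : S} (h : s ≠ q) (t : List S) :
    sweepOut m q χ (s :: t) = hcomp (cross (𝟙_ C) (m s)) (sweepOut m q χ t) := by
  rw [sweepOut, dif_neg h]

theorem sweepIn_self (t : List S) : sweepIn m p q φ χ (p :: t) =
    hcomp (φ ≫ (ρ_ _).inv) (sweepOut m q χ t) := by
  rw [sweepIn, dif_pos rfl]

theorem sweepIn_ne {s : S} (h : s ≠ p) (t : List S) :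
    sweepIn m p q φ χ (s :: t) = hcomp (cross Z (m s)) (sweepIn m p q φ χ t) := by
  rw [sweepIn, dif_neg h]

end

/-- Here and in the next lemmas: a sweep is a horizontal product, so slotwise morphisms above or
below it, and morphisms of the strand, are absorbed into the single squares by naturality. -/
theorem whiskerLeft_prodMap_sweepOut (n : ∀ s, O s ⟶ O' s) (m : ∀ s, O' s ⟶ O'' s) (q : S) {W : C}
    (χ : O' q ⟶ O'' q ⊗ W) (t : List S) :
    _ ◁ prodMap n t ≫ sweepOut m q χ t = sweepOut (fun s => n s ≫ m s) q (n q ≫ χ) t := by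
  induction t with
  | nil => simp [sweepOut]
  | cons s t ih =>
    by_cases h : s = q
    · subst h
      rw [sweepOut_self, sweepOut_self, prodMap_cons, whiskerLeft_hcomp, whiskerLeft_comp_cross,
        prodMap_comp]
      simp
    · rw [sweepOut_ne _ _ _ h, sweepOut_ne _ _ _ h, prodMap_cons, whiskerLeft_hcomp, ih,
        whiskerLeft_comp_cross]

theorem sweepOut_prodMap_whiskerRight (m : ∀ s, O s ⟶ O' s) (n : ∀ s, O' s ⟶ O'' s) (q : S) {W : C}
    (χ : O q ⟶ O' q ⊗ W) (t : List S) :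
    sweepOut m q χ t ≫ prodMap n t ▷ W = sweepOut (fun s => m s ≫ n s) q (χ ≫ n q ▷ W) t := by
  induction t with
  | nil => simp [sweepOut]
  | cons s t ih =>
    by_cases h : s = q
    · subst h
      rw [sweepOut_self, sweepOut_self, prodMap_cons, hcomp_whiskerRight, cross_comp_whiskerRight,
        prodMap_comp]
      simp
    · rw [sweepOut_ne _ _ _ h, sweepOut_ne _ _ _ h, prodMap_cons, hcomp_whiskerRight, ih,
        cross_comp_whiskerRight]

theorem whiskerLeft_prodMap_sweepIn (n : ∀ s, O s ⟶ O' s) (m : ∀ s, O' s ⟶ O'' s) (p q : S)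
    {Z W : C} (φ : Z ⊗ O' p ⟶ O'' p) (χ : O' q ⟶ O'' q ⊗ W) (t : List S) :
    Z ◁ prodMap n t ≫ sweepIn m p q φ χ t =
      sweepIn (fun s => n s ≫ m s) p q (Z ◁ n p ≫ φ) (n q ≫ χ) t := by
  induction t with
  | nil => simp [sweepIn]
  | cons s t ih =>
    by_cases h : s = p
    · subst h
      rw [sweepIn_self, sweepIn_self, prodMap_cons, whiskerLeft_hcomp,
        whiskerLeft_prodMap_sweepOut, Category.assoc]
    · rw [sweepIn_ne _ _ _ _ _ h, sweepIn_ne _ _ _ _ _ h, prodMap_cons, whiskerLeft_hcomp, ih,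
        whiskerLeft_comp_cross]

theorem sweepIn_prodMap_whiskerRight (m : ∀ s, O s ⟶ O' s) (n : ∀ s, O' s ⟶ O'' s) (p q : S)
    {Z W : C} (φ : Z ⊗ O p ⟶ O' p) (χ : O q ⟶ O' q ⊗ W) (t : List S) :
    sweepIn m p q φ χ t ≫ prodMap n t ▷ W =
      sweepIn (fun s => m s ≫ n s) p q (φ ≫ n p) (χ ≫ n q ▷ W) t := by
  induction t with
  | nil => simp [sweepIn]
  | cons s t ih =>
    by_cases h : s = p
    · subst h
      rw [sweepIn_self, sweepIn_self, prodMap_cons, hcomp_whiskerRight,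
        sweepOut_prodMap_whiskerRight]
      simp
    · rw [sweepIn_ne _ _ _ _ _ h, sweepIn_ne _ _ _ _ _ h, prodMap_cons, hcomp_whiskerRight, ih,
        cross_comp_whiskerRight]

theorem whiskerRight_sweepIn (m : ∀ s, O s ⟶ O' s) (p q : S) {Y Z W : C} (h : Y ⟶ Z)
    (φ : Z ⊗ O p ⟶ O' p) (χ : O q ⟶ O' q ⊗ W) (t : List S) :
    h ▷ prodObj O t ≫ sweepIn m p q φ χ t = sweepIn m p q (h ▷ O p ≫ φ) χ t := by
  induction t with
  | nil => simp [sweepIn]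
  | cons s t ih =>
    by_cases e : s = p
    · subst e
      rw [sweepIn_self, sweepIn_self, whiskerRight_hcomp, Category.assoc]
    · rw [sweepIn_ne _ _ _ _ _ e, sweepIn_ne _ _ _ _ _ e, whiskerRight_hcomp,
        whiskerRight_comp_cross, hcomp_slide, ih]

theorem sweepOut_whiskerLeft (m : ∀ s, O s ⟶ O' s) (q : S) {V W : C} (h : W ⟶ V)
    (χ : O q ⟶ O' q ⊗ W) (t : List S) :
    sweepOut m q χ t ≫ prodObj O' t ◁ h = sweepOut m q (χ ≫ O' q ◁ h) t := by
  induction t with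
  | nil => simp [sweepOut]
  | cons s t ih =>
    by_cases e : s = q
    · subst e
      rw [sweepOut_self, sweepOut_self, hcomp_whiskerLeft, ← whiskerRight_comp_cross,
        ← hcomp_slide, Category.assoc]
    · rw [sweepOut_ne _ _ _ e, sweepOut_ne _ _ _ e, hcomp_whiskerLeft, ih]

theorem sweepIn_whiskerLeft (m : ∀ s, O s ⟶ O' s) (p q : S) {V Z W : C} (h : W ⟶ V)
    (φ : Z ⊗ O p ⟶ O' p) (χ : O q ⟶ O' q ⊗ W) (t : List S) :
    sweepIn m p q φ χ t ≫ prodObj O' t ◁ h = sweepIn m p q φ (χ ≫ O' q ◁ h) t := by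
  induction t with
  | nil => simp [sweepIn]
  | cons s t ih =>
    by_cases e : s = p
    · subst e
      rw [sweepIn_self, sweepIn_self, hcomp_whiskerLeft, sweepOut_whiskerLeft]
    · rw [sweepIn_ne _ _ _ _ _ e, sweepIn_ne _ _ _ _ _ e, hcomp_whiskerLeft, ih]

section Vanishing

variable [MonoidalPreadditive C]

theorem cross_zero {Z A B : C} : cross Z (0 : A ⟶ B) = 0 := by simp [cross]

theorem sweepOut_eq_zero {m : ∀ s, O s ⟶ O' s} {q : S} {W : C} {χ : O q ⟶ O' q ⊗ W} {t : List S}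
    {s : S} (hs : s ∈ t) (hq : s ≠ q) (h : m s = 0) : sweepOut m q χ t = 0 := by
  induction t with
  | nil => simp at hs
  | cons s' t ih =>
    by_cases e : s' = q
    · subst e
      rw [sweepOut_self, prodMap_eq_zero ((List.mem_cons.mp hs).resolve_left hq) h, cross_zero,
        hcomp_zero_right]
    · rw [sweepOut_ne _ _ _ e]
      rcases List.mem_cons.mp hs with rfl | hs
      · rw [h, cross_zero, hcomp_zero_left]
      · rw [ih hs, hcomp_zero_right]

theorem sweepIn_eq_zero {m : ∀ s, O s ⟶ O' s} {p q : S} {Z W : C} {φ : Z ⊗ O p ⟶ O' p}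
    {χ : O q ⟶ O' q ⊗ W} {t : List S}
    {s : S} (hs : s ∈ t) (hp : s ≠ p) (hq : s ≠ q) (h : m s = 0) : sweepIn m p q φ χ t = 0 := by
  induction t with
  | nil => simp at hs
  | cons s' t ih =>
    by_cases e : s' = p
    · subst e
      rw [sweepIn_self, sweepOut_eq_zero ((List.mem_cons.mp hs).resolve_left hp) hq h,
        hcomp_zero_right]
    · rw [sweepIn_ne _ _ _ _ _ e]
      rcases List.mem_cons.mp hs with rfl | hs
      · rw [h, cross_zero, hcomp_zero_left]
      · rw [ih hs, hcomp_zero_right]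

theorem sweepOut_add (m : ∀ s, O s ⟶ O' s) (q : S) {W : C} (χ χ' : O q ⟶ O' q ⊗ W) (t : List S) :
    sweepOut m q (χ + χ') t = sweepOut m q χ t + sweepOut m q χ' t := by
  induction t with
  | nil => simp [sweepOut]
  | cons s t ih =>
    by_cases e : s = q
    · subst e
      simp only [sweepOut_self, Preadditive.comp_add, hcomp_add_left]
    · simp only [sweepOut_ne _ _ _ e, ih, hcomp_add_right]

theorem sweepIn_add_right (m : ∀ s, O s ⟶ O' s) (p q : S) {Z W : C} (φ : Z ⊗ O p ⟶ O' p)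
    (χ χ' : O q ⟶ O' q ⊗ W) (t : List S) :
    sweepIn m p q φ (χ + χ') t = sweepIn m p q φ χ t + sweepIn m p q φ χ' t := by
  induction t with
  | nil => simp [sweepIn]
  | cons s t ih =>
    by_cases e : s = p
    · subst e
      simp only [sweepIn_self, sweepOut_add, hcomp_add_right]
    · simp only [sweepIn_ne _ _ _ _ _ e, ih, hcomp_add_right]

theorem sweepIn_add_left (m : ∀ s, O s ⟶ O' s) (p q : S) {Z W : C} (φ φ' : Z ⊗ O p ⟶ O' p)
    (χ : O q ⟶ O' q ⊗ W) (t : List S) :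
    sweepIn m p q (φ + φ') χ t = sweepIn m p q φ χ t + sweepIn m p q φ' χ t := by
  induction t with
  | nil => simp [sweepIn]
  | cons s t ih =>
    by_cases e : s = p
    · subst e
      simp only [sweepIn_self, Preadditive.add_comp, hcomp_add_left]
    · simp only [sweepIn_ne _ _ _ _ _ e, ih, hcomp_add_right]

section Linear

variable {k : Type w} [Field k] [Linear k C] [MonoidalLinear k C]

theorem sweepOut_smul (m : ∀ s, O s ⟶ O' s) (q : S) {W : C} (c : k) (χ : O q ⟶ O' q ⊗ W)
    (t : List S) : sweepOut m q (c • χ) t = c • sweepOut m q χ t := by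
  induction t with
  | nil => simp [sweepOut]
  | cons s t ih =>
    by_cases e : s = q
    · subst e
      simp only [sweepOut_self, Linear.comp_smul, hcomp_smul_left]
    · simp only [sweepOut_ne _ _ _ e, ih, hcomp_smul_right]

theorem sweepIn_smul_right (m : ∀ s, O s ⟶ O' s) (p q : S) {Z W : C} (c : k)
    (φ : Z ⊗ O p ⟶ O' p) (χ : O q ⟶ O' q ⊗ W) (t : List S) :
    sweepIn m p q φ (c • χ) t = c • sweepIn m p q φ χ t := by
  induction t with
  | nil => simp [sweepIn]
  | cons s t ih =>
    by_cases e : s = p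
    · subst e
      simp only [sweepIn_self, sweepOut_smul, hcomp_smul_right]
    · simp only [sweepIn_ne _ _ _ _ _ e, ih, hcomp_smul_right]

theorem sweepIn_smul_left (m : ∀ s, O s ⟶ O' s) (p q : S) {Z W : C} (c : k)
    (φ : Z ⊗ O p ⟶ O' p) (χ : O q ⟶ O' q ⊗ W) (t : List S) :
    sweepIn m p q (c • φ) χ t = c • sweepIn m p q φ χ t := by
  induction t with
  | nil => simp [sweepIn]
  | cons s t ih =>
    by_cases e : s = p
    · subst e
      simp only [sweepIn_self, Linear.smul_comp, hcomp_smul_left]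
    · simp only [sweepIn_ne _ _ _ _ _ e, ih, hcomp_smul_right]

end Linear

end Vanishing

end Sweeps

/-! ### The order of the relevant slots in a word -/

section Patterns

variable {S : Type}

open Classical in
/-- The subword of `t` of the slots that occur in `L`. -/
def pattern (L t : List S) : List S := t.filter (· ∈ L)

theorem pattern_eq_nil {L t : List S} (h : pattern L t = []) : ∀ s ∈ t, s ∉ L := by
  simpa [pattern] using h

-- Sweeps only depend on the order of the few active slots. A word is therefore read until the next
-- active slot, and the property need only be propagated over inactive slots and checked at the hit.
@[elab_as_elim]
theorem pattern_induction {L : List S} {a : S} {l : List S} {P : List S → Prop}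
    (pass : ∀ s t, s ∉ L → pattern L t = a :: l → P t → P (s :: t))
    (hit : ∀ t, pattern L t = l → P (a :: t)) (t : List S) (h : pattern L t = a :: l) : P t := by
  classical
  induction t with
  | nil => simp [pattern] at h
  | cons s t ih =>
    by_cases hs : s ∈ L
    · rw [pattern, List.filter_cons_of_pos (by simpa using hs)] at h
      obtain ⟨rfl, h'⟩ := List.cons.inj h
      exact hit t h'
    · rw [pattern, List.filter_cons_of_neg (by simpa using hs)] at h
      exact pass s t hs h (ih h)

end Patterns

/-! ### Two strands through the same handle -/

section Composite

variable {C : Type u} [Category.{v} C] [MonoidalCategory C] [BraidedCategory C]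

theorem vstack_cross_cross {Z₁ Z₂ A B D : C} (f : A ⟶ B) (g : B ⟶ D) :
    vstack (cross Z₂ g) (cross Z₁ f) = cross (Z₂ ⊗ Z₁) (f ≫ g) := by
  dsimp only [vstack, cross]
  rw [BraidedCategory.braiding_tensor_right_inv]
  calc
    _ = 𝟙 _ ⊗≫ Z₂ ◁ (β_ A Z₁).inv ⊗≫ (Z₂ ◁ f ≫ (β_ B Z₂).inv) ▷ Z₁ ⊗≫ g ▷ Z₂ ▷ Z₁ ⊗≫ 𝟙 _ := by
      monoidal
    _ = _ := by
      rw [BraidedCategory.braiding_inv_naturality_right]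
      monoidal

end Composite

section SameHandle

variable {C : Type u} [Category.{v} C] [Preadditive C] [MonoidalCategory C] [BraidedCategory C]
  {S : Type} {O O' O'' : S → C}

theorem vstack_sweepOut_sweepOut {m : ∀ s, O s ⟶ O'' s} {m₁ : ∀ s, O s ⟶ O' s}
    {m₂ : ∀ s, O' s ⟶ O'' s} {L : List S} (hm : ∀ s, s ∉ L → m s = m₁ s ≫ m₂ s)
    (q : S) {W₁ W₂ : C} (χ₁ : O q ⟶ O' q ⊗ W₁) (χ₂ : O' q ⟶ O'' q ⊗ W₂) (hq : q ∈ L)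
    (t : List S) (ht : pattern L t = [q]) :
    vstack (sweepOut m₂ q χ₂ t) (sweepOut m₁ q χ₁ t) =
      (λ_ (𝟙_ C)).hom ▷ _ ≫ sweepOut m q (χ₁ ≫ χ₂ ▷ W₁ ≫ (α_ _ _ _).hom) t := by
  refine pattern_induction (fun s t hs _ ih => ?_) (fun t ht => ?_) t ht
  · have h : s ≠ q := fun e => hs (e ▸ hq)
    rw [sweepOut_ne _ _ _ h, sweepOut_ne _ _ _ h, sweepOut_ne _ _ _ h, vstack_hcomp, ih,
      vstack_cross_cross, whiskerRight_hcomp, whiskerRight_comp_cross, hcomp_slide, hm s hs]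
  · rw [sweepOut_self, sweepOut_self, sweepOut_self, vstack_hcomp, vstack_cross_cross,
      prodMap_comp, whiskerRight_hcomp,
      prodMap_congr fun s hs => (hm s (pattern_eq_nil ht s hs)).symm]
    congr 1
    dsimp only [vstack]
    monoidal

/-- By interchange the two strands fuse slot by slot: crossings combine by the hexagon for the
braiding, and the two absorptions and the two emissions compose. This is the geometric half of the
hexagon axiom for the induced half-braiding. -/
theorem vstack_sweepIn_sweepIn {m : ∀ s, O s ⟶ O'' s} {m₁ : ∀ s, O s ⟶ O' s}
    {m₂ : ∀ s, O' s ⟶ O'' s} {p q : S} (hm : ∀ s, s ∉ [p, q] → m s = m₁ s ≫ m₂ s)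
    {Z₁ Z₂ W₁ W₂ : C} (φ₁ : Z₁ ⊗ O p ⟶ O' p) (φ₂ : Z₂ ⊗ O' p ⟶ O'' p)
    (χ₁ : O q ⟶ O' q ⊗ W₁) (χ₂ : O' q ⟶ O'' q ⊗ W₂)
    (t : List S) (ht : pattern [p, q] t = [p, q]) :
    vstack (sweepIn m₂ p q φ₂ χ₂ t) (sweepIn m₁ p q φ₁ χ₁ t) =
      sweepIn m p q ((α_ _ _ _).hom ≫ Z₂ ◁ φ₁ ≫ φ₂) (χ₁ ≫ χ₂ ▷ W₁ ≫ (α_ _ _ _).hom) t := by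
  refine pattern_induction (fun s t hs _ ih => ?_) (fun t ht => ?_) t ht
  · have h : s ≠ p := fun e => hs (by simp [e])
    rw [sweepIn_ne _ _ _ _ _ h, sweepIn_ne _ _ _ _ _ h, sweepIn_ne _ _ _ _ _ h, vstack_hcomp, ih,
      vstack_cross_cross, hm s hs]
  · rw [sweepIn_self, sweepIn_self, sweepIn_self, vstack_hcomp,
      vstack_sweepOut_sweepOut hm q χ₁ χ₂ (by simp) t ht, ← hcomp_slide]
    congr 1
    dsimp only [vstack]
    monoidal

theorem sweepOut_id (q : S) {L : List S} (hq : q ∈ L) (t : List S) (ht : pattern L t = [q]) :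
    sweepOut (fun s => 𝟙 (O s)) q (ρ_ (O q)).inv t = cross (𝟙_ C) (𝟙 (prodObj O t)) := by
  refine pattern_induction (fun s t hs _ ih => ?_) (fun t ht => ?_) t ht
  · have h : s ≠ q := fun e => hs (e ▸ hq)
    rw [sweepOut_ne _ _ _ h, ih, ← cross_tensorHom, id_tensorHom_id]
  · rw [sweepOut_self, prodMap_id, ← id_tensorHom_id, cross_tensorHom]
    congr 1
    rw [cross_unit, Category.id_comp]

/-- With unitors at both vertices every square is a trivial crossing with the unit object; this
gives the unit component of the induced half-braiding. -/
theorem sweepIn_id (p q : S) (t : List S) (ht : pattern [p, q] t = [p, q]) :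
    sweepIn (fun s => 𝟙 (O s)) p q (λ_ (O p)).hom (ρ_ (O q)).inv t =
      cross (𝟙_ C) (𝟙 (prodObj O t)) := by
  refine pattern_induction (fun s t hs _ ih => ?_) (fun t ht => ?_) t ht
  · rw [sweepIn_ne _ _ _ _ _ (fun e => hs (by simp [e])), ih, ← cross_tensorHom, id_tensorHom_id]
  · rw [sweepIn_self, sweepOut_id q (L := [p, q]) (by simp) t ht, ← id_tensorHom_id, cross_tensorHom]
    congr 1
    rw [cross_unit, Category.id_comp]

theorem sweepOut_congr {m m' : ∀ s, O s ⟶ O' s} {L : List S} (hm : ∀ s, s ∉ L → m s = m' s)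
    {q : S} {W : C} (χ : O q ⟶ O' q ⊗ W) (hq : q ∈ L)
    (t : List S) (ht : pattern L t = [q]) : sweepOut m q χ t = sweepOut m' q χ t := by
  refine pattern_induction (fun s t hs _ ih => ?_) (fun t ht => ?_) t ht
  · have h : s ≠ q := fun e => hs (e ▸ hq)
    rw [sweepOut_ne _ _ _ h, sweepOut_ne _ _ _ h, ih, hm s hs]
  · rw [sweepOut_self, sweepOut_self,
      prodMap_congr fun s hs => hm s (pattern_eq_nil ht s hs)]

theorem sweepIn_congr {m m' : ∀ s, O s ⟶ O' s} {L : List S} (hm : ∀ s, s ∉ L → m s = m' s)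
    {p q : S} {Z W : C} (φ : Z ⊗ O p ⟶ O' p) (χ : O q ⟶ O' q ⊗ W) (hp : p ∈ L) (hq : q ∈ L)
    (t : List S) (ht : pattern L t = [p, q]) :
    sweepIn m p q φ χ t = sweepIn m' p q φ χ t := by
  refine pattern_induction (fun s t hs _ ih => ?_) (fun t ht => ?_) t ht
  · have h : s ≠ p := fun e => hs (e ▸ hp)
    rw [sweepIn_ne _ _ _ _ _ h, sweepIn_ne _ _ _ _ _ h, ih, hm s hs]
  · rw [sweepIn_self, sweepIn_self, sweepOut_congr hm χ hq t ht]

end SameHandle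

/-! ### Two strands through interleaved or nested handles -/

section TwoHandles

/-- Exchange relations can be pasted: the crossing `r` that leaves the left square is the one that
enters the right square. Thus a relation for a word follows from one relation per slot. -/
theorem vstack_hcomp_relation {C : Type u} [Category.{v} C] [MonoidalCategory C]
    {Z₁ Z₂ W₁ W₂ V₁ V₂ A A' B B' D D' E E' : C}
    {a : Z₂ ⊗ B ⟶ D ⊗ W₂} {b : Z₁ ⊗ A ⟶ B ⊗ W₁} {a' : Z₁ ⊗ E ⟶ D ⊗ W₁} {b' : Z₂ ⊗ A ⟶ E ⊗ W₂}
    {p : Z₂ ⊗ Z₁ ⟶ Z₁ ⊗ Z₂} {r : W₂ ⊗ W₁ ⟶ W₁ ⊗ W₂}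
    (h : vstack a b ≫ D ◁ r = p ▷ A ≫ vstack a' b')
    {c : W₂ ⊗ B' ⟶ D' ⊗ V₂} {d : W₁ ⊗ A' ⟶ B' ⊗ V₁} {c' : W₁ ⊗ E' ⟶ D' ⊗ V₁}
    {d' : W₂ ⊗ A' ⟶ E' ⊗ V₂} {s : V₂ ⊗ V₁ ⟶ V₁ ⊗ V₂}
    (h' : vstack c d ≫ D' ◁ s = r ▷ A' ≫ vstack c' d') :
    vstack (hcomp a c) (hcomp b d) ≫ (D ⊗ D') ◁ s =
      p ▷ (A ⊗ A') ≫ vstack (hcomp a' c') (hcomp b' d') := by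
  rw [vstack_hcomp, hcomp_whiskerLeft, h', ← hcomp_slide, h, ← whiskerRight_hcomp, vstack_hcomp]

theorem braiding_unit_inv {C : Type u} [Category.{v} C] [MonoidalCategory C] [BraidedCategory C]
    (V : C) : (β_ (𝟙_ C) V).inv = (β_ V (𝟙_ C)).hom := by
  rw [braiding_inv_tensorUnit_left, braiding_tensorUnit_right]

theorem braiding_unit_inv' {C : Type u} [Category.{v} C] [MonoidalCategory C] [BraidedCategory C]
    (V : C) : (β_ V (𝟙_ C)).inv = (β_ (𝟙_ C) V).hom := by
  rw [braiding_inv_tensorUnit_right, braiding_tensorUnit_left]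

variable {C : Type u} [Category.{v} C] [MonoidalCategory C] {S : Type} {O A B O' : S → C}

/-- The data of two strands moving through two different handles in the two possible orders. -/
structure TwoSweeps (O A B O' : S → C) (p q p' q' : S) (Z W Z' W' : C) where
  m₁ : ∀ s, O s ⟶ A s
  m₂ : ∀ s, A s ⟶ O' s
  n₁ : ∀ s, O s ⟶ B s
  n₂ : ∀ s, B s ⟶ O' s
  comm : ∀ s, s ∉ [p, q, p', q'] → m₁ s ≫ m₂ s = n₁ s ≫ n₂ s
  φ : Z ⊗ O p ⟶ A p
  φn : Z ⊗ B p ⟶ O' p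
  hφ : φ ≫ m₂ p = Z ◁ n₁ p ≫ φn
  χ : O q ⟶ A q ⊗ W
  χn : B q ⟶ O' q ⊗ W
  hχ : χ ≫ m₂ q ▷ W = n₁ q ≫ χn
  φ' : Z' ⊗ A p' ⟶ O' p'
  φn' : Z' ⊗ O p' ⟶ B p'
  hφ' : Z' ◁ m₁ p' ≫ φ' = φn' ≫ n₂ p'
  χ' : A q' ⟶ O' q' ⊗ W'
  χn' : O q' ⟶ B q' ⊗ W'
  hχ' : m₁ q' ≫ χ' = χn' ≫ n₂ q' ▷ W'
  ne₁ : p ≠ p'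
  ne₃ : q ≠ p'
  ne₄ : q ≠ q'

namespace TwoSweeps

variable {p q p' q' : S} {Z W Z' W' : C} (T : TwoSweeps O A B O' p q p' q' Z W Z' W')

theorem ne_of_notMem {s : S} (h : s ∉ [p, q, p', q']) : s ≠ p ∧ s ≠ q ∧ s ≠ p' ∧ s ≠ q' := by
  simpa using h

variable [BraidedCategory C]

theorem cross_relation (V V' : C) {s : S} (hs : s ∉ [p, q, p', q']) :
    vstack (cross V' (T.m₂ s)) (cross V (T.m₁ s)) ≫ _ ◁ (β_ V V').inv =
      (β_ V V').inv ▷ _ ≫ vstack (cross V (T.n₂ s)) (cross V' (T.n₁ s)) :=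
  vstack_cross_left _ _ _ _ (by
    rw [cross_comp_whiskerRight, whiskerLeft_comp_cross, T.comm s hs])

/-- The second strand passes under the whole absorption square of the first one. Afterwards the
first strand is the unit object, and only a crossing with the unit remains. -/
theorem absorb_relation :
    vstack (cross Z' (T.m₂ p)) (T.φ ≫ (ρ_ _).inv) ≫ _ ◁ (β_ (𝟙_ C) Z').inv =
      (β_ Z Z').inv ▷ _ ≫ vstack (T.φn ≫ (ρ_ _).inv) (cross Z' (T.n₁ p)) :=
  vstack_cross_left _ _ _ _ (by simp [← reassoc_of% T.hφ])

theorem absorb_relation' :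
    vstack (T.φ' ≫ (ρ_ _).inv) (cross (𝟙_ C) (T.m₁ p')) ≫ _ ◁ (β_ (𝟙_ C) (𝟙_ C)).inv =
      (β_ (𝟙_ C) Z').inv ▷ _ ≫ vstack (cross (𝟙_ C) (T.n₂ p')) (T.φn' ≫ (ρ_ _).inv) := by
  -- Over- and undercrossings with the unit object agree, so the version with the opposite crossing
  -- applies.
  rw [braiding_unit_inv, braiding_unit_inv]
  exact vstack_cross_right _ _ _ _ (by simp [reassoc_of% T.hφ'])

theorem emit_relation :
    vstack (cross (𝟙_ C) (T.m₂ q)) ((λ_ _).hom ≫ T.χ) ≫ _ ◁ (β_ W (𝟙_ C)).inv =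
      (β_ (𝟙_ C) (𝟙_ C)).inv ▷ _ ≫ vstack ((λ_ _).hom ≫ T.χn) (cross (𝟙_ C) (T.n₁ q)) :=
  vstack_cross_left _ _ _ _ (by simp [T.hχ])

theorem emit_relation' :
    vstack ((λ_ _).hom ≫ T.χ') (cross (𝟙_ C) (T.m₁ q')) ≫ _ ◁ (β_ (𝟙_ C) W').inv =
      (β_ (𝟙_ C) (𝟙_ C)).inv ▷ _ ≫ vstack (cross (𝟙_ C) (T.n₂ q')) ((λ_ _).hom ≫ T.χn') := by
  rw [braiding_unit_inv, braiding_unit_inv]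
  exact vstack_cross_right _ _ _ _ (by simp [T.hχ'])

variable [Preadditive C]

/-- Both strands are before their handles. -/
def RelBB (r : W' ⊗ W ⟶ W ⊗ W') (t : List S) : Prop :=
  vstack (sweepIn T.m₂ p' q' T.φ' T.χ' t) (sweepIn T.m₁ p q T.φ T.χ t) ≫ _ ◁ r =
    (β_ Z Z').inv ▷ _ ≫
      vstack (sweepIn T.n₂ p q T.φn T.χn t) (sweepIn T.n₁ p' q' T.φn' T.χn' t)

/-- The first strand is inside its handle, the second one before its handle. -/
def RelIB (r : W' ⊗ W ⟶ W ⊗ W') (t : List S) : Prop :=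
  vstack (sweepIn T.m₂ p' q' T.φ' T.χ' t) (sweepOut T.m₁ q T.χ t) ≫ _ ◁ r =
    (β_ (𝟙_ C) Z').inv ▷ _ ≫
      vstack (sweepOut T.n₂ q T.χn t) (sweepIn T.n₁ p' q' T.φn' T.χn' t)

/-- Both strands are inside their handles. -/
def RelII (r : W' ⊗ W ⟶ W ⊗ W') (t : List S) : Prop :=
  vstack (sweepOut T.m₂ q' T.χ' t) (sweepOut T.m₁ q T.χ t) ≫ _ ◁ r =
    (β_ (𝟙_ C) (𝟙_ C)).inv ▷ _ ≫
      vstack (sweepOut T.n₂ q T.χn t) (sweepOut T.n₁ q' T.χn' t)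

/-- The handle of the second strand ends inside the handle of the first strand. -/
theorem relII_nested (t : List S) (ht : pattern [p, q, p', q'] t = [q', q]) :
    T.RelII (β_ W W').inv t := by
  refine pattern_induction (fun s t hs _ ih => ?_) (fun t ht => ?_) t ht
  · obtain ⟨hp, hq, hp', hq'⟩ := ne_of_notMem hs
    unfold RelII
    rw [sweepOut_ne _ _ _ hq, sweepOut_ne _ _ _ hq, sweepOut_ne _ _ _ hq', sweepOut_ne _ _ _ hq']
    exact vstack_hcomp_relation (T.cross_relation _ _ hs) ih
  · unfold RelII
    rw [sweepOut_ne _ _ _ T.ne₄.symm, sweepOut_ne _ _ _ T.ne₄.symm, sweepOut_self, sweepOut_self]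
    -- Past its exit the second strand only undercrosses the rest of the word. It therefore passes
    -- under the whole remaining sweep of the first strand, and this creates the crossing of the
    -- output strands.
    refine vstack_hcomp_relation T.emit_relation' (vstack_cross_left _ _ _ _ ?_)
    rw [sweepOut_prodMap_whiskerRight, whiskerLeft_prodMap_sweepOut, T.hχ]
    exact sweepOut_congr T.comm _ (by simp) t ht

/-- The handle of the first strand ends inside the handle of the second strand. -/
theorem relII_crossed (t : List S) (ht : pattern [p, q, p', q'] t = [q, q']) :
    T.RelII (β_ W' W).hom t := by
  refine pattern_induction (fun s t hs _ ih => ?_) (fun t ht => ?_) t ht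
  · obtain ⟨hp, hq, hp', hq'⟩ := ne_of_notMem hs
    unfold RelII
    rw [sweepOut_ne _ _ _ hq, sweepOut_ne _ _ _ hq, sweepOut_ne _ _ _ hq', sweepOut_ne _ _ _ hq']
    exact vstack_hcomp_relation (T.cross_relation _ _ hs) ih
  · unfold RelII
    rw [sweepOut_ne _ _ _ T.ne₄, sweepOut_ne _ _ _ T.ne₄, sweepOut_self, sweepOut_self]
    refine vstack_hcomp_relation T.emit_relation ?_
    rw [braiding_unit_inv']
    -- Now the first strand is outside first and undercrosses the remaining sweep of the second one,
    -- hence the opposite crossing of the output strands.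
    refine vstack_cross_right _ _ _ _ ?_
    rw [sweepOut_prodMap_whiskerRight, whiskerLeft_prodMap_sweepOut, T.hχ']
    exact sweepOut_congr T.comm _ (by simp) t ht

/-- The order of the exits enters only through `h`; the prefix of the word up to the second
absorption is treated alike for nested and crossed handles. -/
theorem relIB {r : W' ⊗ W ⟶ W ⊗ W'} {l : List S}
    (h : ∀ t, pattern [p, q, p', q'] t = l → T.RelII r t) (t : List S)
    (ht : pattern [p, q, p', q'] t = p' :: l) : T.RelIB r t := by
  refine pattern_induction (fun s t hs _ ih => ?_) (fun t ht => ?_) t ht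
  · obtain ⟨hp, hq, hp', hq'⟩ := ne_of_notMem hs
    unfold RelIB
    rw [sweepOut_ne _ _ _ hq, sweepOut_ne _ _ _ hq, sweepIn_ne _ _ _ _ _ hp',
      sweepIn_ne _ _ _ _ _ hp']
    exact vstack_hcomp_relation (T.cross_relation _ _ hs) ih
  · unfold RelIB
    rw [sweepOut_ne _ _ _ T.ne₃.symm, sweepOut_ne _ _ _ T.ne₃.symm, sweepIn_self, sweepIn_self]
    exact vstack_hcomp_relation T.absorb_relation' (h t ht)

theorem relBB {r : W' ⊗ W ⟶ W ⊗ W'} {l : List S}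
    (h : ∀ t, pattern [p, q, p', q'] t = l → T.RelII r t) (t : List S)
    (ht : pattern [p, q, p', q'] t = p :: p' :: l) : T.RelBB r t := by
  refine pattern_induction (fun s t hs _ ih => ?_) (fun t ht => ?_) t ht
  · obtain ⟨hp, hq, hp', hq'⟩ := ne_of_notMem hs
    unfold RelBB
    rw [sweepIn_ne _ _ _ _ _ hp, sweepIn_ne _ _ _ _ _ hp, sweepIn_ne _ _ _ _ _ hp',
      sweepIn_ne _ _ _ _ _ hp']
    exact vstack_hcomp_relation (T.cross_relation _ _ hs) ih
  · unfold RelBB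
    rw [sweepIn_ne _ _ _ _ _ T.ne₁, sweepIn_ne _ _ _ _ _ T.ne₁, sweepIn_self, sweepIn_self]
    exact vstack_hcomp_relation T.absorb_relation (T.relIB h t ht)

end TwoSweeps

end TwoHandles

/-! ### Separated handles: turning the first strand back -/

section Turn

variable {C : Type u} [Category.{v} C] [MonoidalCategory C]

theorem hcomp_assoc {Z W V U A B D A' B' D' : C} (a : Z ⊗ A ⟶ A' ⊗ W) (b : W ⊗ B ⟶ B' ⊗ V)
    (c : V ⊗ D ⟶ D' ⊗ U) :
    hcomp a (hcomp b c) =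
      Z ◁ (α_ A B D).inv ≫ hcomp (hcomp a b) c ≫ (α_ A' B' D').hom ▷ U := by
  dsimp only [hcomp]
  monoidal

variable [BraidedCategory C]

/-- A morphism of the first two factors commutes with a strand that passes under them. -/
theorem hcomp_cross_cross {Z W P Q P₁ Q₁ P₂ Q₂ P' Q' T T' : C} {x : P ⊗ Q ⟶ P₁ ⊗ Q₁}
    {x' : P₂ ⊗ Q₂ ⟶ P' ⊗ Q'} {a : P ⟶ P₂} {b : Q ⟶ Q₂} {a' : P₁ ⟶ P'} {b' : Q₁ ⟶ Q'}
    (h : x ≫ (a' ⊗ₘ b') = (a ⊗ₘ b) ≫ x') (g : Z ⊗ T ⟶ T' ⊗ W) :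
    Z ◁ ((α_ _ _ _).inv ≫ x ▷ T ≫ (α_ _ _ _).hom) ≫
        hcomp (cross Z a') (hcomp (cross Z b') g) =
      hcomp (cross Z a) (hcomp (cross Z b) g) ≫
        ((α_ _ _ _).inv ≫ x' ▷ T' ≫ (α_ _ _ _).hom) ▷ W := by
  rw [hcomp_assoc, hcomp_assoc, ← cross_tensorHom, ← cross_tensorHom]
  have h1 := whiskerLeft_hcomp x (𝟙 T) (cross Z (a' ⊗ₘ b')) g
  have h2 := hcomp_whiskerRight x' (𝟙 T') (cross Z (a ⊗ₘ b)) g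
  rw [whiskerLeft_comp_cross, h, tensorHom_id] at h1
  rw [cross_comp_whiskerRight, tensorHom_id] at h2
  simp only [MonoidalCategory.whiskerLeft_id, Category.id_comp, id_whiskerRight,
    Category.comp_id] at h1 h2
  simp only [MonoidalCategory.whiskerLeft_comp, Category.assoc, comp_whiskerRight,
    whiskerLeft_hom_inv_assoc, hom_inv_whiskerRight_assoc, reassoc_of% h1,
    reassoc_of% h2]

/-- The strand of a square turned back to the left, under the outgoing objects. -/
def turn {L L' V A A' T T' : C} (f : L ⊗ A ⟶ A' ⊗ L') (D : L' ⊗ T ⟶ V ⊗ T') :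
    L ⊗ (A ⊗ T) ⟶ V ⊗ (A' ⊗ T') :=
  ((α_ _ _ _).inv ≫ f ▷ T ≫ (α_ _ _ _).hom) ≫ A' ◁ D ≫
    ((α_ _ _ _).inv ≫ (β_ A' V).hom ▷ T' ≫ (α_ _ _ _).hom)

theorem hcomp_braiding {L L' V A A' T T' : C} (f : L ⊗ A ⟶ A' ⊗ L') (g : L' ⊗ T ⟶ T' ⊗ V) :
    hcomp f g ≫ (β_ (A' ⊗ T') V).hom = turn f (g ≫ (β_ T' V).hom) := by
  simp [hcomp, turn, BraidedCategory.braiding_tensor_left_hom]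

/-- A turned square is a square on the first slot, the turned rest, and a braiding back over that
slot. The strand `Z` commutes with each of these three pieces, for the middle one by `hD`. -/
theorem turn_relation {Z W L L' V A A₁ A₁' A₂ T T₁ T₁' T₂ : C}
    {f : L ⊗ A ⟶ A₁ ⊗ L'} {f' : L ⊗ A₁' ⟶ A₂ ⊗ L'} {h₁ : A ⟶ A₁'} {h₂ : A₁ ⟶ A₂}
    (e : f ≫ h₂ ▷ L' = L ◁ h₁ ≫ f')
    {D : L' ⊗ T ⟶ V ⊗ T₁} {D' : L' ⊗ T₁' ⟶ V ⊗ T₂} {g : Z ⊗ T₁ ⟶ T₂ ⊗ W} {g' : Z ⊗ T ⟶ T₁' ⊗ W}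
    (hD : Z ◁ D ≫ hcomp (cross Z (𝟙 V)) g = hcomp (cross Z (𝟙 L')) g' ≫ D' ▷ W) :
    Z ◁ turn f D ≫ hcomp (cross Z (𝟙 V)) (hcomp (cross Z h₂) g) =
      hcomp (cross Z (𝟙 L)) (hcomp (cross Z h₁) g') ≫ turn f' D' ▷ W := by
  have h1 := hcomp_cross_cross (Z := Z) (x := f) (x' := f') (a := 𝟙 L) (b := h₁) (a' := h₂)
    (b' := 𝟙 L') (by simpa using e) g'
  have h2 := hcomp_cross_cross (Z := Z) (x := (β_ A₁ V).hom) (x' := (β_ A₂ V).hom) (a := h₂)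
    (b := 𝟙 V) (a' := 𝟙 V) (b' := h₂) (by simp) g
  have h3 := whiskerLeft_hcomp (𝟙 A₁) D (cross Z h₂) (hcomp (cross Z (𝟙 V)) g)
  have h4 := hcomp_whiskerRight (𝟙 A₂) D' (cross Z h₂) (hcomp (cross Z (𝟙 L')) g')
  rw [hD, id_tensorHom, MonoidalCategory.whiskerLeft_id, Category.id_comp] at h3
  rw [id_tensorHom, id_whiskerRight, Category.comp_id] at h4
  simp only [MonoidalCategory.whiskerLeft_comp, comp_whiskerRight, Category.assoc] at h1 h2
  simp only [turn, MonoidalCategory.whiskerLeft_comp, comp_whiskerRight, Category.assoc]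
  rw [h2, reassoc_of% h3, ← reassoc_of% h4, reassoc_of% h1]

end Turn

section TwoHandles

variable {C : Type u} [Category.{v} C] [MonoidalCategory C] {S : Type} {O A B O' : S → C}
  [BraidedCategory C] [Preadditive C]

namespace TwoSweeps

variable {p q p' q' : S} {Z W Z' W' : C} (T : TwoSweeps O A B O' p q p' q' Z W Z' W')

theorem turn_out (t : List S) (ht : pattern [p, q, p', q'] t = [q, p', q']) :
    Z' ◁ (sweepOut T.m₁ q T.χ t ≫ (β_ _ W).hom) ≫
        hcomp (cross Z' (𝟙 W)) (sweepIn T.m₂ p' q' T.φ' T.χ' t) =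
      hcomp (cross Z' (𝟙 (𝟙_ C))) (sweepIn T.n₁ p' q' T.φn' T.χn' t) ≫
        (sweepOut T.n₂ q T.χn t ≫ (β_ _ W).hom) ▷ W' := by
  refine pattern_induction (fun s t hs _ ih => ?_) (fun t ht => ?_) t ht
  · obtain ⟨hp, hq, hp', hq'⟩ := ne_of_notMem hs
    rw [sweepOut_ne _ _ _ hq, sweepOut_ne _ _ _ hq, sweepIn_ne _ _ _ _ _ hp',
      sweepIn_ne _ _ _ _ _ hp', hcomp_braiding, hcomp_braiding]
    exact turn_relation (by rw [cross_comp_whiskerRight, whiskerLeft_comp_cross, T.comm s hs]) ih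
  · rw [sweepOut_self, sweepOut_self, sweepIn_ne _ _ _ _ _ T.ne₃,
      sweepIn_ne _ _ _ _ _ T.ne₃, hcomp_braiding, hcomp_braiding]
    refine turn_relation (by simp [T.hχ]) ?_
    have h1 := whiskerLeft_hcomp (𝟙 W) (prodMap T.m₁ t) (cross Z' (𝟙 W))
      (sweepIn T.m₂ p' q' T.φ' T.χ' t)
    have h2 := hcomp_whiskerRight (𝟙 W) (prodMap T.n₂ t) (cross Z' (𝟙 W))
      (sweepIn T.n₁ p' q' T.φn' T.χn' t)
    rw [id_tensorHom] at h1 h2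
    -- After its exit the first strand passes by inverse braidings and is brought back by braidings.
    -- These cancel, so the turned strand does not meet the second handle.
    have h3 : ∀ {P Q : C} (f : P ⟶ Q), cross W f ≫ (β_ Q W).hom = W ◁ f := fun f => by
      simp [cross]
    rw [h3, h3, h1, h2, whiskerLeft_prodMap_sweepIn, sweepIn_prodMap_whiskerRight, T.hφ', T.hχ']
    simp only [MonoidalCategory.whiskerLeft_id, Category.id_comp, id_whiskerRight,
      Category.comp_id]
    rw [sweepIn_congr T.comm _ _ (by simp) (by simp) t ht]

theorem turn_in (t : List S) (ht : pattern [p, q, p', q'] t = [p, q, p', q']) :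
    Z' ◁ (sweepIn T.m₁ p q T.φ T.χ t ≫ (β_ _ W).hom) ≫
        hcomp (cross Z' (𝟙 W)) (sweepIn T.m₂ p' q' T.φ' T.χ' t) =
      hcomp (cross Z' (𝟙 Z)) (sweepIn T.n₁ p' q' T.φn' T.χn' t) ≫
        (sweepIn T.n₂ p q T.φn T.χn t ≫ (β_ _ W).hom) ▷ W' := by
  refine pattern_induction (fun s t hs _ ih => ?_) (fun t ht => ?_) t ht
  · obtain ⟨hp, hq, hp', hq'⟩ := ne_of_notMem hs
    rw [sweepIn_ne _ _ _ _ _ hp, sweepIn_ne _ _ _ _ _ hp, sweepIn_ne _ _ _ _ _ hp',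
      sweepIn_ne _ _ _ _ _ hp', hcomp_braiding, hcomp_braiding]
    exact turn_relation (by rw [cross_comp_whiskerRight, whiskerLeft_comp_cross, T.comm s hs]) ih
  · rw [sweepIn_self, sweepIn_self, sweepIn_ne _ _ _ _ _ T.ne₁,
      sweepIn_ne _ _ _ _ _ T.ne₁, hcomp_braiding, hcomp_braiding]
    exact turn_relation (by simp [← reassoc_of% T.hφ]) (T.turn_out t ht)

end TwoSweeps

end TwoHandles

/-! ### The first commutative relation from turned strands -/

section CommOne

variable {C : Type u} [Category.{v} C] [MonoidalCategory C] [BraidedCategory C]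

/-- `tildeTwist` consists of the half-braiding turned back to the left and one further braiding to
the right. The turned part commutes with the second strand by assumption, and the further braiding
by naturality (`slide`), at the cost of the crossing of `Z₁` and `Z₂`. -/
theorem comm₁_of_turn {X : C} {γi γj : ∀ Z : C, Z ⊗ X ⟶ X ⊗ Z}
    (h : ∀ Z₁ Z₂ : C, Z₂ ◁ (γi Z₁ ≫ (β_ X Z₁).hom) ≫ hcomp (cross Z₂ (𝟙 Z₁)) (γj Z₂) =
      hcomp (cross Z₂ (𝟙 Z₁)) (γj Z₂) ≫ (γi Z₁ ≫ (β_ X Z₁).hom) ▷ Z₂) :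
    Comm₁ X γi γj := by
  intro Z₁ Z₂
  have slide : hcomp (cross Z₂ (𝟙 Z₁)) (γj Z₂) ≫ (β_ Z₁ X).hom ▷ Z₂ ≫ (α_ _ _ _).hom ≫
      X ◁ (β_ Z₁ Z₂).hom = Z₂ ◁ (β_ Z₁ X).hom ≫ (α_ _ _ _).inv ≫ γj Z₂ ▷ Z₁ ≫ (α_ _ _ _).hom := by
    have n := BraidedCategory.braiding_naturality_right Z₁ (γj Z₂)
    rw [BraidedCategory.braiding_tensor_right_hom, BraidedCategory.braiding_tensor_right_hom] at n
    rw [← cancel_mono (α_ _ _ _).inv]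
    simp only [Category.assoc] at n
    simp [hcomp, cross, n]
  have h' := h Z₁ Z₂
  calc
    _ = (α_ _ _ _).hom ≫ (Z₂ ◁ (γi Z₁ ≫ (β_ X Z₁).hom) ≫ hcomp (cross Z₂ (𝟙 Z₁)) (γj Z₂)) ≫
        (β_ Z₁ X).hom ▷ Z₂ ≫ (α_ _ _ _).hom ≫ X ◁ (β_ Z₁ Z₂).hom := by
      rw [Category.assoc, slide]
      simp [stack, tildeTwist]
    _ = _ := by
      rw [h']
      simp [stack, tildeTwist, hcomp, cross]

end CommOne

/-! ### Bending the outgoing strand to obtain isomorphisms -/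

section Bend

variable {C : Type u} [Category.{v} C] [MonoidalCategory C]

/-- The outgoing strand of a square bent down by an evaluation. -/
def bend {Z T T' A A' : C} (ev : A ⊗ A' ⟶ 𝟙_ C) (f : Z ⊗ T ⟶ T' ⊗ A) : (Z ⊗ T) ⊗ A' ⟶ T' :=
  f ▷ A' ≫ (α_ _ _ _).hom ≫ T' ◁ ev ≫ (ρ_ _).hom

theorem bend_comp {Z T T' T'' A A' : C} (ev : A ⊗ A' ⟶ 𝟙_ C) (f : Z ⊗ T ⟶ T' ⊗ A)
    (g : T' ⟶ T'') : bend ev (f ≫ g ▷ A) = bend ev f ≫ g := by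
  simp only [bend, comp_whiskerRight, Category.assoc]
  calc
    _ = f ▷ A' ⊗≫ (g ▷ (A ⊗ A') ≫ T'' ◁ ev) ⊗≫ 𝟙 _ := by monoidal
    _ = _ := by
      rw [← whisker_exchange]
      monoidal

theorem bend_hcomp {Z W S S' T T' A A' : C} (ev : A ⊗ A' ⟶ 𝟙_ C) (f : Z ⊗ S ⟶ S' ⊗ W)
    (g : W ⊗ T ⟶ T' ⊗ A) :
    bend ev (hcomp f g) = ((α_ Z S T).inv ≫ f ▷ T ≫ (α_ S' W T).hom) ▷ A' ≫ (α_ _ _ _).hom ≫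
      S' ◁ bend ev g := by
  dsimp only [bend, hcomp]
  monoidal

variable [BraidedCategory C]

theorem braiding_inv_comp_ev {A A' : C} (ev : A ⊗ A' ⟶ 𝟙_ C) (T : C) :
    (β_ T A).inv ▷ A' ≫ (α_ _ _ _).hom ≫ T ◁ ev =
      (α_ _ _ _).hom ≫ A ◁ (β_ T A').hom ≫ (α_ _ _ _).inv ≫ ev ▷ T ≫ (λ_ T).hom ≫ (ρ_ T).inv := by
  have n := BraidedCategory.braiding_naturality_right T ev
  rw [BraidedCategory.braiding_tensor_right_hom, braiding_tensorUnit_right] at n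
  simp only [Category.assoc] at n
  rw [← cancel_epi ((β_ T A).hom ▷ A'), ← cancel_epi (α_ T A A').inv]
  simp [← reassoc_of% n]

/-- A strand that passes under `T` and is then capped off may be capped off before `T`, with the
other leg `A'` of the cap braided past `T` instead. -/
theorem bend_hcomp_cross {W S S' T T' A A' : C} (ev : A ⊗ A' ⟶ 𝟙_ C) (f : W ⊗ S ⟶ S' ⊗ A)
    (w : T ⟶ T') :
    bend ev (hcomp f (cross A w)) = (α_ _ _ _).inv ▷ A' ≫ (α_ _ _ _).hom ≫
      _ ◁ (β_ T A').hom ≫ (α_ _ _ _).inv ≫ bend ev f ▷ T ≫ S' ◁ w := by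
  have n := braiding_inv_comp_ev ev T
  calc
    _ = (α_ _ _ _).inv ▷ A' ≫ f ▷ T ▷ A' ⊗≫ S' ◁ ((β_ T A).inv ▷ A' ≫ (α_ _ _ _).hom ≫
        (w ▷ (A ⊗ A') ≫ T' ◁ ev)) ⊗≫ 𝟙 _ := by
      dsimp only [bend, hcomp, cross]
      monoidal
    _ = (α_ _ _ _).inv ▷ A' ⊗≫ (f ▷ (T ⊗ A') ≫ (S' ⊗ A) ◁ (β_ T A').hom) ⊗≫
        S' ◁ ev ▷ T ⊗≫ S' ◁ w := by
      rw [← whisker_exchange, reassoc_of% n]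
      monoidal
    _ = _ := by
      rw [← whisker_exchange]
      dsimp only [bend]
      monoidal

variable [Preadditive C] {S : Type} {O O' : S → C}

instance isIso_cross {Z A B : C} (f : A ⟶ B) [IsIso f] : IsIso (cross Z f) := by
  unfold cross
  infer_instance

theorem isIso_bend_sweepOut {A A' : C} (ev : A ⊗ A' ⟶ 𝟙_ C) {m : ∀ s, O s ⟶ O' s} {L : List S}
    (hm : ∀ s, s ∉ L → IsIso (m s)) {q : S} (hq : q ∈ L) (χ : O q ⟶ O' q ⊗ A)
    (hχ : IsIso (bend ev ((λ_ _).hom ≫ χ))) (t : List S) (ht : pattern L t = [q]) :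
    IsIso (bend ev (sweepOut m q χ t)) := by
  refine pattern_induction (fun s t hs _ ih => ?_) (fun t ht => ?_) t ht
  · rw [sweepOut_ne _ _ _ (fun e => hs (e ▸ hq) : s ≠ q), bend_hcomp]
    have := hm s hs
    infer_instance
  · rw [sweepOut_self, bend_hcomp_cross]
    have := isIso_prodMap fun s hs => hm s (pattern_eq_nil ht s hs)
    infer_instance

/-- All pieces of the bent sweep are braidings, slot morphisms and the two vertices, so it suffices
that the absorption and the bent emission are invertible. -/
theorem isIso_bend_sweepIn {A A' Z : C} (ev : A ⊗ A' ⟶ 𝟙_ C) {m : ∀ s, O s ⟶ O' s} {L : List S}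
    (hm : ∀ s, s ∉ L → IsIso (m s)) {p q : S} (hp : p ∈ L) (hq : q ∈ L) (φ : Z ⊗ O p ⟶ O' p)
    [IsIso φ] (χ : O q ⟶ O' q ⊗ A)
    (hχ : IsIso (bend ev ((λ_ _).hom ≫ χ))) (t : List S) (ht : pattern L t = [p, q]) :
    IsIso (bend ev (sweepIn m p q φ χ t)) := by
  refine pattern_induction (fun s t hs _ ih => ?_) (fun t ht => ?_) t ht
  · rw [sweepIn_ne _ _ _ _ _ (fun e => hs (e ▸ hp) : s ≠ p), bend_hcomp]
    have := hm s hs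
    infer_instance
  · rw [sweepIn_self, bend_hcomp]
    have := isIso_bend_sweepOut ev hm hq χ hχ t ht
    infer_instance

end Bend

/-! ### Canonical elements of dual bases -/

namespace DualBases

variable {k : Type w} {C : Type u} [Field k] [Category.{v} C] [Preadditive C] [Linear k C]
  {W W' S : C} {M : Type*} [AddCommGroup M] [Module k M]

theorem sum_comp_φ_φdual (B : DualBases k W S) (g : S ⟶ W) :
    ∑ l, g ≫ B.φ l ≫ B.φdual l = g := by
  conv_rhs => rw [← B.φdual.sum_repr g]
  refine Finset.sum_congr rfl fun l _ => ?_
  conv_lhs => rw [← B.φdual.sum_repr g]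
  rw [← Category.assoc]
  simp only [Preadditive.sum_comp, Linear.smul_comp, B.pairing, ite_comp, zero_comp,
    Category.id_comp, smul_ite, smul_zero]
  rw [Finset.sum_ite_eq _ _ _, if_pos (Finset.mem_univ l)]

theorem φdual_comp (B : DualBases k W S) (l : Fin B.card) (f : W ⟶ S) :
    B.φdual l ≫ f = B.φ.repr f l • 𝟙 S := by
  conv_lhs => rw [← B.φ.sum_repr f]
  simp only [Preadditive.comp_sum, Linear.comp_smul, B.pairing, smul_ite, smul_zero]
  rw [Finset.sum_ite_eq_of_mem' _ _ _ (Finset.mem_univ l)]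

/-- The canonical element Σ φ_l ⊗ φ^l is determined by acting as the identity on `S ⟶ W`. A bilinear
sum over the dual bases may thus be computed with any complete family. -/
theorem sum_eq_of_complete (B : DualBases k W S) {ι : Type*} [Fintype ι] (f : ι → (W ⟶ S))
    (g : ι → (S ⟶ W)) (h : ∀ x : S ⟶ W, ∑ p, x ≫ f p ≫ g p = x)
    (F : (W ⟶ S) →ₗ[k] (S ⟶ W) →ₗ[k] M) :
    ∑ p, F (f p) (g p) = ∑ l, F (B.φ l) (B.φdual l) := by
  have h1 : ∀ p, F (f p) (g p) = ∑ l, F (B.φ l) (B.φ.repr (f p) l • g p) := fun p => by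
    conv_lhs => rw [← B.φ.sum_repr (f p)]
    simp only [map_sum, map_smul, LinearMap.sum_apply, LinearMap.smul_apply]
  simp_rw [h1]
  rw [Finset.sum_comm]
  refine Finset.sum_congr rfl fun l _ => ?_
  rw [← map_sum]
  congr 1
  refine Eq.trans (Finset.sum_congr rfl fun p _ => ?_) (h (B.φdual l))
  rw [← Category.assoc, B.φdual_comp, Linear.smul_comp, Category.id_comp]

/-- Precomposition with `h` on one side is adjoint, for the composition pairing, to postcomposition
on the other; this moves `h` from the absorption to the emission. -/
theorem sum_naturality (B : DualBases k W S) (B' : DualBases k W' S) (h : W ⟶ W')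
    (F : (W ⟶ S) →ₗ[k] (S ⟶ W') →ₗ[k] M) :
    ∑ l, F (h ≫ B'.φ l) (B'.φdual l) = ∑ l, F (B.φ l) (B.φdual l ≫ h) := by
  have h1 : ∀ p, F (h ≫ B'.φ p) (B'.φdual p) =
      ∑ l, F (B.φ l) (B.φ.repr (h ≫ B'.φ p) l • B'.φdual p) := fun p => by
    conv_lhs => rw [← B.φ.sum_repr (h ≫ B'.φ p)]
    simp only [map_sum, map_smul, LinearMap.sum_apply, LinearMap.smul_apply]
  simp_rw [h1]
  rw [Finset.sum_comm]
  refine Finset.sum_congr rfl fun l _ => ?_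
  rw [← map_sum]
  congr 1
  refine Eq.trans (Finset.sum_congr rfl fun p _ => ?_) (B'.sum_comp_φ_φdual (B.φdual l ≫ h))
  rw [← Category.id_comp (B'.φdual p), ← Linear.smul_comp, ← B.φdual_comp]
  simp

end DualBases

/-! ### Schur's lemma and semisimplicity -/

section Schur

variable {C : Type u} [Category.{v} C] [Abelian C] (R : SimpleReps C)

theorem SimpleReps.hom_eq_zero {a b : Fin R.card} (h : a ≠ b) (f : R.obj a ⟶ R.obj b) : f = 0 := by
  by_contra hf
  have := R.simple a
  have := R.simple b
  have := isIso_of_hom_simple hf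
  exact h (R.eq_of_iso a b ⟨asIso f⟩)

variable (k : Type w) [Field k] [Linear k C] [MonoidalCategory C] [MonoidalPreadditive C]
  [MonoidalLinear k C] [RigidCategory C] [FusionCategory k C]

include k in
theorem SimpleReps.hom_ext {W V : C} {f g : W ⟶ V}
    (h : ∀ (a : Fin R.card) (x : R.obj a ⟶ W), x ≫ f = x ≫ g) : f = g := by
  obtain ⟨m, T, hT, ⟨t⟩⟩ := FusionCategory.semisimple (k := k) W
  rw [← cancel_epi t.inv]
  refine biproduct.hom_ext' _ _ fun j => ?_
  obtain ⟨a, ⟨e⟩⟩ := R.exists_iso (T j) (hT j)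
  rw [← cancel_epi e.inv]
  simpa using h a (e.inv ≫ biproduct.ι T j ≫ t.inv)

include k in
theorem SimpleReps.hom_ext' {W V : C} {f g : V ⟶ W}
    (h : ∀ (a : Fin R.card) (x : W ⟶ R.obj a), f ≫ x = g ≫ x) : f = g := by
  obtain ⟨m, T, hT, ⟨t⟩⟩ := FusionCategory.semisimple (k := k) W
  rw [← cancel_mono t.hom]
  refine biproduct.hom_ext _ _ fun j => ?_
  obtain ⟨a, ⟨e⟩⟩ := R.exists_iso (T j) (hT j)
  rw [← cancel_mono e.hom]
  simpa using h a (t.hom ≫ biproduct.π T j ≫ e.hom)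

-- The projections of `𝟙` to its simple summands are linearly independent in the one-dimensional
-- algebra `End(𝟙)`, so there is at most one summand; and there is one because `End(𝟙) ≠ 0`.
include k in
theorem SimpleReps.exists_unit : ∃ a, Nonempty (𝟙_ C ≅ R.obj a) := by
  obtain ⟨m, T, hT, ⟨t⟩⟩ := FusionCategory.semisimple (k := k) (𝟙_ C)
  have fin : FiniteDimensional k (𝟙_ C ⟶ 𝟙_ C) := FusionCategory.finite_hom _ _
  have hlin : LinearIndependent k
      fun j => t.hom ≫ biproduct.π T j ≫ biproduct.ι T j ≫ t.inv := by
    rw [Fintype.linearIndependent_iff]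
    intro c hc j
    have := hT j
    have h1 : (biproduct.ι T j ≫ t.inv) ≫ (∑ i, c i • t.hom ≫ biproduct.π T i ≫ biproduct.ι T i ≫
        t.inv) ≫ t.hom ≫ biproduct.π T j = 0 := by rw [hc]; simp
    simp only [Preadditive.comp_sum, Preadditive.sum_comp, Linear.comp_smul, Linear.smul_comp,
      Category.assoc, Iso.inv_hom_id_assoc] at h1
    rw [Finset.sum_eq_single j (fun i _ hi => by
      rw [biproduct.ι_π_ne_assoc T hi.symm]; simp) (by simp)] at h1
    simp only [biproduct.ι_π_self, Category.comp_id] at h1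
    exact (smul_eq_zero.mp h1).resolve_right (id_nonzero _)
  have hcard : m ≤ 1 := by
    have := hlin.fintype_card_le_finrank
    rwa [FusionCategory.end_unit, Fintype.card_fin] at this
  have hm : m ≠ 0 := by
    rintro rfl
    have h0 : 𝟙 (𝟙_ C) = 0 := by
      rw [← cancel_mono t.hom]
      exact biproduct.hom_ext _ _ fun j => j.elim0
    have : Module.finrank k (𝟙_ C ⟶ 𝟙_ C) = 0 := by
      have : Subsingleton (𝟙_ C ⟶ 𝟙_ C) := ⟨fun f g => by
        rw [← Category.id_comp f, ← Category.id_comp g, h0, zero_comp, zero_comp]⟩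
      exact Module.finrank_zero_of_subsingleton
    rw [FusionCategory.end_unit] at this
    exact one_ne_zero this
  obtain rfl : m = 1 := by omega
  obtain ⟨a, ⟨e⟩⟩ := R.exists_iso (T 0) (hT 0)
  refine ⟨a, ⟨t ≪≫ ⟨biproduct.π T 0, biproduct.ι T 0, ?_, by simp⟩ ≪≫ e⟩⟩
  refine biproduct.hom_ext' _ _ fun j => ?_
  obtain rfl := Subsingleton.elim j 0
  simp

variable [IsAlgClosed k]

theorem SimpleReps.sum_dualBases (W : C) :
    ∑ a, ∑ l, (dualBases k W (R.obj a) (R.simple a)).φ l ≫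
      (dualBases k W (R.obj a) (R.simple a)).φdual l = 𝟙 W := by
  refine R.hom_ext k fun b x => ?_
  rw [Preadditive.comp_sum, Category.comp_id, Finset.sum_eq_single b]
  · rw [Preadditive.comp_sum, DualBases.sum_comp_φ_φdual]
  · intro a _ hab
    rw [Preadditive.comp_sum]
    refine Finset.sum_eq_zero fun l _ => ?_
    rw [← Category.assoc, R.hom_eq_zero hab.symm (x ≫ _), zero_comp]
  · simp

end Schur

/-! ### The pivotal structure of a ribbon category -/

section Ribbon

variable {C : Type u} [Category.{v} C] [MonoidalCategory C] [BraidedCategory C]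

theorem braiding_cap (X : C) {A B : C} (e : A ⊗ B ⟶ 𝟙_ C) :
    (α_ X A B).inv ≫ (β_ X A).hom ▷ B ≫ (α_ A X B).hom ≫ A ◁ (β_ X B).hom ≫ (α_ A B X).inv ≫
      e ▷ X ≫ (λ_ X).hom = X ◁ e ≫ (ρ_ X).hom := by
  have h := BraidedCategory.braiding_naturality_right X e
  rw [BraidedCategory.braiding_tensor_right_hom, braiding_tensorUnit_right] at h
  rw [← cancel_mono (λ_ X).hom] at h
  simpa using h.symm

theorem braiding_inv_cap (X : C) {A B : C} (e : A ⊗ B ⟶ 𝟙_ C) :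
    (α_ A X B).hom ≫ A ◁ (β_ X B).hom ≫ (α_ A B X).inv ≫ e ▷ X ≫ (λ_ X).hom =
      (β_ X A).inv ▷ B ≫ (α_ X A B).hom ≫ X ◁ e ≫ (ρ_ X).hom := by
  rw [← braiding_cap]
  simp

variable [RigidCategory C] [RibbonCategory C]

/-- The braiding of `𝟙` with itself is trivial, so the tensor axiom and naturality along the unitor
make the twist of `𝟙` an invertible idempotent. -/
theorem twist_unit : (RibbonCategory.twist (𝟙_ C)).hom = 𝟙 (𝟙_ C) := by
  have h1 := RibbonCategory.twist_tensor (𝟙_ C) (𝟙_ C)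
  have h2 := RibbonCategory.twist_naturality (λ_ (𝟙_ C)).hom
  rw [h1] at h2
  have h3 : (β_ (𝟙_ C) (𝟙_ C)).hom = 𝟙 _ := by
    rw [braiding_tensorUnit_left]; simp [unitors_equal]
  rw [h3, Category.id_comp, Category.id_comp, MonoidalCategory.tensorHom_def, Category.assoc,
    leftUnitor_naturality, unitors_equal, rightUnitor_naturality_assoc,
    cancel_epi, ← cancel_mono (RibbonCategory.twist (𝟙_ C)).inv] at h2
  simpa using h2.symm

/-- The evaluation `X ⊗ Y ⟶ 𝟙` given by the pivotal structure, for any dual `Y` of `X`. -/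
def pivEv (X Y : C) [ExactPairing X Y] : X ⊗ Y ⟶ 𝟙_ C :=
  (RibbonCategory.twist X).hom ▷ Y ≫ (β_ X Y).hom ≫ ε_ X Y

/-- The coevaluation `𝟙 ⟶ Y ⊗ X` given by the pivotal structure, for any dual `Y` of `X`. -/
def pivCoev (X Y : C) [ExactPairing X Y] : 𝟙_ C ⟶ Y ⊗ X :=
  η_ X Y ≫ (β_ Y X).inv ≫ Y ◁ (RibbonCategory.twist X).inv

/-- The pairing by which `X` is a right dual of its right dual `Y`. -/
@[reducible]
def pivPairing (X Y : C) [ExactPairing X Y] : ExactPairing Y X where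
  coevaluation' := pivCoev X Y
  evaluation' := pivEv X Y
  coevaluation_evaluation' := by
    have h := (BraidedCategory.exactPairing_swap X Y).coevaluation_evaluation'
    have h' : X ◁ (η_ X Y ≫ (β_ Y X).inv) ≫ (α_ X Y X).inv ≫ ((β_ X Y).hom ≫ ε_ X Y) ▷ X =
      (ρ_ X).hom ≫ (λ_ X).inv := h
    have e1 : X ◁ pivCoev X Y ≫ (α_ X Y X).inv ≫ pivEv X Y ▷ X =
        (RibbonCategory.twist X).hom ▷ 𝟙_ C ≫
        (X ◁ (η_ X Y ≫ (β_ Y X).inv) ≫ (α_ X Y X).inv ≫ ((β_ X Y).hom ≫ ε_ X Y) ▷ X) ≫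
          𝟙_ C ◁ (RibbonCategory.twist X).inv := by
      simp only [pivCoev, pivEv, comp_whiskerRight, MonoidalCategory.whiskerLeft_comp,
        Category.assoc]
      rw [associator_inv_naturality_right_assoc, whisker_exchange_assoc, whisker_exchange_assoc,
        whisker_exchange, ← associator_inv_naturality_left_assoc, whisker_exchange_assoc,
        whisker_exchange_assoc]
    rw [e1, h']
    simp
  evaluation_coevaluation' := by
    have h := (BraidedCategory.exactPairing_swap X Y).evaluation_coevaluation'
    have h' : (η_ X Y ≫ (β_ Y X).inv) ▷ Y ≫ (α_ Y X Y).hom ≫ Y ◁ ((β_ X Y).hom ≫ ε_ X Y) =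
      (λ_ Y).hom ≫ (ρ_ Y).inv := h
    rw [← h']
    simp only [pivCoev, pivEv, comp_whiskerRight, MonoidalCategory.whiskerLeft_comp,
      Category.assoc, associator_naturality_middle_assoc]
    rw [← MonoidalCategory.whiskerLeft_comp_assoc Y ((RibbonCategory.twist X).inv ▷ Y),
      ← comp_whiskerRight]
    simp

/-- The left side is the twist of `Y ⊗ X` followed by ε, written out; naturality of the twist along
ε and triviality on `𝟙` remove it. So taking the pivotal dual twice returns the original evaluation.
-/
theorem pivEv_pivPairing (X Y : C) [ExactPairing X Y] :
    @pivEv C _ _ _ _ _ Y X (pivPairing X Y) = ε_ X Y := by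
  have h := RibbonCategory.twist_naturality (ε_ X Y)
  rw [twist_unit, Category.comp_id, RibbonCategory.twist_tensor, tensorHom_def'] at h
  have e : @pivEv C _ _ _ _ _ Y X (pivPairing X Y) =
    (RibbonCategory.twist Y).hom ▷ X ≫ (β_ Y X).hom ≫
      (RibbonCategory.twist X).hom ▷ Y ≫ (β_ X Y).hom ≫ ε_ X Y := rfl
  rw [e]
  conv_rhs => rw [h]
  simp only [Category.assoc]
  rw [whisker_exchange_assoc, BraidedCategory.braiding_naturality_left_assoc,
    BraidedCategory.braiding_naturality_left_assoc,
    BraidedCategory.braiding_naturality_right_assoc]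

/-- The twist of `X₁ ⊗ X₂` contributes a double braiding, which cancels the entanglement of the two
caps caused by braiding `X₁ ⊗ X₂` past `Y₂ ⊗ Y₁`. What remains are nested caps. -/
theorem pivEv_tensor (X₁ X₂ Y₁ Y₂ : C) [ExactPairing X₁ Y₁] [ExactPairing X₂ Y₂] :
    pivEv (X₁ ⊗ X₂) (Y₂ ⊗ Y₁) = 𝟙 _ ⊗≫ X₁ ◁ (pivEv X₂ Y₂ ▷ Y₁) ⊗≫ pivEv X₁ Y₁ := by
  set M := (RibbonCategory.twist X₁).hom ⊗ₘ (RibbonCategory.twist X₂).hom with hM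
  have e1 : pivEv (X₁ ⊗ X₂) (Y₂ ⊗ Y₁) = M ▷ (Y₂ ⊗ Y₁) ≫
      ((β_ X₁ X₂).hom ≫ (β_ X₂ X₁).hom) ▷ (Y₂ ⊗ Y₁) ≫ (β_ (X₁ ⊗ X₂) (Y₂ ⊗ Y₁)).hom ≫
      ε_ (X₁ ⊗ X₂) (Y₂ ⊗ Y₁) := by
    rw [pivEv, RibbonCategory.twist_tensor, ← comp_whiskerRight_assoc, hM,
      BraidedCategory.braiding_naturality_assoc, BraidedCategory.braiding_naturality]
  have e2 : 𝟙 _ ⊗≫ X₁ ◁ (pivEv X₂ Y₂ ▷ Y₁) ⊗≫ pivEv X₁ Y₁ = M ▷ (Y₂ ⊗ Y₁) ≫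
     (𝟙 _ ⊗≫ X₁ ◁ (((β_ X₂ Y₂).hom ≫ ε_ X₂ Y₂) ▷ Y₁) ⊗≫ (β_ X₁ Y₁).hom ≫ ε_ X₁ Y₁) := by
    rw [hM, tensorHom_def', pivEv, pivEv]
    have := whisker_exchange (RibbonCategory.twist X₁).hom
      ((α_ X₂ Y₂ Y₁).inv ≫ ((β_ X₂ Y₂).hom ≫ ε_ X₂ Y₂) ▷ Y₁ ≫ (λ_ Y₁).hom)
    calc _ = (X₁ ◁ (RibbonCategory.twist X₂).hom) ▷ (Y₂ ⊗ Y₁) ≫ (α_ X₁ X₂ (Y₂ ⊗ Y₁)).hom ≫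
          (X₁ ◁ ((α_ X₂ Y₂ Y₁).inv ≫ ((β_ X₂ Y₂).hom ≫ ε_ X₂ Y₂) ▷ Y₁ ≫ (λ_ Y₁).hom) ≫
          (RibbonCategory.twist X₁).hom ▷ Y₁) ≫ (β_ X₁ Y₁).hom ≫ ε_ X₁ Y₁ := by monoidal
      _ = _ := by rw [this]; monoidal
  rw [e1, e2]
  congr 1
  have h1 := braiding_inv_cap X₂ ((β_ X₁ Y₁).hom ≫ ε_ X₁ Y₁)
  have h2 := braiding_inv_cap X₁ ((β_ X₂ Y₂).hom ≫ ε_ X₂ Y₂)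
  have s2 : (β_ (X₁ ⊗ X₂) Y₁).hom ≫ (α_ Y₁ X₁ X₂).inv ≫ ε_ X₁ Y₁ ▷ X₂ ≫ (λ_ X₂).hom =
      (β_ X₂ X₁).inv ▷ Y₁ ≫ (α_ X₂ X₁ Y₁).hom ≫ X₂ ◁ ((β_ X₁ Y₁).hom ≫ ε_ X₁ Y₁) ≫
        (ρ_ X₂).hom := by
    rw [← h1, BraidedCategory.braiding_tensor_left_hom]
    simp
  have s4 : (β_ X₁ X₂).hom ▷ Y₂ ≫ (β_ (X₂ ⊗ X₁) Y₂).hom ≫ (α_ Y₂ X₂ X₁).inv ≫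
      ε_ X₂ Y₂ ▷ X₁ ≫ (λ_ X₁).hom =
      (α_ X₁ X₂ Y₂).hom ≫ X₁ ◁ ((β_ X₂ Y₂).hom ≫ ε_ X₂ Y₂) ≫ (ρ_ X₁).hom := by
    have : (α_ X₁ X₂ Y₂).hom ≫ X₁ ◁ ((β_ X₂ Y₂).hom ≫ ε_ X₂ Y₂) ≫ (ρ_ X₁).hom =
      (β_ X₁ X₂).hom ▷ Y₂ ≫ (β_ X₁ X₂).inv ▷ Y₂ ≫ (α_ X₁ X₂ Y₂).hom ≫
        X₁ ◁ ((β_ X₂ Y₂).hom ≫ ε_ X₂ Y₂) ≫ (ρ_ X₁).hom := by simp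
    rw [this, ← h2, BraidedCategory.braiding_tensor_left_hom]
    simp
  rw [ExactPairing.tensor_evaluation]
  have ex := whisker_exchange (ε_ X₂ Y₂) ((β_ X₁ Y₁).hom ≫ ε_ X₁ Y₁)
  calc _ = ((β_ X₁ X₂).hom ≫ (β_ X₂ X₁).hom) ▷ (Y₂ ⊗ Y₁) ≫ (α_ _ _ _).inv ≫
        (β_ (X₁ ⊗ X₂) Y₂).hom ▷ Y₁ ≫ (α_ _ _ _).hom ≫
        Y₂ ◁ ((β_ (X₁ ⊗ X₂) Y₁).hom ≫ (α_ Y₁ X₁ X₂).inv ≫ ε_ X₁ Y₁ ▷ X₂ ≫ (λ_ X₂).hom) ≫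
        ε_ X₂ Y₂ := by
        rw [BraidedCategory.braiding_tensor_right_hom]; monoidal
    _ = ((β_ X₁ X₂).hom ≫ (β_ X₂ X₁).hom) ▷ (Y₂ ⊗ Y₁) ≫ (α_ _ _ _).inv ≫
        ((β_ (X₁ ⊗ X₂) Y₂).hom ≫ Y₂ ◁ (β_ X₂ X₁).inv) ▷ Y₁ ≫ (α_ _ _ _).hom ≫
        Y₂ ◁ ((α_ X₂ X₁ Y₁).hom ≫ X₂ ◁ ((β_ X₁ Y₁).hom ≫ ε_ X₁ Y₁) ≫
        (ρ_ X₂).hom) ≫ ε_ X₂ Y₂ := by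
        rw [s2]; monoidal
    _ = (α_ _ _ _).inv ≫ ((β_ X₁ X₂).hom ▷ Y₂ ≫ (β_ (X₂ ⊗ X₁) Y₂).hom ≫ (α_ Y₂ X₂ X₁).inv) ▷ Y₁ ≫
        (α_ _ _ _).hom ≫
        ((Y₂ ⊗ X₂) ◁ ((β_ X₁ Y₁).hom ≫ ε_ X₁ Y₁) ≫ ε_ X₂ Y₂ ▷ 𝟙_ C) ≫ (ρ_ _).hom := by
        rw [← BraidedCategory.braiding_naturality_left]
        have : ((β_ X₁ X₂).hom ≫ (β_ X₂ X₁).hom) ▷ (Y₂ ⊗ Y₁) =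
          (α_ _ _ _).inv ≫ (((β_ X₁ X₂).hom ▷ Y₂) ≫ (β_ X₂ X₁).hom ▷ Y₂) ▷ Y₁ ≫ (α_ _ _ _).hom := by
          monoidal
        rw [this]
        simp only [Category.assoc, Iso.hom_inv_id_assoc]
        rw [← comp_whiskerRight_assoc, Category.assoc, hom_inv_whiskerRight_assoc]
        monoidal
    _ = (α_ _ _ _).inv ≫ ((β_ X₁ X₂).hom ▷ Y₂ ≫ (β_ (X₂ ⊗ X₁) Y₂).hom ≫ (α_ Y₂ X₂ X₁).inv ≫
      ε_ X₂ Y₂ ▷ X₁ ≫ (λ_ X₁).hom) ▷ Y₁ ≫ (β_ X₁ Y₁).hom ≫ ε_ X₁ Y₁ := by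
        rw [ex]; monoidal
    _ = _ := by rw [s4]; monoidal

end Ribbon

/-! ### Partial traces and sphericality -/

section PartialTrace

variable {C : Type u} [Category.{v} C] [MonoidalCategory C] [BraidedCategory C]
  [RigidCategory C] [RibbonCategory C]

/-- One mate serves the coevaluation, the evaluation and the pivotal evaluation at once. The duals
are arbitrary because duals of tensor products and double duals occur below. -/
theorem exists_mate {A A' : C} (B B' : C) [ExactPairing A B] [ExactPairing A' B'] (h : A ⟶ A') :
    ∃ m : B' ⟶ B, η_ A B ≫ h ▷ B = η_ A' B' ≫ A' ◁ m ∧ m ▷ A ≫ ε_ A B = B' ◁ h ≫ ε_ A' B' ∧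
      A ◁ m ≫ pivEv A B = h ▷ B' ≫ pivEv A' B' := by
  let i1 : HasRightDual A := ⟨B⟩
  let i2 : HasRightDual A' := ⟨B'⟩
  have e := rightAdjointMate_comp_evaluation h
  refine ⟨hᘁ, (coevaluation_comp_rightAdjointMate h).symm, e, ?_⟩
  have e' : hᘁ ▷ A ≫ ε_ A B = B' ◁ h ≫ ε_ A' B' := e
  have e'' : A ◁ hᘁ ≫ (RibbonCategory.twist A).hom ▷ B =
    (RibbonCategory.twist A).hom ▷ B' ≫ A ◁ hᘁ := whisker_exchange _ _
  change A ◁ hᘁ ≫ (RibbonCategory.twist A).hom ▷ B ≫ (β_ A B).hom ≫ ε_ A B = _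
  rw [reassoc_of% e'']
  change (RibbonCategory.twist A).hom ▷ B' ≫ A ◁ (show B' ⟶ B from hᘁ) ≫ _ = _
  rw [BraidedCategory.braiding_naturality_right_assoc, e', pivEv, ← comp_whiskerRight_assoc,
    RibbonCategory.twist_naturality, comp_whiskerRight_assoc,
    BraidedCategory.braiding_naturality_left_assoc h]

/-- The partial trace `X ⟶ Y` of `X ⊗ A ⟶ Y ⊗ A`, for a dual `B` of `A`. -/
def ptr {X Y A : C} (B : C) [ExactPairing A B] (f : X ⊗ A ⟶ Y ⊗ A) : X ⟶ Y :=
  (ρ_ X).inv ≫ X ◁ η_ A B ≫ (α_ X A B).inv ≫ f ▷ B ≫ (α_ Y A B).hom ≫ Y ◁ pivEv A B ≫ (ρ_ Y).hom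

theorem ptr_natural {X X' Y Y' A : C} (B : C) [ExactPairing A B] (x : X' ⟶ X) (f : X ⊗ A ⟶ Y ⊗ A)
    (y : Y ⟶ Y') : ptr B (x ▷ A ≫ f ≫ y ▷ A) = x ≫ ptr B f ≫ y := by
  have h1 := whisker_exchange x (η_ A B)
  have h2 := whisker_exchange y (pivEv A B)
  unfold ptr
  calc _ = (ρ_ X').inv ≫ (X' ◁ η_ A B ≫ x ▷ (A ⊗ B)) ≫ (α_ X A B).inv ≫ f ▷ B ≫ (α_ Y A B).hom ≫
        (y ▷ (A ⊗ B) ≫ Y' ◁ pivEv A B) ≫ (ρ_ Y').hom := by monoidal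
    _ = _ := by rw [h1, ← h2]; monoidal

theorem ptr_comp_left {X X' Y A : C} (B : C) [ExactPairing A B] (x : X' ⟶ X) (f : X ⊗ A ⟶ Y ⊗ A) :
    ptr B (x ▷ A ≫ f) = x ≫ ptr B f := by
  simpa using ptr_natural B x f (𝟙 Y)

theorem ptr_comp_right {X Y Y' A : C} (B : C) [ExactPairing A B] (f : X ⊗ A ⟶ Y ⊗ A)
    (y : Y ⟶ Y') : ptr B (f ≫ y ▷ A) = ptr B f ≫ y := by
  simpa using ptr_natural B (𝟙 X) f y

theorem ptr_whiskerLeft {X Y A : C} (B Z : C) [ExactPairing A B] (f : X ⊗ A ⟶ Y ⊗ A) :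
    ptr B ((α_ Z X A).hom ≫ Z ◁ f ≫ (α_ Z Y A).inv) = Z ◁ ptr B f := by
  unfold ptr
  monoidal

/-- Cyclicity: `h` travels around the loop as its mate. -/
theorem ptr_slide {X Y A A' : C} (B B' : C) [ExactPairing A B] [ExactPairing A' B']
    (h : A ⟶ A') (f : X ⊗ A' ⟶ Y ⊗ A) : ptr B (X ◁ h ≫ f) = ptr B' (f ≫ Y ◁ h) := by
  obtain ⟨m, h1, -, h3⟩ := exists_mate B B' h
  unfold ptr
  calc _ = (ρ_ X).inv ≫ X ◁ (η_ A B ≫ h ▷ B) ≫ (α_ X A' B).inv ≫ f ▷ B ≫ (α_ Y A B).hom ≫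
        Y ◁ pivEv A B ≫ (ρ_ Y).hom := by monoidal
    _ = (ρ_ X).inv ≫ X ◁ η_ A' B' ≫ (α_ X A' B').inv ≫ ((X ⊗ A') ◁ m ≫ f ▷ B) ≫ (α_ Y A B).hom ≫
        Y ◁ pivEv A B ≫ (ρ_ Y).hom := by rw [h1]; monoidal
    _ = (ρ_ X).inv ≫ X ◁ η_ A' B' ≫ (α_ X A' B').inv ≫ f ▷ B' ≫ (α_ Y A B').hom ≫
        Y ◁ (A ◁ m ≫ pivEv A B) ≫ (ρ_ Y).hom := by rw [whisker_exchange]; monoidal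
    _ = _ := by rw [h3]; monoidal

theorem ptr_tensor {X Y Z A : C} (BZ BA : C) [ExactPairing Z BZ] [ExactPairing A BA]
    (f : X ⊗ (Z ⊗ A) ⟶ Y ⊗ (Z ⊗ A)) :
    ptr (BA ⊗ BZ) f = ptr BZ (ptr BA ((α_ X Z A).hom ≫ f ≫ (α_ Y Z A).inv)) := by
  unfold ptr
  rw [pivEv_tensor, ExactPairing.tensor_coevaluation]
  monoidal

theorem ptr_id_tensor {X A : C} (B : C) [ExactPairing A B] (f : A ⟶ A) :
    ptr B (X ◁ f) = (ρ_ X).inv ≫ X ◁ (η_ A B ≫ f ▷ B ≫ pivEv A B) ≫ (ρ_ X).hom := by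
  unfold ptr
  monoidal

/-- The partial trace over a left tensor factor. -/
def ltr {A X Y : C} (B : C) [ExactPairing A B] (f : A ⊗ X ⟶ A ⊗ Y) : X ⟶ Y :=
  (λ_ X).inv ≫ pivCoev A B ▷ X ≫ (α_ B A X).hom ≫ B ◁ f ≫ (α_ B A Y).inv ≫ ε_ A B ▷ Y ≫
    (λ_ Y).hom

theorem ltr_ptr {Z A : C} (BZ BA : C) [ExactPairing Z BZ] [ExactPairing A BA]
    (f : Z ⊗ A ⟶ Z ⊗ A) :
    η_ A BA ≫ ltr BZ f ▷ BA ≫ pivEv A BA = pivCoev Z BZ ≫ BZ ◁ (ptr BA f) ≫ ε_ Z BZ := by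
  have h1 := whisker_exchange (ε_ Z BZ) (pivEv A BA)
  have h2 := whisker_exchange (pivCoev Z BZ) (η_ A BA)
  unfold ltr ptr
  calc _ = (λ_ _).inv ≫ (𝟙_ C ◁ η_ A BA ≫ pivCoev Z BZ ▷ (A ⊗ BA)) ≫ (α_ _ _ _).hom ≫
        BZ ◁ (α_ _ _ _).inv ≫ BZ ◁ f ▷ BA ≫ (BZ ◁ (α_ _ _ _).hom) ≫ (α_ _ _ _).inv ≫
        ε_ Z BZ ▷ (A ⊗ BA) ≫ 𝟙_ C ◁ pivEv A BA ≫ (λ_ _).hom := by monoidal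
    _ = (λ_ _).inv ≫ (pivCoev Z BZ ▷ 𝟙_ C ≫ (BZ ⊗ Z) ◁ η_ A BA) ≫ (α_ _ _ _).hom ≫
        BZ ◁ (α_ _ _ _).inv ≫ BZ ◁ f ▷ BA ≫ (BZ ◁ (α_ _ _ _).hom) ≫ (α_ _ _ _).inv ≫
        (BZ ⊗ Z) ◁ pivEv A BA ≫ ε_ Z BZ ▷ 𝟙_ C ≫ (λ_ _).hom := by rw [h2, ← whisker_exchange_assoc]
    _ = _ := by monoidal

theorem twist_dual_evaluation (A : C) :
    (RibbonCategory.twist Aᘁ).hom ▷ A ≫ ε_ A Aᘁ = Aᘁ ◁ (RibbonCategory.twist A).hom ≫ ε_ A Aᘁ := by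
  rw [RibbonCategory.twist_dual]
  exact rightAdjointMate_comp_evaluation _

/-- The axiom that the twist of the dual is the dual of the twist enters here: the two closures of
the loop differ by twists on `A` and on its dual, and these cancel. -/
theorem spherical {A : C} (f : A ⟶ A) :
    η_ A Aᘁ ≫ f ▷ Aᘁ ≫ pivEv A Aᘁ = pivCoev A Aᘁ ≫ Aᘁ ◁ f ≫ ε_ A Aᘁ := by
  have h := RibbonCategory.twist_naturality (η_ A Aᘁ)
  rw [twist_unit, Category.id_comp, RibbonCategory.twist_tensor] at h
  have h1 : η_ A Aᘁ ≫ (β_ A Aᘁ).hom = η_ A Aᘁ ≫ (β_ Aᘁ A).inv ≫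
      (RibbonCategory.twist Aᘁ).inv ▷ A ≫ Aᘁ ◁ (RibbonCategory.twist A).inv := by
    conv_rhs => rw [← h]
    simp only [Category.assoc, BraidedCategory.braiding_inv_naturality_assoc,
      Iso.hom_inv_id_assoc]
    rw [tensorHom_def', Category.assoc, hom_inv_whiskerRight_assoc, whiskerLeft_hom_inv,
      Category.comp_id]
  have h2 : (RibbonCategory.twist Aᘁ).inv ▷ A ≫ ε_ A Aᘁ =
      Aᘁ ◁ (RibbonCategory.twist A).inv ≫ ε_ A Aᘁ := by
    rw [← cancel_epi ((RibbonCategory.twist Aᘁ).hom ▷ A), hom_inv_whiskerRight_assoc,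
      ← whisker_exchange_assoc, twist_dual_evaluation, whiskerLeft_inv_hom_assoc]
  have h3 : (RibbonCategory.twist A).inv ≫ f ≫ (RibbonCategory.twist A).hom = f := by
    rw [RibbonCategory.twist_naturality, Iso.inv_hom_id_assoc]
  rw [pivEv, pivCoev, ← comp_whiskerRight_assoc, BraidedCategory.braiding_naturality_left_assoc,
    reassoc_of% h1, ← MonoidalCategory.whiskerLeft_comp_assoc, h3, ← whisker_exchange_assoc, h2,
    ← MonoidalCategory.whiskerLeft_comp_assoc, Category.assoc, Category.assoc,
    ← MonoidalCategory.whiskerLeft_comp_assoc]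
  congr 4
  rw [Iso.eq_inv_comp, ← Category.assoc, ← RibbonCategory.twist_naturality, Category.assoc,
    Iso.hom_inv_id, Category.comp_id]

end PartialTrace

/-! ### Mates under the pivotal structure -/

section Bend

variable {C : Type u} [Category.{v} C] [MonoidalCategory C] [BraidedCategory C]
  [RigidCategory C] [RibbonCategory C]

/-- The mate `A ⟶ Z* ⊗ A'` of `Z ⊗ A ⟶ A'`. -/
def mateIn {Z A A' : C} (f : Z ⊗ A ⟶ A') : A ⟶ Zᘁ ⊗ A' :=
  (λ_ A).inv ≫ pivCoev Z Zᘁ ▷ A ≫ (α_ (Zᘁ) Z A).hom ≫ Zᘁ ◁ f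

/-- The mate `Z* ⊗ A' ⟶ A` of `A' ⟶ Z ⊗ A`. -/
def mateOut {Z A A' : C} (g : A' ⟶ Z ⊗ A) : Zᘁ ⊗ A' ⟶ A :=
  Zᘁ ◁ g ≫ (α_ (Zᘁ) Z A).inv ≫ ε_ Z Zᘁ ▷ A ≫ (λ_ A).hom

theorem mateIn_mateOut {Z A A' : C} (f : Z ⊗ A ⟶ A') (g : A' ⟶ Z ⊗ A) :
    mateIn f ≫ mateOut g = ltr Zᘁ (f ≫ g) := by
  simp [mateIn, mateOut, ltr]

theorem mateIn_surjective {Z A A' : C} : Function.Surjective (mateIn (Z := Z) (A := A) (A' := A')) :=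
  (@tensorLeftHomEquiv C _ _ A Zᘁ Z A' (pivPairing Z Zᘁ)).surjective

theorem mateOut_surjective {Z A A' : C} :
    Function.Surjective (mateOut (Z := Z) (A := A) (A' := A')) :=
  (tensorLeftHomEquiv A' Z Zᘁ A).symm.surjective

theorem mateIn_spec {Z A A' : C} (f : Z ⊗ A ⟶ A') :
    Z ◁ mateIn f ≫ (α_ Z (Zᘁ) A').inv ≫ pivEv Z Zᘁ ▷ A' ≫ (λ_ A').hom = f :=
  (@tensorLeftHomEquiv C _ _ A Zᘁ Z A' (pivPairing Z Zᘁ)).symm_apply_apply f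

theorem mateOut_spec {Z A A' : C} (g : A' ⟶ Z ⊗ A) :
    (λ_ A').inv ≫ η_ Z Zᘁ ▷ A' ≫ (α_ Z (Zᘁ) A').hom ≫ Z ◁ mateOut g = g :=
  (tensorLeftHomEquiv A' Z Zᘁ A).apply_symm_apply g

theorem pivCoev_ne_zero [Preadditive C] [MonoidalPreadditive C] (A : C) (h : 𝟙 A ≠ 0) :
    pivCoev A Aᘁ ≠ 0 := by
  intro h0
  have : A ◁ pivCoev A Aᘁ ≫ (α_ A Aᘁ A).inv ≫ pivEv A Aᘁ ▷ A = (ρ_ A).hom ≫ (λ_ A).inv :=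
    (pivPairing A Aᘁ).coevaluation_evaluation'
  rw [h0, MonoidalPreadditive.whiskerLeft_zero, zero_comp] at this
  apply h
  rw [← cancel_epi (ρ_ A).hom, ← cancel_mono (λ_ A).inv, Category.assoc, Category.id_comp, ← this]
  simp

end Bend

/-! ### Quantum traces and dimensions -/

section Trace

variable (k : Type w) {C : Type u} [Field k] [Category.{v} C] [Abelian C]
  [Linear k C] [MonoidalCategory C] [MonoidalPreadditive C] [MonoidalLinear k C]
  [BraidedCategory C] [RigidCategory C] [RibbonCategory C]

variable {k} in
theorem ptr_add {X Y A : C} (B : C) [ExactPairing A B] (f g : X ⊗ A ⟶ Y ⊗ A) :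
    ptr B (f + g) = ptr B f + ptr B g := by
  simp [ptr, MonoidalPreadditive.add_whiskerRight]

theorem ptr_smul {X Y A : C} (B : C) [ExactPairing A B] (c : k) (f : X ⊗ A ⟶ Y ⊗ A) :
    ptr B (c • f) = c • ptr B f := by
  simp [ptr, MonoidalLinear.smul_whiskerRight]

/-- The partial trace as a linear map. -/
def ptrₗ (X Y A B : C) [ExactPairing A B] : (X ⊗ A ⟶ Y ⊗ A) →ₗ[k] (X ⟶ Y) where
  toFun := ptr B
  map_add' := ptr_add B
  map_smul' := ptr_smul k B

include k in
theorem ptr_sum {ι : Type*} (s : Finset ι) {X Y A : C} (B : C) [ExactPairing A B]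
    (f : ι → (X ⊗ A ⟶ Y ⊗ A)) : ptr B (∑ i ∈ s, f i) = ∑ i ∈ s, ptr B (f i) :=
  map_sum (ptrₗ k X Y A B) f s

variable [FusionCategory k C]

include k in
theorem unit_ne_zero : 𝟙 (𝟙_ C) ≠ 0 := by
  intro h0
  have : Subsingleton (𝟙_ C ⟶ 𝟙_ C) := ⟨fun f g => by
    rw [← Category.id_comp f, ← Category.id_comp g, h0, zero_comp, zero_comp]⟩
  have h1 : Module.finrank k (𝟙_ C ⟶ 𝟙_ C) = 0 := Module.finrank_zero_of_subsingleton
  rw [FusionCategory.end_unit] at h1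
  exact one_ne_zero h1

/-- `End(𝟙) = k`. -/
def unitEquiv : (𝟙_ C ⟶ 𝟙_ C) ≃ₗ[k] k :=
  (LinearEquiv.ofBijective (LinearMap.toSpanSingleton k (𝟙_ C ⟶ 𝟙_ C) (𝟙 (𝟙_ C)))
    ⟨fun a b h => smul_left_injective k (unit_ne_zero k) (by simpa using h), fun f =>
      (finrank_eq_one_iff_of_nonzero' _ (unit_ne_zero k)).mp
        (FusionCategory.end_unit (k := k) (C := C)) f⟩).symm

theorem unitEquiv_smul_id (f : 𝟙_ C ⟶ 𝟙_ C) : unitEquiv k f • 𝟙 (𝟙_ C) = f :=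
  (unitEquiv k).symm_apply_apply f

theorem unitEquiv_id : unitEquiv k (𝟙 (𝟙_ C)) = 1 := by
  rw [← (unitEquiv k (C := C)).symm.injective.eq_iff, LinearEquiv.symm_apply_apply]
  exact (one_smul k _).symm

/-- The quantum trace. -/
def tr {A : C} : (A ⟶ A) →ₗ[k] k where
  toFun f := unitEquiv k (η_ A Aᘁ ≫ f ▷ Aᘁ ≫ pivEv A Aᘁ)
  map_add' f g := by simp [MonoidalPreadditive.add_whiskerRight]
  map_smul' c f := by simp [MonoidalLinear.smul_whiskerRight]

/-- The quantum dimension. -/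
def qdim (A : C) : k := tr k (𝟙 A)

theorem tr_apply {A : C} (f : A ⟶ A) : tr k f = unitEquiv k (η_ A Aᘁ ≫ f ▷ Aᘁ ≫ pivEv A Aᘁ) := rfl

theorem tr_eq {A : C} (B : C) [ExactPairing A B] (f : A ⟶ A) :
    tr k f = unitEquiv k (η_ A B ≫ f ▷ B ≫ pivEv A B) := by
  obtain ⟨m, h1, -, h2⟩ := exists_mate Aᘁ B f
  rw [tr_apply, reassoc_of% h1, h2]

theorem tr_comp_comm {A A' : C} (f : A ⟶ A') (g : A' ⟶ A) : tr k (f ≫ g) = tr k (g ≫ f) := by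
  obtain ⟨m, h1, -, h2⟩ := exists_mate Aᘁ A'ᘁ f
  rw [tr_apply, comp_whiskerRight, Category.assoc, reassoc_of% h1, whisker_exchange_assoc, h2,
    tr_apply, comp_whiskerRight, Category.assoc]

theorem ptr_whiskerLeft_eq_smul {X A : C} (f : A ⟶ A) : ptr Aᘁ (X ◁ f) = tr k f • 𝟙 X := by
  rw [ptr_id_tensor, ← unitEquiv_smul_id k (_ ≫ _), ← tr_apply]
  simp

theorem ptr_whiskerRight {X Y A : C} (f : X ⟶ Y) : ptr Aᘁ (f ▷ A) = qdim k A • f := by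
  have h := ptr_comp_left Aᘁ f (Y ◁ 𝟙 A)
  rw [ptr_whiskerLeft_eq_smul k] at h
  simpa [qdim] using h

theorem tr_ptr {Z A : C} (f : Z ⊗ A ⟶ Z ⊗ A) : tr k (ptr Aᘁ f) = tr k f := by
  have e : ∀ {W B : C} [ExactPairing W B] (g : W ⟶ W),
      η_ W B ≫ g ▷ B ≫ pivEv W B = ptr B ((λ_ W).hom ≫ g ≫ (λ_ W).inv) := by
    intros
    unfold ptr
    monoidal
  rw [tr_eq k (A := Z ⊗ A) (Aᘁ ⊗ Zᘁ) f, tr_apply, e, e, ptr_tensor, ← ptr_natural]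
  simp

/-- Close `A` on the right and `Z` on the left, in either order; sphericality moves the loop of `Z`
to the right. -/
theorem tr_ltr {Z A : C} (f : Z ⊗ A ⟶ Z ⊗ A) : tr k (ltr Zᘁ f) = tr k f := by
  rw [← tr_ptr, tr_apply, tr_apply, ltr_ptr, spherical]

theorem qdim_tensor (Z A : C) : qdim k (Z ⊗ A) = qdim k Z * qdim k A := by
  rw [qdim, ← tr_ptr, ← id_whiskerRight, ptr_whiskerRight k, map_smul, smul_eq_mul, mul_comm]
  rfl

theorem qdim_dual (Z : C) : qdim k Zᘁ = qdim k Z := by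
  let := pivPairing Z Zᘁ
  rw [qdim, tr_eq k Z, pivEv_pivPairing, qdim, tr_apply, spherical]
  simp only [id_whiskerRight, MonoidalCategory.whiskerLeft_id]
  rfl

theorem qdim_unit : qdim k (𝟙_ C) = 1 := by
  rw [qdim, tr_eq k (𝟙_ C), pivEv, twist_unit, ← unitEquiv_id k (C := C)]
  congr 1
  have h1 : η_ (𝟙_ C) (𝟙_ C) = (ρ_ _).inv := rfl
  have h2 : ε_ (𝟙_ C) (𝟙_ C) = (ρ_ _).hom := rfl
  rw [h1, h2]
  simp only [id_whiskerRight, braiding_tensorUnit_left, Category.id_comp, Category.assoc,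
    Iso.inv_hom_id, Category.comp_id]
  rw [unitors_equal, Iso.inv_hom_id]

theorem qdim_iso {A A' : C} (e : A ≅ A') : qdim k A = qdim k A' := by
  rw [qdim, ← e.hom_inv_id, tr_comp_comm, e.inv_hom_id, qdim]

end Trace

/-! ### Rotating dual bases -/

section Fusion

variable (k : Type w) {C : Type u} [Field k] [IsAlgClosed k] [Category.{v} C] [Abelian C]
  [Linear k C] [MonoidalCategory C] [MonoidalPreadditive C] [MonoidalLinear k C]
  [BraidedCategory C] [RigidCategory C] [RibbonCategory C] [FusionCategory k C]
  (R : SimpleReps C)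

/-- Dual bases of `Hom(W, a)` and `Hom(a, W)` for a representative `a`. -/
abbrev SimpleReps.bases (W : C) (a : Fin R.card) : DualBases k W (R.obj a) :=
  dualBases k W (R.obj a) (R.simple a)

variable {R} in
theorem exists_smul_id {a : Fin R.card} (f : R.obj a ⟶ R.obj a) : ∃ c : k, f = c • 𝟙 _ := by
  have := R.simple a
  have : FiniteDimensional k (R.obj a ⟶ R.obj a) := FusionCategory.finite_hom _ _
  obtain ⟨c, hc⟩ := endomorphism_simple_eq_smul_id k f
  exact ⟨c, hc.symm⟩

theorem qdim_eq_sum (W : C) : qdim k W = ∑ a, (R.bases k W a).card * qdim k (R.obj a) := by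
  rw [qdim, ← R.sum_dualBases k W, map_sum]
  refine Finset.sum_congr rfl fun a _ => ?_
  rw [map_sum, Finset.sum_congr rfl fun l _ => show _ = qdim k (R.obj a) by
    rw [tr_comp_comm, DualBases.pairing, if_pos rfl, qdim]]
  simp

/-- The composite is a scalar by Schur's lemma. Its trace is that of φ^l followed by φ_m, so the
normalisation changes by the ratio of the dimensions of `b` and `a`. -/
theorem smul_mateIn_mateOut {Z : C} {a b : Fin R.card} (m l : Fin (R.bases k (Z ⊗ R.obj a) b).card) :
    qdim k (R.obj a) • (mateIn ((R.bases k (Z ⊗ R.obj a) b).φ m) ≫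
      mateOut ((R.bases k (Z ⊗ R.obj a) b).φdual l)) =
      (if m = l then qdim k (R.obj b) else 0) • 𝟙 (R.obj a) := by
  rw [mateIn_mateOut]
  obtain ⟨c, hc⟩ := exists_smul_id k (ltr Zᘁ ((R.bases k (Z ⊗ R.obj a) b).φ m ≫
    (R.bases k (Z ⊗ R.obj a) b).φdual l))
  have h := congrArg (tr k) hc
  rw [tr_ltr, tr_comp_comm, DualBases.pairing, map_smul, smul_eq_mul] at h
  rw [hc, smul_smul, mul_comm]
  change _ = c * qdim k _ at h
  rw [← h]
  split_ifs <;> simp [qdim]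

/-- Up to these factors the rotated vectors are dual bases for `Zᘁ ⊗ R.obj b`, and this is their
completeness relation. -/
theorem sum_smul_mateOut_mateIn (Z : C) (b : Fin R.card) :
    ∑ a, ∑ l, qdim k (R.obj a) • (mateOut ((R.bases k (Z ⊗ R.obj a) b).φdual l) ≫
      mateIn ((R.bases k (Z ⊗ R.obj a) b).φ l)) = qdim k (R.obj b) • 𝟙 (Zᘁ ⊗ R.obj b) := by
  refine R.hom_ext k fun a x => ?_
  obtain ⟨y, rfl⟩ := mateIn_surjective x
  have hlin : ∃ L : (Z ⊗ R.obj a ⟶ R.obj b) →ₗ[k] (R.obj a ⟶ Zᘁ ⊗ R.obj b), ∀ f, L f = mateIn f :=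
    ⟨⟨⟨mateIn, fun f g => by simp [mateIn]⟩, fun c f => by simp [mateIn]⟩, fun f => rfl⟩
  obtain ⟨L, hL⟩ := hlin
  rw [Preadditive.comp_sum, Finset.sum_eq_single a]
  · have h : (Linear.rightComp k _ (∑ l, qdim k (R.obj a) •
        (mateOut ((R.bases k (Z ⊗ R.obj a) b).φdual l) ≫
          mateIn ((R.bases k (Z ⊗ R.obj a) b).φ l)))).comp L =
        (Linear.rightComp k _ (qdim k (R.obj b) • 𝟙 (Zᘁ ⊗ R.obj b))).comp L := by
      refine (R.bases k (Z ⊗ R.obj a) b).φ.ext fun m => ?_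
      simp only [LinearMap.comp_apply, Linear.rightComp_apply, hL, Preadditive.comp_sum,
        Linear.comp_smul]
      rw [Finset.sum_congr rfl fun l _ => by
        rw [← Category.assoc, ← Linear.smul_comp, smul_mateIn_mateOut]]
      rw [Finset.sum_eq_single m]
      · simp
      · intro l _ hl
        rw [if_neg hl.symm]
        simp
      · simp
    have := LinearMap.congr_fun h y
    simpa only [LinearMap.comp_apply, Linear.rightComp_apply, hL] using this
  · intro a' _ ha'
    rw [Preadditive.comp_sum]
    refine Finset.sum_eq_zero fun l _ => ?_
    rw [Linear.comp_smul, ← Category.assoc, R.hom_eq_zero ha'.symm (_ ≫ mateOut _), zero_comp,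
      smul_zero]
  · simp

end Fusion

/-! ### The handle slide and the global dimension -/

section

open scoped Matrix

section HandleSlide

variable {C : Type u} [Category.{v} C] [MonoidalCategory C] [BraidedCategory C]
  [RigidCategory C] [RibbonCategory C]

/-- The morphism `g : X ⊗ A ⟶ Y ⊗ A` between a cap and a cup of the strand `Z`. -/
def capCup {X Y A : C} (Z : C) (g : X ⊗ A ⟶ Y ⊗ A) : (X ⊗ Z) ⊗ (Zᘁ ⊗ A) ⟶ (Y ⊗ Z) ⊗ (Zᘁ ⊗ A) :=
  (α_ (X ⊗ Z) Zᘁ A).inv ≫ ((α_ X Z Zᘁ).hom ≫ X ◁ pivEv Z Zᘁ ≫ (ρ_ X).hom) ▷ A ≫ g ≫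
    ((ρ_ Y).inv ≫ Y ◁ η_ Z Zᘁ ≫ (α_ Y Z Zᘁ).inv) ▷ A ≫ (α_ (Y ⊗ Z) Zᘁ A).hom

theorem mate_capCup {X Y A B B' Z : C} (g : X ⊗ A ⟶ Y ⊗ A) (φ : Z ⊗ B ⟶ A) (ψ : A ⟶ Z ⊗ B') :
    (X ⊗ Z) ◁ mateIn φ ≫ capCup Z g ≫ (Y ⊗ Z) ◁ mateOut ψ =
      (α_ X Z B).hom ≫ X ◁ φ ≫ g ≫ Y ◁ ψ ≫ (α_ Y Z B').inv := by
  conv_rhs => rw [← mateIn_spec φ, ← mateOut_spec ψ]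
  unfold capCup
  monoidal

/-- Closing the dual strand of `Z` joins the cap and the cup to a straight strand `Z` beside the
loop. The pivotal pairing is used for the dual of `Zᘁ`, so that both zigzags match. -/
theorem ptr_capCup {X Y A : C} (Z : C) (g : X ⊗ A ⟶ Y ⊗ A) (B : C) [ExactPairing A B] :
    @ptr C _ _ _ _ _ _ _ _ (B ⊗ Z) (@ExactPairing.tensor C _ _ _ _ _ _ (pivPairing Z Zᘁ) _)
      (capCup Z g) = ptr B g ▷ Z := by
  let i1 := pivPairing Z Zᘁ
  rw [ptr_tensor]
  have e1 : (α_ (X ⊗ Z) Zᘁ A).hom ≫ capCup Z g ≫ (α_ (Y ⊗ Z) Zᘁ A).inv =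
      ((α_ X Z Zᘁ).hom ≫ X ◁ pivEv Z Zᘁ ≫ (ρ_ X).hom) ▷ A ≫ g ≫
      ((ρ_ Y).inv ≫ Y ◁ η_ Z Zᘁ ≫ (α_ Y Z Zᘁ).inv) ▷ A := by
    simp [capCup]
  have z1 : X ◁ Z ◁ pivCoev Z Zᘁ ⊗≫ X ◁ (pivEv Z Zᘁ ▷ Z) = 𝟙 _ ⊗≫ 𝟙 _ := by
    have h : Z ◁ pivCoev Z Zᘁ ≫ (α_ Z Zᘁ Z).inv ≫ pivEv Z Zᘁ ▷ Z = (ρ_ Z).hom ≫ (λ_ Z).inv :=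
      i1.coevaluation_evaluation'
    calc _ = X ◁ (Z ◁ pivCoev Z Zᘁ ≫ (α_ Z Zᘁ Z).inv ≫ pivEv Z Zᘁ ▷ Z) := by monoidal
      _ = _ := by rw [h]; monoidal
  have z2 : Y ◁ (η_ Z Zᘁ ▷ Z) ⊗≫ Y ◁ Z ◁ ε_ Z Zᘁ = 𝟙 _ ⊗≫ 𝟙 _ := by
    have h := ExactPairing.evaluation_coevaluation Z Zᘁ
    calc _ = Y ◁ (η_ Z Zᘁ ▷ Z ≫ (α_ _ _ _).hom ≫ Z ◁ ε_ Z Zᘁ) := by monoidal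
      _ = _ := by rw [h]; monoidal
  rw [e1, ptr_natural, ptr, pivEv_pivPairing]
  have e2 : @ExactPairing.coevaluation C _ _ Zᘁ Z i1 = pivCoev Z Zᘁ := rfl
  rw [e2]
  calc _ = 𝟙 _ ⊗≫ (X ◁ Z ◁ pivCoev Z Zᘁ ⊗≫ X ◁ (pivEv Z Zᘁ ▷ Z)) ⊗≫ ptr B g ▷ Z ⊗≫
        (Y ◁ (η_ Z Zᘁ ▷ Z) ⊗≫ Y ◁ Z ◁ ε_ Z Zᘁ) ⊗≫ 𝟙 _ := by monoidal
    _ = _ := by rw [z1, z2]; monoidal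

end HandleSlide

section Fusion

variable (k : Type w) {C : Type u} [Field k] [IsAlgClosed k] [Category.{v} C] [Abelian C]
  [Linear k C] [MonoidalCategory C] [MonoidalPreadditive C] [MonoidalLinear k C]
  [BraidedCategory C] [RigidCategory C] [RibbonCategory C] [FusionCategory k C]
  (R : SimpleReps C)

/-- Bending `Z` turns the two vertices into their mates around `capCup Z g`. Cyclicity brings the
mates together, and the completeness relation of the rotated bases then removes them. -/
theorem sum_smul_ptr_bases {X Y : C} (Z : C) (b : Fin R.card) (g : X ⊗ R.obj b ⟶ Y ⊗ R.obj b) :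
    ∑ a, ∑ l, qdim k (R.obj a) • ptr (R.obj a)ᘁ ((α_ X Z (R.obj a)).hom ≫
      X ◁ (R.bases k (Z ⊗ R.obj a) b).φ l ≫ g ≫ Y ◁ (R.bases k (Z ⊗ R.obj a) b).φdual l ≫
      (α_ Y Z (R.obj a)).inv) = qdim k (R.obj b) • (ptr (R.obj b)ᘁ g) ▷ Z := by
  let i1 := pivPairing Z Zᘁ
  let T := ptrₗ k (X ⊗ Z) (Y ⊗ Z) (Zᘁ ⊗ R.obj b) ((R.obj b)ᘁ ⊗ Z)
  have hT : ∀ f, T f = ptr ((R.obj b)ᘁ ⊗ Z) f := fun f => rfl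
  have e : ∀ (a) (l), qdim k (R.obj a) • ptr (R.obj a)ᘁ ((α_ X Z (R.obj a)).hom ≫
      X ◁ (R.bases k (Z ⊗ R.obj a) b).φ l ≫ g ≫ Y ◁ (R.bases k (Z ⊗ R.obj a) b).φdual l ≫
      (α_ Y Z (R.obj a)).inv) = T (capCup Z g ≫ (Y ⊗ Z) ◁ (qdim k (R.obj a) •
        (mateOut ((R.bases k (Z ⊗ R.obj a) b).φdual l) ≫
          mateIn ((R.bases k (Z ⊗ R.obj a) b).φ l)))) := fun a l => by
    rw [← mate_capCup, ptr_slide (R.obj a)ᘁ ((R.obj b)ᘁ ⊗ Z), MonoidalLinear.whiskerLeft_smul,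
      Linear.comp_smul, map_smul, hT, MonoidalCategory.whiskerLeft_comp, Category.assoc]
  simp_rw [e]
  simp_rw [← map_sum, ← Preadditive.comp_sum, ← whiskerLeft_sum]
  rw [sum_smul_mateOut_mateIn, MonoidalLinear.whiskerLeft_smul, MonoidalCategory.whiskerLeft_id,
    Linear.comp_smul, Category.comp_id, map_smul, hT, ptr_capCup]

/-- The handle slide: the sum over a complete family of simple objects, weighted by their
dimensions, absorbs any further strand. -/
theorem handle_slide {X Y : C} (Z : C) (N : ∀ A : C, X ⊗ A ⟶ Y ⊗ A)
    (hN : ∀ {A B : C} (f : A ⟶ B), X ◁ f ≫ N B = N A ≫ Y ◁ f) :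
    ∑ a, qdim k (R.obj a) • ptr (R.obj a)ᘁ
      ((α_ X Z (R.obj a)).hom ≫ N (Z ⊗ R.obj a) ≫ (α_ Y Z (R.obj a)).inv) =
    (∑ a, qdim k (R.obj a) • ptr (R.obj a)ᘁ (N (R.obj a))) ▷ Z := by
  have e : ∀ a, N (Z ⊗ R.obj a) = ∑ b, ∑ l, X ◁ (R.bases k (Z ⊗ R.obj a) b).φ l ≫ N (R.obj b) ≫
      Y ◁ (R.bases k (Z ⊗ R.obj a) b).φdual l := fun a => by
    conv_lhs => rw [← Category.comp_id (N _), ← MonoidalCategory.whiskerLeft_id,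
      ← R.sum_dualBases k (Z ⊗ R.obj a)]
    simp only [whiskerLeft_sum, Preadditive.comp_sum, MonoidalCategory.whiskerLeft_comp]
    refine Finset.sum_congr rfl fun b _ => Finset.sum_congr rfl fun l _ => ?_
    rw [← Category.assoc, ← hN, Category.assoc]
  simp_rw [e]
  simp only [Preadditive.comp_sum, Preadditive.sum_comp, Category.assoc, ptr_sum k,
    Finset.smul_sum, sum_whiskerRight, MonoidalLinear.smul_whiskerRight]
  rw [Finset.sum_comm]
  exact Finset.sum_congr rfl fun b _ => sum_smul_ptr_bases k R Z b _

/-- If the dimension were 0, the coevaluation of `b`, a nonzero map from the unit, would pair to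
zero with every map back to the unit: the scalar of such a composite is a trace, which cyclicity
turns into a multiple of the dimension of `b`. Semisimplicity forbids this. -/
theorem qdim_ne_zero (b : Fin R.card) : qdim k (R.obj b) ≠ 0 := by
  intro h0
  obtain ⟨u, ⟨e⟩⟩ := R.exists_unit k
  have hu : qdim k (R.obj u) = 1 := by rw [← qdim_iso k e, qdim_unit]
  have hs := R.simple b
  obtain ⟨x, hx⟩ : ∃ x : R.obj u ⟶ (R.obj b)ᘁ ⊗ R.obj b, x ≠ 0 := by
    refine ⟨e.inv ≫ pivCoev (R.obj b) (R.obj b)ᘁ, fun h => ?_⟩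
    exact pivCoev_ne_zero (R.obj b) (id_nonzero _) (by simpa using h)
  refine hx (R.hom_ext' k fun a y => ?_)
  rw [zero_comp]
  by_cases ha : u = a
  · subst ha
    obtain ⟨f, rfl⟩ := mateIn_surjective x
    obtain ⟨g, rfl⟩ := mateOut_surjective y
    rw [mateIn_mateOut]
    obtain ⟨c, hc⟩ := exists_smul_id k (ltr (R.obj b)ᘁ (f ≫ g))
    obtain ⟨c', hc'⟩ := exists_smul_id k (g ≫ f)
    have h := congrArg (tr k) hc
    rw [tr_ltr, tr_comp_comm, hc', map_smul, map_smul] at h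
    change c' • qdim k _ = c • qdim k _ at h
    rw [h0, hu, smul_zero, smul_eq_mul, mul_one] at h
    rw [hc, ← h, zero_smul]
  · exact R.hom_eq_zero ha _

/-- Trace of the rotated completeness relation, divided by the dimension of `b`. Unlike
`qdim_eq_sum`, the sum runs over the object that is tensored with `Z`. -/
theorem sum_card_mul_qdim (Z : C) (b : Fin R.card) :
    ∑ a, (R.bases k (Z ⊗ R.obj a) b).card * qdim k (R.obj a) = qdim k Z * qdim k (R.obj b) := by
  have h := congrArg (tr k) (sum_smul_mateOut_mateIn k R Z b)
  simp only [map_sum, map_smul] at h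
  simp_rw [tr_comp_comm k (mateOut _)] at h
  simp_rw [← map_smul, smul_mateIn_mateOut, if_pos] at h
  simp only [map_smul, Finset.sum_const, Finset.card_univ, Fintype.card_fin] at h
  have e : tr k (𝟙 ((Z)ᘁ ⊗ R.obj b)) = qdim k Z * qdim k (R.obj b) := by
    rw [← qdim_dual k Z, ← qdim_tensor, qdim]
  rw [e] at h
  apply mul_left_cancel₀ (qdim_ne_zero k R b)
  rw [← smul_eq_mul (qdim k (R.obj b)) (qdim k Z * _), ← h, Finset.mul_sum]
  refine Finset.sum_congr rfl fun a _ => ?_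
  rw [nsmul_eq_mul, smul_eq_mul, show tr k (𝟙 (R.obj a)) = qdim k (R.obj a) from rfl]
  ring

/-- The global dimension `∑_a d_a²`. -/
def globalDim : k := ∑ a, qdim k (R.obj a) * qdim k (R.obj a)

theorem card_bases_unit {u : Fin R.card} (e : 𝟙_ C ≅ R.obj u) (a b : Fin R.card) :
    (R.bases k (R.obj u ⊗ R.obj a) b).card = if a = b then 1 else 0 := by
  have h1 : Module.finrank k (R.obj u ⊗ R.obj a ⟶ R.obj b) =
      (R.bases k (R.obj u ⊗ R.obj a) b).card := by
    simp [Module.finrank_eq_card_basis (R.bases k (R.obj u ⊗ R.obj a) b).φ]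
  have e' : (R.obj u ⊗ R.obj a ⟶ R.obj b) ≃ₗ[k] (R.obj a ⟶ R.obj b) :=
    Linear.homCongr k (whiskerRightIso e.symm (R.obj a) ≪≫ λ_ (R.obj a)) (Iso.refl _)
  rw [← h1, e'.finrank_eq]
  split_ifs with h
  · subst h
    have := R.simple a
    have : FiniteDimensional k (R.obj a ⟶ R.obj a) := FusionCategory.finite_hom _ _
    exact finrank_endomorphism_simple_eq_one k _
  · have : Subsingleton (R.obj a ⟶ R.obj b) := ⟨fun f g => by
      rw [R.hom_eq_zero h f, R.hom_eq_zero h g]⟩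
    exact Module.finrank_zero_of_subsingleton

/-- The sum of `N_z N_zᵀ` over the fusion matrices `N_z` of the simple objects. -/
def fusionGram (K : Type*) [CommRing K] : Matrix (Fin R.card) (Fin R.card) K :=
  fun a b => ∑ z, ∑ c, ((R.bases k (R.obj z ⊗ R.obj a) c).card : K) *
    ((R.bases k (R.obj z ⊗ R.obj b) c).card : K)

/-- The inner sum over `b` gives d_z d_c by `sum_card_mul_qdim`, the sum over `c` gives d_z d_a by
`qdim_eq_sum`, and Σ_z d_z² remains. -/
theorem fusionGram_mulVec_qdim :
    fusionGram k R k *ᵥ (fun a => qdim k (R.obj a)) =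
      globalDim k R • fun a => qdim k (R.obj a) := by
  funext a
  have : ∀ z, ∑ c, ∑ b, ((R.bases k (R.obj z ⊗ R.obj a) c).card : k) *
      ((R.bases k (R.obj z ⊗ R.obj b) c).card : k) * qdim k (R.obj b) =
      qdim k (R.obj z) * qdim k (R.obj z) * qdim k (R.obj a) := fun z => by
    simp_rw [mul_assoc, ← Finset.mul_sum, sum_card_mul_qdim, mul_left_comm _ (qdim k (R.obj z))]
    rw [← Finset.mul_sum, ← qdim_eq_sum, qdim_tensor]
  simp only [Matrix.mulVec, dotProduct, fusionGram, Finset.sum_mul, Pi.smul_apply, globalDim,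
    smul_eq_mul]
  simp_rw [← this]
  rw [Finset.sum_comm]
  exact Finset.sum_congr rfl fun z _ => Finset.sum_comm

/-- Over ℚ the matrix is `B * Bᵀ`, so by positivity its kernel is that of `Bᵀ`. -/
theorem fusionGram_det_ne_zero : (fusionGram k R ℚ).det ≠ 0 := by
  obtain ⟨u, ⟨e⟩⟩ := R.exists_unit k
  intro h0
  obtain ⟨x, hx, h⟩ := Matrix.exists_mulVec_eq_zero_iff.mpr h0
  let B : Matrix (Fin R.card) (Fin R.card × Fin R.card) ℚ :=
    Matrix.of fun a p => (R.bases k (R.obj p.1 ⊗ R.obj a) p.2).card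
  have hB : fusionGram k R ℚ = B * B.conjTranspose := by
    ext a b
    simp [Matrix.mul_apply, fusionGram, B, Fintype.sum_prod_type]
  rw [hB, Matrix.self_mul_conjTranspose_mulVec_eq_zero] at h
  refine hx (funext fun b => ?_)
  -- The rows for the unit object form an identity matrix, hence `Bᵀ` is injective.
  have h2 := congrFun h (u, b)
  simp only [Matrix.mulVec, dotProduct, Matrix.conjTranspose_apply, B, Matrix.of_apply,
    card_bases_unit k R e] at h2
  simpa using h2

/-- If D = 0, the nonzero vector of dimensions is in the kernel of the Gram matrix over `k`. Its
determinant is an integer, which would vanish in characteristic 0 and hence also over ℚ. -/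
theorem globalDim_ne_zero [CharZero k] : globalDim k R ≠ 0 := by
  intro h0
  obtain ⟨u, -⟩ := R.exists_unit k
  have h1 : (fusionGram k R k).det = 0 := by
    refine Matrix.exists_mulVec_eq_zero_iff.mp ⟨fun a => qdim k (R.obj a), fun h => ?_, ?_⟩
    · exact qdim_ne_zero k R u (congrFun h u)
    · rw [fusionGram_mulVec_qdim, h0, zero_smul]
  have h2 : fusionGram k R k = (Int.castRingHom k).mapMatrix (fusionGram k R ℤ) := by
    ext a b
    simp [fusionGram]
  have h3 : fusionGram k R ℚ = (Int.castRingHom ℚ).mapMatrix (fusionGram k R ℤ) := by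
    ext a b
    simp [fusionGram]
  apply fusionGram_det_ne_zero k R
  rw [h2, ← RingHom.map_det] at h1
  rw [h3, ← RingHom.map_det]
  have h4 : (fusionGram k R ℤ).det = 0 := by simpa using h1
  rw [h4, map_zero]

end Fusion

end

/-! ### Emission vertices as mates -/

section Emission

variable {C : Type u} [Category.{v} C] [MonoidalCategory C] [BraidedCategory C]
  [RigidCategory C] [RibbonCategory C]

/-- This property characterises the mate by `hom_dual_tensor_ext`; the naturality rules below are
verified on this side of the duality. -/
theorem emission_spec {Y Y' Z : C} (ψ : Y' ⟶ Z ⊗ Y) :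
    Y' ◁ emission ψ ≫ (α_ Y' Y'ᘁ Z).inv ≫ pivEv Y' Y'ᘁ ▷ Z ≫ (λ_ Z).hom =
      ψ ▷ Yᘁ ≫ (α_ Z Y Yᘁ).hom ≫ Z ◁ pivEv Y Yᘁ ≫ (ρ_ Z).hom :=
  (@tensorLeftHomEquiv C _ _ Yᘁ Y'ᘁ Y' Z (pivPairing Y' Y'ᘁ)).symm_apply_apply _

theorem hom_dual_tensor_ext {X Y' Z : C} {f g : X ⟶ Y'ᘁ ⊗ Z}
    (h : Y' ◁ f ≫ (α_ Y' Y'ᘁ Z).inv ≫ pivEv Y' Y'ᘁ ▷ Z ≫ (λ_ Z).hom =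
      Y' ◁ g ≫ (α_ Y' Y'ᘁ Z).inv ≫ pivEv Y' Y'ᘁ ▷ Z ≫ (λ_ Z).hom) : f = g :=
  (@tensorLeftHomEquiv C _ _ X Y'ᘁ Y' Z (pivPairing Y' Y'ᘁ)).symm.injective h

theorem mate_pivEv {A A' : C} (h : A ⟶ A') : A ◁ hᘁ ≫ pivEv A Aᘁ = h ▷ A'ᘁ ≫ pivEv A' A'ᘁ := by
  have e'' : A ◁ hᘁ ≫ (RibbonCategory.twist A).hom ▷ Aᘁ =
    (RibbonCategory.twist A).hom ▷ A'ᘁ ≫ A ◁ hᘁ := whisker_exchange _ _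
  rw [pivEv, reassoc_of% e'', BraidedCategory.braiding_naturality_right_assoc,
    rightAdjointMate_comp_evaluation, pivEv, ← comp_whiskerRight_assoc,
    RibbonCategory.twist_naturality, comp_whiskerRight_assoc,
    BraidedCategory.braiding_naturality_left_assoc h]

theorem emission_comp_left {Y Y' Y'' Z : C} (x : Y'' ⟶ Y') (ψ : Y' ⟶ Z ⊗ Y) :
    emission (x ≫ ψ) = emission ψ ≫ xᘁ ▷ Z := by
  refine hom_dual_tensor_ext ?_
  rw [emission_spec]
  calc _ = x ▷ Yᘁ ≫ (ψ ▷ Yᘁ ≫ (α_ Z Y Yᘁ).hom ≫ Z ◁ pivEv Y Yᘁ ≫ (ρ_ Z).hom) := by simp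
    _ = x ▷ Yᘁ ≫ (Y' ◁ emission ψ ≫ (α_ Y' Y'ᘁ Z).inv ≫ pivEv Y' Y'ᘁ ▷ Z ≫ (λ_ Z).hom) := by
      rw [emission_spec]
    _ = (Y'' ◁ emission ψ) ≫ (α_ _ _ _).inv ≫ (x ▷ Y'ᘁ ≫ pivEv Y' Y'ᘁ) ▷ Z ≫ (λ_ Z).hom := by
      rw [← whisker_exchange_assoc]; monoidal
    _ = _ := by rw [← mate_pivEv]; monoidal

theorem emission_comp_whiskerLeft {Y Y' Y₂ Z : C} (ψ : Y' ⟶ Z ⊗ Y) (z : Y ⟶ Y₂) :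
    emission (ψ ≫ Z ◁ z) = zᘁ ≫ emission ψ := by
  refine hom_dual_tensor_ext ?_
  rw [emission_spec, MonoidalCategory.whiskerLeft_comp, Category.assoc, emission_spec,
    whisker_exchange_assoc]
  calc _ = ψ ▷ Y₂ᘁ ≫ (α_ _ _ _).hom ≫ Z ◁ (z ▷ Y₂ᘁ ≫ pivEv Y₂ Y₂ᘁ) ≫ (ρ_ Z).hom := by monoidal
    _ = _ := by rw [← mate_pivEv]; monoidal

theorem emission_comp_whiskerRight {Y Y' Z W : C} (ψ : Y' ⟶ Z ⊗ Y) (f : Z ⟶ W) :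
    emission (ψ ≫ f ▷ Y) = emission ψ ≫ Y'ᘁ ◁ f := by
  refine hom_dual_tensor_ext ?_
  rw [emission_spec]
  calc _ = (ψ ▷ Yᘁ ≫ (α_ Z Y Yᘁ).hom ≫ (f ▷ (Y ⊗ Yᘁ) ≫ W ◁ pivEv Y Yᘁ) ≫ (ρ_ W).hom) := by
        monoidal
    _ = (ψ ▷ Yᘁ ≫ (α_ Z Y Yᘁ).hom ≫ Z ◁ pivEv Y Yᘁ ≫ (ρ_ Z).hom) ≫ f := by
        rw [← whisker_exchange]; monoidal
    _ = Y' ◁ emission ψ ≫ (α_ Y' Y'ᘁ Z).inv ≫ (pivEv Y' Y'ᘁ ▷ Z ≫ 𝟙_ C ◁ f) ≫ (λ_ W).hom := by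
        rw [← emission_spec]; monoidal
    _ = _ := by rw [← whisker_exchange]; monoidal

theorem emission_comp {Y Y' Y'' Z₁ Z₂ : C} (ψ₁ : Y' ⟶ Z₁ ⊗ Y) (ψ₂ : Y'' ⟶ Z₂ ⊗ Y') :
    emission (ψ₂ ≫ Z₂ ◁ ψ₁ ≫ (α_ Z₂ Z₁ Y).inv) =
      emission ψ₁ ≫ emission ψ₂ ▷ Z₁ ≫ (α_ Y''ᘁ Z₂ Z₁).hom := by
  refine hom_dual_tensor_ext ?_
  rw [emission_spec]
  calc _ = ψ₂ ▷ Yᘁ ≫ (α_ _ _ _).hom ≫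
        Z₂ ◁ (ψ₁ ▷ Yᘁ ≫ (α_ Z₁ Y Yᘁ).hom ≫ Z₁ ◁ pivEv Y Yᘁ ≫ (ρ_ Z₁).hom) := by monoidal
    _ = (ψ₂ ▷ Yᘁ ≫ (Z₂ ⊗ Y') ◁ emission ψ₁) ≫ (α_ _ _ _).hom ≫ Z₂ ◁ ((α_ Y' Y'ᘁ Z₁).inv ≫
        pivEv Y' Y'ᘁ ▷ Z₁ ≫ (λ_ Z₁).hom) := by rw [← emission_spec]; monoidal
    _ = Y'' ◁ emission ψ₁ ≫ (α_ _ _ _).inv ≫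
        (ψ₂ ▷ Y'ᘁ ≫ (α_ Z₂ Y' Y'ᘁ).hom ≫ Z₂ ◁ pivEv Y' Y'ᘁ ≫ (ρ_ Z₂).hom) ▷ Z₁ := by
        rw [← whisker_exchange]; monoidal
    _ = _ := by rw [← emission_spec]; monoidal

theorem emission_unit (Y : C) : emission (λ_ Y).inv = (ρ_ Yᘁ).inv := by
  refine hom_dual_tensor_ext ?_
  rw [emission_spec]
  monoidal

theorem isIso_unit_pivEv (Y : C) [ExactPairing (𝟙_ C) Y] :
    IsIso ((λ_ Y).inv ≫ pivEv (𝟙_ C) Y) := by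
  have e : (λ_ Y).inv ≫ pivEv (𝟙_ C) Y = (ρ_ Y).inv ≫ ε_ (𝟙_ C) Y := by
    simp [pivEv, twist_unit, braiding_tensorUnit_left]
  rw [e]
  refine ⟨η_ (𝟙_ C) Y ≫ (λ_ _).hom, ?_, ?_⟩
  · have h := ExactPairing.coevaluation_evaluation (𝟙_ C) Y
    calc _ = (ρ_ Y).inv ≫ (ρ_ _).inv ≫ (ε_ (𝟙_ C) Y ▷ 𝟙_ C ≫ 𝟙_ C ◁ η_ (𝟙_ C) Y) ≫
          (λ_ _).hom ≫ (λ_ _).hom := by monoidal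
      _ = (ρ_ Y).inv ≫ (Y ◁ η_ (𝟙_ C) Y ≫ (α_ _ _ _).inv ≫
          ε_ (𝟙_ C) Y ▷ Y) ≫ (λ_ _).hom := by rw [← whisker_exchange]; monoidal
      _ = _ := by rw [h]; simp
  · have h := ExactPairing.evaluation_coevaluation (𝟙_ C) Y
    calc _ = (ρ_ _).inv ≫ (η_ (𝟙_ C) Y ▷ 𝟙_ C ≫ (α_ _ _ _).hom ≫
          𝟙_ C ◁ ε_ (𝟙_ C) Y) ≫ (λ_ _).hom := by monoidal
      _ = _ := by rw [h]; simp [← unitors_inv_equal]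

theorem isIso_comp_pivEv {U : C} (e : 𝟙_ C ≅ U) :
    IsIso ((λ_ Uᘁ).inv ≫ e.hom ▷ Uᘁ ≫ pivEv U Uᘁ) := by
  let i1 : ExactPairing (𝟙_ C) Uᘁ := exactPairingCongrLeft e
  have h : pivEv (𝟙_ C) Uᘁ = e.hom ▷ Uᘁ ≫ pivEv U Uᘁ := by
    have h1 : ε_ (𝟙_ C) Uᘁ = Uᘁ ◁ e.hom ≫ ε_ U Uᘁ := rfl
    rw [pivEv, h1, pivEv, ← comp_whiskerRight_assoc, RibbonCategory.twist_naturality,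
      comp_whiskerRight_assoc, BraidedCategory.braiding_naturality_left_assoc e.hom]
  rw [← h]
  exact isIso_unit_pivEv _

theorem emission_rightUnitor_inv {A U : C} (e : 𝟙_ C ⟶ U) :
    emission ((ρ_ A).inv ≫ A ◁ e) =
      ((λ_ Uᘁ).inv ≫ e ▷ Uᘁ ≫ pivEv U Uᘁ) ≫ pivCoev A Aᘁ := by
  refine hom_dual_tensor_ext ?_
  rw [emission_spec]
  have h : A ◁ pivCoev A Aᘁ ≫ (α_ A Aᘁ A).inv ≫ pivEv A Aᘁ ▷ A = (ρ_ A).hom ≫ (λ_ A).inv :=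
    (pivPairing A Aᘁ).coevaluation_evaluation'
  simp only [MonoidalCategory.whiskerLeft_comp, Category.assoc]
  rw [reassoc_of% h]
  simp

/-- Emission from a trivially colored slot is a coevaluation of `A` up to the trivial factor `Uᘁ`;
bending its output straightens the zigzag. -/
theorem isIso_bend_emission {A U : C} (e : 𝟙_ C ≅ U) :
    IsIso (bend (pivEv A Aᘁ) ((λ_ _).hom ≫ emission ((ρ_ A).inv ≫ A ◁ e.hom))) := by
  have h : pivCoev A Aᘁ ▷ Aᘁ ≫ (α_ Aᘁ A Aᘁ).hom ≫ Aᘁ ◁ pivEv A Aᘁ = (λ_ Aᘁ).hom ≫ (ρ_ Aᘁ).inv :=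
    (pivPairing A Aᘁ).evaluation_coevaluation'
  have := isIso_comp_pivEv e
  rw [emission_rightUnitor_inv]
  have e1 : bend (pivEv A Aᘁ) ((λ_ _).hom ≫ ((λ_ Uᘁ).inv ≫ e.hom ▷ Uᘁ ≫ pivEv U Uᘁ) ≫
        pivCoev A Aᘁ) =
      (λ_ _).hom ▷ _ ≫ ((λ_ Uᘁ).inv ≫ e.hom ▷ Uᘁ ≫ pivEv U Uᘁ) ▷ _ ≫ (λ_ _).hom := by
    simp only [bend, comp_whiskerRight, Category.assoc]
    rw [reassoc_of% h]
    simp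
  rw [e1]
  infer_instance

end Emission

section Linear

variable (k : Type w) {C : Type u} [Field k] [Category.{v} C] [Abelian C]
  [Linear k C] [MonoidalCategory C] [MonoidalPreadditive C] [MonoidalLinear k C]
  [BraidedCategory C] [RigidCategory C] [RibbonCategory C]

/-- The mate as a linear map. -/
def emissionₗ (Y Y' Z : C) : (Y' ⟶ Z ⊗ Y) →ₗ[k] (Yᘁ ⟶ Y'ᘁ ⊗ Z) where
  toFun := emission
  map_add' f g := by simp [emission, MonoidalPreadditive.add_whiskerRight]
  map_smul' c f := by simp [emission, MonoidalLinear.smul_whiskerRight]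

end Linear

/-! ### The order of the slots of a gluing -/

section Word

variable {n : ℕ} (σ : AdmissibleGluing n)

theorem AdmissibleGluing.lo_lt_hi (i : σ.Orbit) : σ.lo i < σ.hi i := i.2

theorem AdmissibleGluing.slot_lo (i : σ.Orbit) : σ.slot (σ.lo i) = .first i := by
  exact dif_pos i.2

theorem AdmissibleGluing.slot_hi (i : σ.Orbit) : σ.slot (σ.hi i) = .second i := by
  have h : ¬ σ.hi i < σ.toPerm (σ.hi i) := by
    rw [AdmissibleGluing.hi, σ.involutive]
    exact not_lt_of_gt i.2
  rw [AdmissibleGluing.slot, dif_neg h]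
  congr 1
  exact Subtype.ext (σ.involutive _)

theorem AdmissibleGluing.slot_eq_first {p : Fin (2 * n)} {i : σ.Orbit} :
    σ.slot p = .first i ↔ p = σ.lo i := by
  refine ⟨fun h => ?_, fun h => h ▸ σ.slot_lo i⟩
  unfold AdmissibleGluing.slot at h
  split_ifs at h
  simp only [Slot.first.injEq] at h
  rw [← h]
  rfl

theorem AdmissibleGluing.slot_eq_second {p : Fin (2 * n)} {i : σ.Orbit} :
    σ.slot p = .second i ↔ p = σ.hi i := by
  refine ⟨fun h => ?_, fun h => h ▸ σ.slot_hi i⟩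
  unfold AdmissibleGluing.slot at h
  split_ifs at h
  simp only [Slot.second.injEq] at h
  rw [← h, AdmissibleGluing.hi, σ.involutive]

theorem filter_mem_finRange {N : ℕ} {l : List (Fin N)} (hl : l.Pairwise (· < ·)) :
    (List.finRange N).filter (· ∈ l) = l := by
  have h1 : ((List.finRange N).filter (· ∈ l)).Pairwise (· < ·) :=
    (List.pairwise_lt_finRange N).filter _
  refine List.Perm.eq_of_pairwise (le := (· < ·)) (fun a b _ _ h h' => (lt_asymm h h').elim) h1 hl ?_
  rw [List.perm_ext_iff_of_nodup (h1.imp fun h => h.ne) (hl.imp fun h => h.ne)]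
  simp

theorem AdmissibleGluing.pattern_word {L : List (Slot σ.Orbit)} {l : List (Fin (2 * n))}
    (hL : ∀ p, σ.slot p ∈ L ↔ p ∈ l) (hb : Slot.base ∉ L) (hl : l.Pairwise (· < ·)) :
    pattern L σ.word = l.map σ.slot := by
  classical
  rw [pattern, AdmissibleGluing.word, List.filter_append, List.filter_cons_of_neg (by simpa using hb),
    ← List.filter_append, List.take_append_drop, List.filter_map]
  congr 1
  conv_rhs => rw [← filter_mem_finRange hl]
  refine List.filter_congr fun p _ => ?_
  simp [hL]

theorem AdmissibleGluing.pattern_pair (i : σ.Orbit) :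
    pattern [.first i, .second i] σ.word = [Slot.first i, .second i] := by
  rw [σ.pattern_word (l := [σ.lo i, σ.hi i]) (by simp [slot_eq_first, slot_eq_second]) (by simp)
    (by simpa using σ.lo_lt_hi i)]
  simp [slot_lo, slot_hi]

theorem AdmissibleGluing.pattern_separate {i j : σ.Orbit} (h : σ.hi i < σ.lo j) :
    pattern [.first i, .second i, .first j, .second j] σ.word =
      [Slot.first i, .second i, .first j, .second j] := by
  rw [σ.pattern_word (l := [σ.lo i, σ.hi i, σ.lo j, σ.hi j])
    (by simp [slot_eq_first, slot_eq_second]) (by simp) (by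
      have h1 := σ.lo_lt_hi i
      have h2 := σ.lo_lt_hi j
      simp only [List.pairwise_cons, List.mem_cons, List.not_mem_nil, or_false, forall_eq_or_imp,
        forall_eq]
      grind)]
  simp [slot_lo, slot_hi]

theorem AdmissibleGluing.pattern_crossed {i j : σ.Orbit} (h₁ : σ.lo i < σ.lo j)
    (h₂ : σ.lo j < σ.hi i) (h₃ : σ.hi i < σ.hi j) :
    pattern [.first i, .second i, .first j, .second j] σ.word =
      [Slot.first i, .first j, .second i, .second j] := by
  rw [σ.pattern_word (l := [σ.lo i, σ.lo j, σ.hi i, σ.hi j])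
    (by simp only [List.mem_cons, List.not_mem_nil, slot_eq_first, slot_eq_second]; grind)
    (by simp) (by
      simp only [List.pairwise_cons, List.mem_cons, List.not_mem_nil, or_false, forall_eq_or_imp,
        forall_eq]
      grind)]
  simp [slot_lo, slot_hi]

theorem AdmissibleGluing.pattern_nested {i j : σ.Orbit} (h₁ : σ.lo i < σ.lo j)
    (h₂ : σ.hi j < σ.hi i) :
    pattern [.first i, .second i, .first j, .second j] σ.word =
      [Slot.first i, .first j, .second j, .second i] := by
  have h3 := σ.lo_lt_hi j
  rw [σ.pattern_word (l := [σ.lo i, σ.lo j, σ.hi j, σ.hi i])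
    (by simp only [List.mem_cons, List.not_mem_nil, slot_eq_first, slot_eq_second]; grind)
    (by simp) (by
      simp only [List.pairwise_cons, List.mem_cons, List.not_mem_nil, or_false, forall_eq_or_imp,
        forall_eq]
      grind)]
  simp [slot_lo, slot_hi]

theorem AdmissibleGluing.first_mem_word (i : σ.Orbit) : Slot.first i ∈ σ.word := by
  have : Slot.first i ∈ pattern [.first i, .second i] σ.word := by rw [σ.pattern_pair]; simp
  exact List.mem_of_mem_filter this

end Word

/-! ### From the given strands to sweeps -/

section Bridge

variable {C : Type u} [Category.{v} C] [Preadditive C] [MonoidalCategory C] [RigidCategory C]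
  (R : SimpleReps C) {K : Type}

/-- The word of slots as a product of the family of slots. -/
def wordIso (y : K → Fin R.card) (X : C) :
    ∀ t : List (Slot K), wordObj R y X t ≅ prodObj (slotObj R y X) t
  | [] => Iso.refl _
  | s :: t => whiskerLeftIso (slotObj R y X s) (wordIso y X t)

theorem wordMap_wordIso (y : K → Fin R.card) {X Y : C} (f : X ⟶ Y) (t : List (Slot K)) :
    wordMap R y f t ≫ (wordIso R y Y t).hom =
      (wordIso R y X t).hom ≫ prodMap (slotMap R y f) t := by
  induction t with
  | nil => rfl
  | cons s t ih =>
    have : (slotMap R y f s ⊗ₘ wordMap R y f t) ≫ slotObj R y Y s ◁ (wordIso R y Y t).hom =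
        slotObj R y X s ◁ (wordIso R y X t).hom ≫ (slotMap R y f s ⊗ₘ prodMap (slotMap R y f) t) := by
      rw [← id_tensorHom, ← id_tensorHom, tensorHom_comp_tensorHom, tensorHom_comp_tensorHom, ih]
      simp
    exact this

theorem wordDelta_wordIso (y y' : K → Fin R.card) (X : C) (t : List (Slot K)) :
    wordDelta R y y' X t ≫ (wordIso R y' X t).hom =
      (wordIso R y X t).hom ≫ prodMap (slotDelta R y y' X) t := by
  induction t with
  | nil => rfl
  | cons s t ih =>
    have : (slotDelta R y y' X s ⊗ₘ wordDelta R y y' X t) ≫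
        slotObj R y' X s ◁ (wordIso R y' X t).hom = slotObj R y X s ◁ (wordIso R y X t).hom ≫
          (slotDelta R y y' X s ⊗ₘ prodMap (slotDelta R y y' X) t) := by
      rw [← id_tensorHom, ← id_tensorHom, tensorHom_comp_tensorHom, tensorHom_comp_tensorHom, ih]
      simp
    exact this

theorem tensorHom_eq_hcomp_absorb {C : Type u} [Category.{v} C] [MonoidalCategory C]
    {Z A B T T' V : C} (φ : Z ⊗ A ⟶ B) (o : T ⟶ T' ⊗ V) :
    (α_ Z A T).inv ≫ (φ ⊗ₘ o) ≫ (α_ B T' V).inv = hcomp (φ ≫ (ρ_ B).inv) ((λ_ T).hom ≫ o) := by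
  rw [MonoidalCategory.tensorHom_def]
  dsimp only [hcomp]
  monoidal

theorem tensorHom_eq_hcomp_cross {C : Type u} [Category.{v} C] [MonoidalCategory C]
    [BraidedCategory C] {A B T T' V : C} (d : A ⟶ B) (o : T ⟶ T' ⊗ V) :
    (λ_ _).hom ≫ (d ⊗ₘ o) ≫ (α_ B T' V).inv = hcomp (cross (𝟙_ C) d) ((λ_ T).hom ≫ o) := by
  rw [MonoidalCategory.tensorHom_def, cross_unit]
  dsimp only [hcomp]
  monoidal

theorem emission_eq_hcomp {C : Type u} [Category.{v} C] [MonoidalCategory C]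
    {Z A B T T' V : C} (e : A ⟶ B ⊗ Z) (c : Z ⊗ T ⟶ T' ⊗ V) :
    (λ_ _).hom ≫ e ▷ T ≫ (α_ B Z T).hom ≫ B ◁ c ≫ (α_ B T' V).inv =
      hcomp ((λ_ _).hom ≫ e) c := by
  dsimp only [hcomp]
  monoidal

theorem whiskerLeft_hcomp_whiskerRight {C : Type u} [Category.{v} C] [MonoidalCategory C]
    {Z W V A B T T₁ S S₁ : C} (f : Z ⊗ A ⟶ B ⊗ W) (g : W ⊗ T ⟶ S ⊗ V) (p : T₁ ⟶ T) (q : S ⟶ S₁) :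
    Z ◁ A ◁ p ≫ hcomp f g ≫ (B ◁ q) ▷ V = hcomp f (W ◁ p ≫ g ≫ q ▷ V) := by
  rw [← id_tensorHom B, hcomp_whiskerRight, ← id_tensorHom A, whiskerLeft_hcomp]
  simp

variable [BraidedCategory C] [RibbonCategory C] [DecidableEq K]

variable {R} in
/-- The absorption of a strand in the first slot of the orbit `i`. -/
def absorbAt {i : K} {y y' : K → Fin R.card} (X : C) {Z : C}
    (φ : Z ⊗ R.obj (y i) ⟶ R.obj (y' i)) :
    Z ⊗ slotObj R y X (.first i) ⟶ slotObj R y' X (.first i) := φ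

variable {R} in
/-- The emission of a strand from the second slot of the orbit `i`. -/
def emitAt {i : K} {y y' : K → Fin R.card} (X : C) {Z : C}
    (ψ : R.obj (y' i) ⟶ Z ⊗ R.obj (y i)) :
    slotObj R y X (.second i) ⟶ slotObj R y' X (.second i) ⊗ Z := emission ψ

variable (i : K) {y y' : K → Fin R.card} (X : C) {Z : C}

theorem strandOut_self (ψ : R.obj (y' i) ⟶ Z ⊗ R.obj (y i)) (t : List (Slot K)) :
    (λ_ (wordObj R y X (.second i :: t))).hom ≫ strandOut R i X ψ (.second i :: t) =
      (hcomp ((λ_ _).hom ≫ emitAt X ψ) (cross Z (wordDelta R y y' X t)) :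
        𝟙_ C ⊗ (slotObj R y X (.second i) ⊗ wordObj R y X t) ⟶
          (slotObj R y' X (.second i) ⊗ wordObj R y' X t) ⊗ Z) := by
  rw [← emission_eq_hcomp]
  exact congrArg ((λ_ (slotObj R y X (.second i) ⊗ wordObj R y X t)).hom ≫ ·) (dif_pos rfl)

theorem strandOut_ne {s : Slot K} (hs : s ≠ .second i) (ψ : R.obj (y' i) ⟶ Z ⊗ R.obj (y i))
    (t : List (Slot K)) :
    (λ_ (wordObj R y X (s :: t))).hom ≫ strandOut R i X ψ (s :: t) =
      (hcomp (cross (𝟙_ C) (slotDelta R y y' X s))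
        ((λ_ (wordObj R y X t)).hom ≫ strandOut R i X ψ t) :
        𝟙_ C ⊗ (slotObj R y X s ⊗ wordObj R y X t) ⟶
          (slotObj R y' X s ⊗ wordObj R y' X t) ⊗ Z) := by
  rw [← tensorHom_eq_hcomp_cross]
  refine congrArg ((λ_ (slotObj R y X s ⊗ wordObj R y X t)).hom ≫ ·) ?_
  cases s with
  | first j => rfl
  | second j => exact dif_neg fun h => hs (by rw [h])
  | base =>
    have : (𝟙 X ⊗ₘ strandOut R i X ψ t) ≫ (α_ X (wordObj R y' X t) Z).inv =
      X ◁ strandOut R i X ψ t ≫ (α_ X (wordObj R y' X t) Z).inv := by rw [id_tensorHom]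
    exact this.symm

theorem strandIn_self (φ : Z ⊗ R.obj (y i) ⟶ R.obj (y' i)) (ψ : R.obj (y' i) ⟶ Z ⊗ R.obj (y i))
    (t : List (Slot K)) :
    strandIn R i X φ ψ (.first i :: t) =
      (hcomp (absorbAt X φ ≫ (ρ_ _).inv)
        ((λ_ (wordObj R y X t)).hom ≫ strandOut R i X ψ t) :
        Z ⊗ (slotObj R y X (.first i) ⊗ wordObj R y X t) ⟶
          (slotObj R y' X (.first i) ⊗ wordObj R y' X t) ⊗ Z) := by
  rw [← tensorHom_eq_hcomp_absorb]
  exact dif_pos rfl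

theorem strandIn_ne {s : Slot K} (hs : s ≠ .first i) (φ : Z ⊗ R.obj (y i) ⟶ R.obj (y' i))
    (ψ : R.obj (y' i) ⟶ Z ⊗ R.obj (y i)) (t : List (Slot K)) :
    strandIn R i X φ ψ (s :: t) =
      (hcomp (cross Z (slotDelta R y y' X s)) (strandIn R i X φ ψ t) :
        Z ⊗ (slotObj R y X s ⊗ wordObj R y X t) ⟶
          (slotObj R y' X s ⊗ wordObj R y' X t) ⊗ Z) := by
  cases s with
  | first j => exact dif_neg fun h => hs (by rw [h])
  | second j => rfl
  | base => rfl

/-- The left unitor supplies the unit strand with which `sweepOut` starts; then both sides follow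
the same recursion on the word. -/
theorem strandOut_eq (ψ : R.obj (y' i) ⟶ Z ⊗ R.obj (y i)) (t : List (Slot K)) :
    (λ_ (wordObj R y X t)).hom ≫ strandOut R i X ψ t =
      𝟙_ C ◁ (wordIso R y X t).hom ≫ sweepOut
        (slotDelta R y y' X) (.second i) (emitAt X ψ) t ≫ (wordIso R y' X t).inv ▷ Z := by
  induction t with
  | nil =>
    have h : strandOut R i X ψ [] = (0 : wordObj R y X [] ⟶ wordObj R y' X [] ⊗ Z) := rfl
    rw [h]
    simp [sweepOut]
  | cons s t ih =>
    by_cases hs : s = .second i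
    · subst hs
      have h : hcomp ((λ_ _).hom ≫ emitAt X ψ) (cross Z (wordDelta R y y' X t)) =
          𝟙_ C ◁ slotObj R y X (.second i) ◁ (wordIso R y X t).hom ≫
          sweepOut (slotDelta R y y' X) (.second i) (emitAt X ψ) (.second i :: t) ≫
            (slotObj R y' X (.second i) ◁ (wordIso R y' X t).inv) ▷ Z := by
        rw [sweepOut_self, whiskerLeft_hcomp_whiskerRight, cross_comp_whiskerRight,
          whiskerLeft_comp_cross, ← reassoc_of% wordDelta_wordIso]
        simp
      exact (strandOut_self R i X ψ t).trans h
    · have h : hcomp (cross (𝟙_ C) (slotDelta R y y' X s))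
            ((λ_ (wordObj R y X t)).hom ≫ strandOut R i X ψ t) =
          𝟙_ C ◁ slotObj R y X s ◁ (wordIso R y X t).hom ≫
          sweepOut (slotDelta R y y' X) (.second i) (emitAt X ψ) (s :: t) ≫
            (slotObj R y' X s ◁ (wordIso R y' X t).inv) ▷ Z := by
        rw [sweepOut_ne _ _ _ hs, whiskerLeft_hcomp_whiskerRight, ih]
      exact (strandOut_ne R i X hs ψ t).trans h

theorem strandIn_eq (φ : Z ⊗ R.obj (y i) ⟶ R.obj (y' i)) (ψ : R.obj (y' i) ⟶ Z ⊗ R.obj (y i))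
    (t : List (Slot K)) :
    strandIn R i X φ ψ t =
      Z ◁ (wordIso R y X t).hom ≫ sweepIn (slotDelta R y y' X) (.first i) (.second i)
        (absorbAt X φ) (emitAt X ψ) t ≫ (wordIso R y' X t).inv ▷ Z := by
  induction t with
  | nil =>
    have h : strandIn R i X φ ψ [] = (0 : Z ⊗ wordObj R y X [] ⟶ wordObj R y' X [] ⊗ Z) := rfl
    rw [h]
    simp [sweepIn]
  | cons s t ih =>
    by_cases hs : s = .first i
    · subst hs
      have h : hcomp (absorbAt X φ ≫ (ρ_ _).inv)
            ((λ_ (wordObj R y X t)).hom ≫ strandOut R i X ψ t) =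
          Z ◁ slotObj R y X (.first i) ◁ (wordIso R y X t).hom ≫
          sweepIn (slotDelta R y y' X) (.first i) (.second i) (absorbAt X φ) (emitAt X ψ)
            (.first i :: t) ≫ (slotObj R y' X (.first i) ◁ (wordIso R y' X t).inv) ▷ Z := by
        rw [sweepIn_self, whiskerLeft_hcomp_whiskerRight, strandOut_eq]
      exact (strandIn_self R i X φ ψ t).trans h
    · have h : hcomp (cross Z (slotDelta R y y' X s)) (strandIn R i X φ ψ t) =
          Z ◁ slotObj R y X s ◁ (wordIso R y X t).hom ≫
          sweepIn (slotDelta R y y' X) (.first i) (.second i) (absorbAt X φ) (emitAt X ψ)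
            (s :: t) ≫ (slotObj R y' X s ◁ (wordIso R y' X t).inv) ▷ Z := by
        rw [sweepIn_ne _ _ _ _ _ hs, whiskerLeft_hcomp_whiskerRight, ih]
      exact (strandIn_ne R i X hs φ ψ t).trans h

end Bridge

/-! ### Changing colors -/

section Delta

variable {C : Type u} [Category.{v} C] [Preadditive C] (R : SimpleReps C)

theorem delta_self (a : Fin R.card) : delta R a a = 𝟙 (R.obj a) := dif_pos rfl

theorem delta_ne {a b : Fin R.card} (h : a ≠ b) : delta R a b = 0 := dif_neg h

theorem delta_comp {a b c : Fin R.card} (h : a = b) : delta R a b ≫ delta R b c = delta R a c := by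
  subst h
  rw [delta_self, Category.id_comp]

theorem delta_comp' {a b c : Fin R.card} (h : b = c) :
    delta R a b ≫ delta R b c = delta R a c := by
  subst h
  rw [delta_self, Category.comp_id]

variable [MonoidalCategory C] [RigidCategory C] {K : Type} (X : C)

theorem isIso_slotDelta {y y' : K → Fin R.card} {s : Slot K}
    (h : ∀ j, s = .first j ∨ s = .second j → y j = y' j) : IsIso (slotDelta R y y' X s) := by
  cases s with
  | first j =>
    have : IsIso (delta R (y j) (y' j)) := by
      rw [← h j (Or.inl rfl), delta_self]
      infer_instance
    exact this
  | second j =>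
    have : IsIso (rightAdjointMate (delta R (y' j) (y j))) := by
      rw [← h j (Or.inr rfl), delta_self, rightAdjointMate_id]
      infer_instance
    exact this
  | base => exact inferInstanceAs (IsIso (𝟙 X))

/-- Agreement in one of the two steps is needed: if neither step fixes the color, the composite is 0
although the outer colors may agree. -/
theorem slotDelta_comp {y y' y'' : K → Fin R.card} {s : Slot K}
    (h : (∀ j, s = .first j ∨ s = .second j → y j = y' j) ∨
      ∀ j, s = .first j ∨ s = .second j → y' j = y'' j) :
    slotDelta R y y' X s ≫ slotDelta R y' y'' X s = slotDelta R y y'' X s := by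
  have hd : ∀ j, (s = .first j ∨ s = .second j) →
      delta R (y j) (y' j) ≫ delta R (y' j) (y'' j) = delta R (y j) (y'' j) ∧
      delta R (y'' j) (y' j) ≫ delta R (y' j) (y j) = delta R (y'' j) (y j) := fun j hj => by
    rcases h with h | h
    · exact ⟨delta_comp R (h j hj), delta_comp' R (h j hj).symm⟩
    · exact ⟨delta_comp' R (h j hj), delta_comp R (h j hj).symm⟩
  cases s with
  | first j => exact (hd j (Or.inl rfl)).1
  | second j =>
    have := congrArg (fun f => rightAdjointMate f) (hd j (Or.inr rfl)).2
    simp only [comp_rightAdjointMate] at this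
    exact this
  | base => exact Category.comp_id (𝟙 X)

theorem slotDelta_self (y : K → Fin R.card) (s : Slot K) :
    slotDelta R y y X s = 𝟙 (slotObj R y X s) := by
  cases s with
  | first j => exact delta_self R _
  | second j =>
    have : rightAdjointMate (delta R (y j) (y j)) = 𝟙 _ := by rw [delta_self, rightAdjointMate_id]
    exact this
  | base => rfl

theorem slotDelta_eq_zero [MonoidalPreadditive C] {y y' : K → Fin R.card} {j : K}
    (h : y j ≠ y' j) : slotDelta R y y' X (.first j) = 0 := delta_ne R h

end Delta

/-! ### Components of the induced half-braiding -/

section Handles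

variable (k : Type w) {C : Type u} [Field k] [IsAlgClosed k] [Category.{v} C] [Abelian C]
  [Linear k C] [MonoidalCategory C] [MonoidalPreadditive C] [MonoidalLinear k C]
  [BraidedCategory C] [RigidCategory C] [RibbonCategory C] [FusionCategory k C]
  {n : ℕ} (σ : AdmissibleGluing n) (R : SimpleReps C)

variable {R} in
/-- The summand of `X_σ` for the coloring `y`. -/
abbrev summand (y : σ.Orbit → Fin R.card) (X : C) : C := prodObj (slotObj R y X) σ.word

variable {R} in
/-- The inclusion of a word into `X_σ`. -/
def wordInc (y : σ.Orbit → Fin R.card) (X : C) : wordObj R y X σ.word ⟶ inducedObj σ R X :=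
  biproduct.ι (fun y : σ.Orbit → Fin R.card => wordObj R y X σ.word) y

variable {R} in
/-- The projection of `X_σ` to a word. -/
def wordPrj (y : σ.Orbit → Fin R.card) (X : C) : inducedObj σ R X ⟶ wordObj R y X σ.word :=
  biproduct.π (fun y : σ.Orbit → Fin R.card => wordObj R y X σ.word) y

theorem wordInc_wordPrj_self (y : σ.Orbit → Fin R.card) (X : C) :
    wordInc σ y X ≫ wordPrj σ y X = 𝟙 _ :=
  biproduct.ι_π_self _ _

theorem wordInc_wordPrj_ne {y y' : σ.Orbit → Fin R.card} (h : y ≠ y') (X : C) :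
    wordInc σ y X ≫ wordPrj σ y' X = 0 :=
  biproduct.ι_π_ne _ h

theorem sum_wordPrj_wordInc (X : C) :
    ∑ y : σ.Orbit → Fin R.card, wordPrj σ y X ≫ wordInc σ y X = 𝟙 (inducedObj σ R X) :=
  biproduct.total

variable {R} in
/-- The inclusion of a summand of `X_σ`. -/
def inc (y : σ.Orbit → Fin R.card) (X : C) : summand σ y X ⟶ inducedObj σ R X :=
  (wordIso R y X σ.word).inv ≫ wordInc σ y X

variable {R} in
/-- The projection to a summand of `X_σ`. -/
def prj (y : σ.Orbit → Fin R.card) (X : C) : inducedObj σ R X ⟶ summand σ y X :=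
  wordPrj σ y X ≫ (wordIso R y X σ.word).hom

theorem inc_prj_self (y : σ.Orbit → Fin R.card) (X : C) : inc σ y X ≫ prj σ y X = 𝟙 _ := by
  rw [inc, prj, Category.assoc, ← Category.assoc (wordInc σ y X), wordInc_wordPrj_self,
    Category.id_comp, Iso.inv_hom_id]

theorem inc_prj_ne {y y' : σ.Orbit → Fin R.card} (h : y ≠ y') (X : C) :
    inc σ y X ≫ prj σ y' X = 0 := by
  rw [inc, prj, Category.assoc, ← Category.assoc (wordInc σ y X), wordInc_wordPrj_ne σ R h,
    zero_comp, comp_zero]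

theorem sum_prj_inc (X : C) :
    ∑ y : σ.Orbit → Fin R.card, prj σ y X ≫ inc σ y X = 𝟙 (inducedObj σ R X) := by
  simp only [prj, inc, Category.assoc, Iso.hom_inv_id_assoc]
  exact sum_wordPrj_wordInc σ R X

variable {R} in
/-- A strand runs through the handle `i`. -/
def handle (i : σ.Orbit) (y y' : σ.Orbit → Fin R.card) (X Z : C) :
    (Z ⊗ R.obj (y i) ⟶ R.obj (y' i)) →ₗ[k] (R.obj (y' i) ⟶ Z ⊗ R.obj (y i)) →ₗ[k]
      (Z ⊗ summand σ y X ⟶ summand σ y' X ⊗ Z) :=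
  LinearMap.mk₂ k (fun φ ψ => sweepIn (slotDelta R y y' X) (.first i) (.second i)
      (absorbAt X φ) (emitAt X ψ) σ.word)
    (fun φ φ' ψ => sweepIn_add_left _ _ _ (absorbAt X φ) (absorbAt X φ') _ _)
    (fun c φ ψ => sweepIn_smul_left _ _ _ c (absorbAt X φ) _ _)
    (fun φ ψ ψ' => by
      have : emitAt X (ψ + ψ') = emitAt X ψ + emitAt X ψ' := map_add (emissionₗ k _ _ _) ψ ψ'
      rw [this, sweepIn_add_right])
    (fun c φ ψ => by
      have : emitAt X (c • ψ) = c • emitAt X ψ := map_smul (emissionₗ k _ _ _) c ψ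
      rw [this, sweepIn_smul_right])

theorem handle_apply (i : σ.Orbit) (y y' : σ.Orbit → Fin R.card) (X Z : C)
    (φ : Z ⊗ R.obj (y i) ⟶ R.obj (y' i)) (ψ : R.obj (y' i) ⟶ Z ⊗ R.obj (y i)) :
    handle k σ i y y' X Z φ ψ = sweepIn (slotDelta R y y' X) (.first i) (.second i)
      (absorbAt X φ) (emitAt X ψ) σ.word := rfl

variable {R} in
/-- The component of the `i`-th induced half-braiding between two summands. -/
def component (i : σ.Orbit) (y y' : σ.Orbit → Fin R.card) (X Z : C) :
    Z ⊗ summand σ y X ⟶ summand σ y' X ⊗ Z :=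
  ∑ l, handle k σ i y y' X Z ((R.bases k (Z ⊗ R.obj (y i)) (y' i)).φ l)
    ((R.bases k (Z ⊗ R.obj (y i)) (y' i)).φdual l)

theorem inducedHalfBraiding_eq (X : C) (i : σ.Orbit) (Z : C) :
    inducedHalfBraiding k σ R X i Z = ∑ y : σ.Orbit → Fin R.card, ∑ y' : σ.Orbit → Fin R.card,
      Z ◁ prj σ y X ≫ component k σ i y y' X Z ≫ inc σ y' X ▷ Z := by
  refine Finset.sum_congr rfl fun y _ => Finset.sum_congr rfl fun y' _ => ?_
  have h : Z ◁ wordPrj σ y X ≫ (∑ l, strandIn R i (y := y) (y' := y') X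
        ((R.bases k (Z ⊗ R.obj (y i)) (y' i)).φ l)
        ((R.bases k (Z ⊗ R.obj (y i)) (y' i)).φdual l) σ.word) ≫ wordInc σ y' X ▷ Z =
      Z ◁ prj σ y X ≫ component k σ i y y' X Z ≫ inc σ y' X ▷ Z := by
    simp only [strandIn_eq, component, handle_apply, Preadditive.sum_comp, Preadditive.comp_sum,
      prj, inc, MonoidalCategory.whiskerLeft_comp, comp_whiskerRight, Category.assoc]
  exact h

theorem inc_inducedHalfBraiding_prj (X : C) (i : σ.Orbit) (Z : C) (y y' : σ.Orbit → Fin R.card) :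
    Z ◁ inc σ y X ≫ inducedHalfBraiding k σ R X i Z ≫ prj σ y' X ▷ Z =
      component k σ i y y' X Z := by
  rw [inducedHalfBraiding_eq]
  simp only [Preadditive.sum_comp, Preadditive.comp_sum]
  rw [Finset.sum_eq_single y, Finset.sum_eq_single y']
  · simp only [Category.assoc, ← comp_whiskerRight, inc_prj_self,
      ← MonoidalCategory.whiskerLeft_comp_assoc]
    simp
  · intro a _ ha
    simp only [Category.assoc, ← comp_whiskerRight, inc_prj_ne σ R ha]
    simp
  · simp
  · intro a _ ha
    refine Finset.sum_eq_zero fun b _ => ?_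
    simp only [Category.assoc, ← MonoidalCategory.whiskerLeft_comp_assoc, inc_prj_ne σ R ha.symm]
    simp
  · simp

theorem induced_hom_ext {X V W : C} {f g : V ⊗ inducedObj σ R X ⟶ inducedObj σ R X ⊗ W}
    (h : ∀ y y' : σ.Orbit → Fin R.card, V ◁ inc σ y X ≫ f ≫ prj σ y' X ▷ W =
      V ◁ inc σ y X ≫ g ≫ prj σ y' X ▷ W) : f = g := by
  have e : ∀ f : V ⊗ inducedObj σ R X ⟶ inducedObj σ R X ⊗ W, f =
      ∑ y : σ.Orbit → Fin R.card, ∑ y' : σ.Orbit → Fin R.card,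
        V ◁ prj σ y X ≫ (V ◁ inc σ y X ≫ f ≫ prj σ y' X ▷ W) ≫ inc σ y' X ▷ W := fun f => by
    conv_lhs => rw [← Category.id_comp f, ← Category.comp_id f, ← MonoidalCategory.whiskerLeft_id,
      ← id_whiskerRight, ← sum_prj_inc σ R X]
    simp only [whiskerLeft_sum, sum_whiskerRight, Preadditive.sum_comp, Preadditive.comp_sum,
      MonoidalCategory.whiskerLeft_comp, comp_whiskerRight, Category.assoc]
    exact Finset.sum_comm
  rw [e f, e g]
  simp only [h]

theorem vstack_induced {X Z₁ Z₂ W₁ W₂ A D : C} (a : Z₂ ⊗ inducedObj σ R X ⟶ D ⊗ W₂)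
    (b : Z₁ ⊗ A ⟶ inducedObj σ R X ⊗ W₁) :
    vstack a b = ∑ y : σ.Orbit → Fin R.card, vstack (Z₂ ◁ inc σ y X ≫ a) (b ≫ prj σ y X ▷ W₁) := by
  have h : ∀ y, vstack (Z₂ ◁ inc σ y X ≫ a) (b ≫ prj σ y X ▷ W₁) =
      (α_ Z₂ Z₁ A).hom ≫ Z₂ ◁ b ≫ (α_ Z₂ _ W₁).inv ≫ (Z₂ ◁ (prj σ y X ≫ inc σ y X)) ▷ W₁ ≫
        a ▷ W₁ ≫ (α_ D W₂ W₁).hom := fun y => by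
    dsimp only [vstack]
    monoidal
  simp_rw [h]
  simp only [← Preadditive.comp_sum, ← Preadditive.sum_comp, ← whiskerLeft_sum, ← sum_whiskerRight,
    sum_prj_inc]
  simp [vstack]

/-- A strand through the handle `i` crosses the first slot of `j`, where the color change is the
zero morphism. -/
theorem component_eq_zero {i j : σ.Orbit} (hj : j ≠ i) {y y' : σ.Orbit → Fin R.card}
    (h : y j ≠ y' j) (X Z : C) : component k σ i y y' X Z = 0 := by
  refine Finset.sum_eq_zero fun l _ => ?_
  rw [handle_apply]
  exact sweepIn_eq_zero (σ.first_mem_word j) (by simpa using hj) (by simp)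
    (slotDelta_eq_zero R X h)

theorem component_naturality (i : σ.Orbit) (y y' : σ.Orbit → Fin R.card) (X : C) {Z W : C}
    (h : Z ⟶ W) : h ▷ summand σ y X ≫ component k σ i y y' X W =
      component k σ i y y' X Z ≫ summand σ y' X ◁ h := by
  -- With `Z` entering and `W` leaving, both sides are sums of values of the same bilinear map, as
  -- `sum_naturality` requires.
  let F : (Z ⊗ R.obj (y i) ⟶ R.obj (y' i)) →ₗ[k] (R.obj (y' i) ⟶ W ⊗ R.obj (y i)) →ₗ[k]
      (Z ⊗ summand σ y X ⟶ summand σ y' X ⊗ W) :=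
    LinearMap.mk₂ k (fun φ ψ => sweepIn (slotDelta R y y' X) (.first i) (.second i)
      (absorbAt X φ) (emitAt X ψ) σ.word)
    (fun φ φ' ψ => sweepIn_add_left _ _ _ (absorbAt X φ) (absorbAt X φ') _ _)
    (fun c φ ψ => sweepIn_smul_left _ _ _ c (absorbAt X φ) _ _)
    (fun φ ψ ψ' => by
      have : emitAt X (ψ + ψ') = emitAt X ψ + emitAt X ψ' := map_add (emissionₗ k _ _ _) ψ ψ'
      rw [this, sweepIn_add_right])
    (fun c φ ψ => by
      have : emitAt X (c • ψ) = c • emitAt X ψ := map_smul (emissionₗ k _ _ _) c ψ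
      rw [this, sweepIn_smul_right])
  have h1 := (R.bases k (Z ⊗ R.obj (y i)) (y' i)).sum_naturality
    (R.bases k (W ⊗ R.obj (y i)) (y' i)) (h ▷ R.obj (y i)) F
  rw [component, component, Preadditive.comp_sum, Preadditive.sum_comp]
  refine Eq.trans (Finset.sum_congr rfl fun l _ => ?_) (h1.trans (Finset.sum_congr rfl fun l _ => ?_))
  · rw [handle_apply, whiskerRight_sweepIn]
    rfl
  · rw [handle_apply, sweepIn_whiskerLeft]
    have : emitAt X ((R.bases k (Z ⊗ R.obj (y i)) (y' i)).φdual l) ≫ slotObj R y' X (.second i) ◁ h =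
      emitAt X ((R.bases k (Z ⊗ R.obj (y i)) (y' i)).φdual l ≫ h ▷ R.obj (y i)) :=
      (emission_comp_whiskerRight _ _).symm
    rw [this]
    rfl

end Handles

section Additive

variable {C : Type u} [Category.{v} C] [Preadditive C] [MonoidalCategory C] [MonoidalPreadditive C]

theorem vstack_zero_left {Z₁ Z₂ W₁ W₂ A B D : C} (b : Z₁ ⊗ A ⟶ B ⊗ W₁) :
    vstack (0 : Z₂ ⊗ B ⟶ D ⊗ W₂) b = 0 := by simp [vstack]

theorem vstack_zero_right {Z₁ Z₂ W₁ W₂ A B D : C} (a : Z₂ ⊗ B ⟶ D ⊗ W₂) :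
    vstack a (0 : Z₁ ⊗ A ⟶ B ⊗ W₁) = 0 := by simp [vstack]

theorem vstack_sum_left {ι : Type*} (s : Finset ι) {Z₁ Z₂ W₁ W₂ A B D : C}
    (a : ι → (Z₂ ⊗ B ⟶ D ⊗ W₂)) (b : Z₁ ⊗ A ⟶ B ⊗ W₁) :
    vstack (∑ l ∈ s, a l) b = ∑ l ∈ s, vstack (a l) b := by
  simp [vstack, sum_whiskerRight, Preadditive.sum_comp, Preadditive.comp_sum]

theorem vstack_sum_right {ι : Type*} (s : Finset ι) {Z₁ Z₂ W₁ W₂ A B D : C}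
    (a : Z₂ ⊗ B ⟶ D ⊗ W₂) (b : ι → (Z₁ ⊗ A ⟶ B ⊗ W₁)) :
    vstack a (∑ l ∈ s, b l) = ∑ l ∈ s, vstack a (b l) := by
  simp [vstack, whiskerLeft_sum, Preadditive.sum_comp, Preadditive.comp_sum]

end Additive

theorem sum_adjacent {K : Type*} [Fintype K] [DecidableEq K] {m : ℕ} {M : Type*} [AddCommMonoid M] (i : K)
    (y : K → Fin m) [∀ y' : K → Fin m, Decidable (∀ j, j ≠ i → y j = y' j)] (T : Fin m → M) :
    ∑ y' : K → Fin m, (if ∀ j, j ≠ i → y j = y' j then T (y' i) else 0) = ∑ c, T c := by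
  rw [← Finset.sum_filter]
  refine Finset.sum_bij' (fun y' _ => y' i) (fun c _ => Function.update y i c) (by simp)
    (fun c _ => ?_) (fun y' hy' => ?_) (by simp) (by simp)
  · simp only [Finset.mem_filter, Finset.mem_univ, true_and]
    intro j hj
    rw [Function.update_of_ne hj]
  · simp only [Finset.mem_filter, Finset.mem_univ, true_and] at hy'
    funext j
    by_cases hj : j = i
    · subst hj
      simp
    · rw [Function.update_of_ne hj, hy' j hj]

/-! ### Composites of components in one and in two handles -/

section Handles

variable (k : Type w) {C : Type u} [Field k] [IsAlgClosed k] [Category.{v} C] [Abelian C]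
  [Linear k C] [MonoidalCategory C] [MonoidalPreadditive C] [MonoidalLinear k C]
  [BraidedCategory C] [RigidCategory C] [RibbonCategory C] [FusionCategory k C]
  {n : ℕ} (σ : AdmissibleGluing n) (R : SimpleReps C)

theorem slotDelta_comp_of_adjacent {i : σ.Orbit} {y y' y'' : σ.Orbit → Fin R.card} (X : C)
    (h : (∀ j, j ≠ i → y j = y' j) ∨ ∀ j, j ≠ i → y' j = y'' j) (s : Slot σ.Orbit)
    (hs : s ∉ [Slot.first i, .second i]) :
    slotDelta R y y'' X s = slotDelta R y y' X s ≫ slotDelta R y' y'' X s := by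
  have hi : ∀ j, s = .first j ∨ s = .second j → j ≠ i := by
    rintro j (rfl | rfl) rfl <;> simp at hs
  refine (slotDelta_comp R X ?_).symm
  exact h.imp (fun h j hj => h j (hi j hj)) (fun h j hj => h j (hi j hj))

/-- Only intermediate colorings that differ from `y` at `i` contribute, so the sum runs over an
intermediate simple object. The two strands fuse, and the composite vertices form a complete family
for `Z₂ ⊗ Z₁`. -/
theorem component_comp (i : σ.Orbit) (y y'' : σ.Orbit → Fin R.card) (X Z₁ Z₂ : C) :
    component k σ i y y'' X (Z₂ ⊗ Z₁) = ∑ y' : σ.Orbit → Fin R.card,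
      vstack (component k σ i y' y'' X Z₂) (component k σ i y y' X Z₁) := by
  classical
  by_cases h : ∀ j, j ≠ i → y j = y'' j
  · obtain ⟨T, hT⟩ : ∃ T : Fin R.card →
        ((Z₂ ⊗ Z₁) ⊗ summand σ y X ⟶ summand σ y'' X ⊗ (Z₂ ⊗ Z₁)),
        ∀ c, T c = ∑ l, ∑ l', handle k σ i y y'' X (Z₂ ⊗ Z₁)
            ((α_ _ _ _).hom ≫ Z₂ ◁ (R.bases k (Z₁ ⊗ R.obj (y i)) c).φ l ≫
              (R.bases k (Z₂ ⊗ R.obj c) (y'' i)).φ l')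
            ((R.bases k (Z₂ ⊗ R.obj c) (y'' i)).φdual l' ≫
              Z₂ ◁ (R.bases k (Z₁ ⊗ R.obj (y i)) c).φdual l ≫ (α_ _ _ _).inv) :=
      ⟨_, fun _ => rfl⟩
    have e : ∀ y' : σ.Orbit → Fin R.card,
        vstack (component k σ i y' y'' X Z₂) (component k σ i y y' X Z₁) =
        if ∀ j, j ≠ i → y j = y' j then T (y' i) else 0 := by
      intro y'
      split_ifs with hy
      · rw [hT, component, component, vstack_sum_right]
        refine Finset.sum_congr rfl fun l _ => ?_
        rw [vstack_sum_left]
        refine Finset.sum_congr rfl fun l' _ => ?_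
        rw [handle_apply, handle_apply, handle_apply,
          vstack_sweepIn_sweepIn (slotDelta_comp_of_adjacent σ R X (Or.inl hy)) _ _ _ _ _
            (σ.pattern_pair i)]
        congr 1
        exact (emission_comp _ _).symm
      · push Not at hy
        obtain ⟨j, hj, hy⟩ := hy
        rw [component_eq_zero k σ R hj hy, vstack_zero_right]
    rw [Finset.sum_congr rfl fun y' _ => e y', sum_adjacent i y T]
    simp_rw [hT]
    rw [component]
    let ι := Σ c : Fin R.card, Fin (R.bases k (Z₁ ⊗ R.obj (y i)) c).card ×
      Fin (R.bases k (Z₂ ⊗ R.obj c) (y'' i)).card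
    have hc := (R.bases k ((Z₂ ⊗ Z₁) ⊗ R.obj (y i)) (y'' i)).sum_eq_of_complete
      (ι := ι) (fun p => (α_ _ _ _).hom ≫ Z₂ ◁ (R.bases k (Z₁ ⊗ R.obj (y i)) p.1).φ p.2.1 ≫
              (R.bases k (Z₂ ⊗ R.obj p.1) (y'' i)).φ p.2.2)
      (fun p => (R.bases k (Z₂ ⊗ R.obj p.1) (y'' i)).φdual p.2.2 ≫
              Z₂ ◁ (R.bases k (Z₁ ⊗ R.obj (y i)) p.1).φdual p.2.1 ≫ (α_ _ _ _).inv)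
      (fun x => by
        rw [Fintype.sum_sigma]
        simp_rw [Fintype.sum_prod_type]
        have h1 : ∀ c l, ∑ l', x ≫ ((α_ _ _ _).hom ≫ Z₂ ◁ (R.bases k (Z₁ ⊗ R.obj (y i)) c).φ l ≫
              (R.bases k (Z₂ ⊗ R.obj c) (y'' i)).φ l') ≫
              ((R.bases k (Z₂ ⊗ R.obj c) (y'' i)).φdual l' ≫
              Z₂ ◁ (R.bases k (Z₁ ⊗ R.obj (y i)) c).φdual l ≫ (α_ _ _ _).inv) =
            x ≫ (α_ _ _ _).hom ≫ Z₂ ◁ ((R.bases k (Z₁ ⊗ R.obj (y i)) c).φ l ≫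
              (R.bases k (Z₁ ⊗ R.obj (y i)) c).φdual l) ≫ (α_ _ _ _).inv := fun c l => by
          have h2 := (R.bases k (Z₂ ⊗ R.obj c) (y'' i)).sum_comp_φ_φdual
            (x ≫ (α_ _ _ _).hom ≫ Z₂ ◁ (R.bases k (Z₁ ⊗ R.obj (y i)) c).φ l)
          have h3 := congrArg (fun f => f ≫ Z₂ ◁ (R.bases k (Z₁ ⊗ R.obj (y i)) c).φdual l ≫
            (α_ _ _ _).inv) h2
          simp only [Preadditive.sum_comp, Category.assoc] at h3
          simp only [MonoidalCategory.whiskerLeft_comp, Category.assoc]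
          exact h3
        simp_rw [h1, ← Preadditive.comp_sum, ← Preadditive.sum_comp, ← whiskerLeft_sum]
        rw [R.sum_dualBases k]
        simp)
      (handle k σ i y y'' X (Z₂ ⊗ Z₁))
    rw [← hc, Fintype.sum_sigma]
    simp_rw [Fintype.sum_prod_type]
  · push Not at h
    obtain ⟨j, hj, h⟩ := h
    rw [component_eq_zero k σ R hj h]
    refine (Finset.sum_eq_zero fun y' _ => ?_).symm
    by_cases hy : y j = y' j
    · rw [component_eq_zero k σ R hj (hy ▸ h), vstack_zero_left]
    · rw [component_eq_zero k σ R hj hy, vstack_zero_right]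

theorem component_unit_self (i : σ.Orbit) (y : σ.Orbit → Fin R.card) (X : C) :
    component k σ i y y X (𝟙_ C) = (λ_ _).hom ≫ (ρ_ _).inv := by
  have h := (R.bases k (𝟙_ C ⊗ R.obj (y i)) (y i)).sum_eq_of_complete (ι := Unit)
    (fun _ => (λ_ _).hom) (fun _ => (λ_ _).inv) (fun x => by simp) (handle k σ i y y X (𝟙_ C))
  have h1 : sweepIn (slotDelta R y y X) (.first i) (.second i) (absorbAt X (λ_ _).hom)
      (emitAt X (λ_ _).inv) σ.word = cross (𝟙_ C) (𝟙 (summand σ y X)) := by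
    have e1 : emitAt (R := R) (y := y) (y' := y) (i := i) X (λ_ _).inv = (ρ_ _).inv := emission_unit _
    have e2 : slotDelta R y y X = fun s => 𝟙 (slotObj R y X s) :=
      funext fun s => slotDelta_self R X y s
    rw [e1, e2, ← sweepIn_id (O := slotObj R y X) _ _ _ (σ.pattern_pair i)]
    rfl
  rw [component, ← h, Fintype.sum_unique, handle_apply, h1, cross_unit, Category.id_comp]

theorem component_unit_ne (i : σ.Orbit) {y y' : σ.Orbit → Fin R.card} (h : y ≠ y') (X : C) :
    component k σ i y y' X (𝟙_ C) = 0 := by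
  by_cases hi : y i = y' i
  · obtain ⟨j, hj⟩ := Function.ne_iff.mp h
    exact component_eq_zero k σ R (fun e => hj (by rw [e]; exact hi)) hj X _
  -- There are no nonzero morphisms between distinct simple objects, so the empty family is
  -- complete.
  · have h := (R.bases k (𝟙_ C ⊗ R.obj (y i)) (y' i)).sum_eq_of_complete (ι := Empty)
      Empty.elim Empty.elim (fun x => by
        rw [← cancel_mono (λ_ _).hom, R.hom_eq_zero (Ne.symm hi) (x ≫ (λ_ _).hom)]
        simp) (handle k σ i y y' X (𝟙_ C))
    rw [component, ← h, Fintype.sum_empty]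

/-- Colors that agree only propositionally have formally different bases. Expressing the component
in bases for fixed colors makes the two orders of two strands comparable term by term. -/
theorem component_transport (i : σ.Orbit) {y y' : σ.Orbit → Fin R.card} {c d : Fin R.card}
    (hc : y i = c) (hd : y' i = d) (X Z : C) :
    component k σ i y y' X Z = ∑ l, handle k σ i y y' X Z
      (Z ◁ delta R (y i) c ≫ (R.bases k (Z ⊗ R.obj c) d).φ l ≫ delta R d (y' i))
      (delta R (y' i) d ≫ (R.bases k (Z ⊗ R.obj c) d).φdual l ≫ Z ◁ delta R c (y i)) := by
  subst hc hd
  simp only [delta_self, MonoidalCategory.whiskerLeft_id, Category.id_comp, Category.comp_id]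
  rfl

/-- Two strands that run through different handles. -/
def twoStrands {i j : σ.Orbit} (hij : i ≠ j) {y y' a b : σ.Orbit → Fin R.card}
    (ha : ∀ l, l ≠ i → y l = a l) (hai : a i = y' i) (hb : ∀ l, l ≠ j → y l = b l)
    (hbj : b j = y' j) (X : C) {Z₁ Z₂ : C}
    (φ : Z₁ ⊗ R.obj (y i) ⟶ R.obj (y' i)) (φd : R.obj (y' i) ⟶ Z₁ ⊗ R.obj (y i))
    (φ' : Z₂ ⊗ R.obj (y j) ⟶ R.obj (y' j)) (φd' : R.obj (y' j) ⟶ Z₂ ⊗ R.obj (y j)) :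
    TwoSweeps (slotObj R y X) (slotObj R a X) (slotObj R b X) (slotObj R y' X) (.first i)
      (.second i) (.first j) (.second j) Z₁ Z₁ Z₂ Z₂ where
  m₁ := slotDelta R y a X
  m₂ := slotDelta R a y' X
  n₁ := slotDelta R y b X
  n₂ := slotDelta R b y' X
  comm s hs := by
    have h1 : s ∉ [Slot.first i, .second i] := by grind
    have h2 : s ∉ [Slot.first j, .second j] := by grind
    rw [← slotDelta_comp_of_adjacent σ R X (Or.inl ha) s h1,
      ← slotDelta_comp_of_adjacent σ R X (Or.inl hb) s h2]
  φ := absorbAt X (Z₁ ◁ delta R (y i) (y i) ≫ φ ≫ delta R (y' i) (a i))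
  φn := absorbAt X (Z₁ ◁ delta R (b i) (y i) ≫ φ ≫ delta R (y' i) (y' i))
  hφ := by
    have h : (Z₁ ◁ delta R (y i) (y i) ≫ φ ≫ delta R (y' i) (a i)) ≫ delta R (a i) (y' i) =
        Z₁ ◁ delta R (y i) (b i) ≫ Z₁ ◁ delta R (b i) (y i) ≫ φ ≫ delta R (y' i) (y' i) := by
      rw [← MonoidalCategory.whiskerLeft_comp_assoc, delta_comp R (hb i hij), Category.assoc,
        Category.assoc, delta_comp R hai.symm]
    exact h
  χ := emitAt X (delta R (a i) (y' i) ≫ φd ≫ Z₁ ◁ delta R (y i) (y i))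
  χn := emitAt X (delta R (y' i) (y' i) ≫ φd ≫ Z₁ ◁ delta R (y i) (b i))
  hχ := by
    have h : emission (delta R (a i) (y' i) ≫ φd ≫ Z₁ ◁ delta R (y i) (y i)) ≫
          rightAdjointMate (delta R (y' i) (a i)) ▷ Z₁ = rightAdjointMate (delta R (b i) (y i)) ≫
        emission (delta R (y' i) (y' i) ≫ φd ≫ Z₁ ◁ delta R (y i) (b i)) := by
      rw [← emission_comp_left, ← emission_comp_whiskerLeft, ← Category.assoc,
        delta_comp R hai.symm, Category.assoc, Category.assoc,
        ← MonoidalCategory.whiskerLeft_comp, delta_comp R (hb i hij)]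
    exact h
  φ' := absorbAt X (Z₂ ◁ delta R (a j) (y j) ≫ φ' ≫ delta R (y' j) (y' j))
  φn' := absorbAt X (Z₂ ◁ delta R (y j) (y j) ≫ φ' ≫ delta R (y' j) (b j))
  hφ' := by
    have h : Z₂ ◁ delta R (y j) (a j) ≫ Z₂ ◁ delta R (a j) (y j) ≫ φ' ≫ delta R (y' j) (y' j) =
        (Z₂ ◁ delta R (y j) (y j) ≫ φ' ≫ delta R (y' j) (b j)) ≫ delta R (b j) (y' j) := by
      rw [← MonoidalCategory.whiskerLeft_comp_assoc, delta_comp R (ha j hij.symm), Category.assoc,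
        Category.assoc, delta_comp R hbj.symm]
    exact h
  χ' := emitAt X (delta R (y' j) (y' j) ≫ φd' ≫ Z₂ ◁ delta R (y j) (a j))
  χn' := emitAt X (delta R (b j) (y' j) ≫ φd' ≫ Z₂ ◁ delta R (y j) (y j))
  hχ' := by
    have h : rightAdjointMate (delta R (a j) (y j)) ≫
          emission (delta R (y' j) (y' j) ≫ φd' ≫ Z₂ ◁ delta R (y j) (a j)) =
        emission (delta R (b j) (y' j) ≫ φd' ≫ Z₂ ◁ delta R (y j) (y j)) ≫
          rightAdjointMate (delta R (y' j) (b j)) ▷ Z₂ := by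
      rw [← emission_comp_left, ← emission_comp_whiskerLeft, ← Category.assoc (delta R (y' j) (b j)),
        delta_comp R hbj.symm, Category.assoc, Category.assoc,
        ← MonoidalCategory.whiskerLeft_comp, delta_comp R (ha j hij.symm)]
    exact h
  ne₁ := by simpa using hij
  ne₃ := by simp
  ne₄ := by simpa using hij

variable {σ R}

/-- The first strand recolors only `i` and the second only `j`, so a single intermediate coloring
contributes. -/
theorem sum_intermediate {i j : σ.Orbit} (hij : i ≠ j) {y y' : σ.Orbit → Fin R.card}
    {X Z₁ Z₂ : C} {M : Type*} [AddCommGroup M]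
    (F : ∀ a : σ.Orbit → Fin R.card, (Z₁ ⊗ summand σ y X ⟶ summand σ a X ⊗ Z₁) →
      (Z₂ ⊗ summand σ a X ⟶ summand σ y' X ⊗ Z₂) → M) (hF : ∀ a g, F a 0 g = 0)
    (hF' : ∀ a f, F a f 0 = 0) :
    ∑ a, F a (component k σ i y a X Z₁) (component k σ j a y' X Z₂) =
      F (Function.update y i (y' i)) (component k σ i y (Function.update y i (y' i)) X Z₁)
        (component k σ j (Function.update y i (y' i)) y' X Z₂) := by
  refine Finset.sum_eq_single _ (fun a _ ha => ?_) (by simp)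
  obtain ⟨l, hl⟩ := Function.ne_iff.mp ha
  by_cases hli : l = i
  · subst hli
    rw [Function.update_self] at hl
    rw [component_eq_zero k σ R hij hl, hF']
  · rw [Function.update_of_ne hli] at hl
    rw [component_eq_zero k σ R hli (Ne.symm hl), hF]

/-- Relations between two strands in different handles hold for the components of the induced
half-braidings if they hold for all pairs of strands. -/
theorem component_relation {i j : σ.Orbit} (hij : i ≠ j) (y y' : σ.Orbit → Fin R.card)
    {X Z₁ Z₂ : C} {M : Type*} [AddCommGroup M]
    (F : ∀ a : σ.Orbit → Fin R.card, (Z₁ ⊗ summand σ y X ⟶ summand σ a X ⊗ Z₁) →+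
      (Z₂ ⊗ summand σ a X ⟶ summand σ y' X ⊗ Z₂) →+ M)
    (G : ∀ b : σ.Orbit → Fin R.card, (Z₂ ⊗ summand σ y X ⟶ summand σ b X ⊗ Z₂) →+
      (Z₁ ⊗ summand σ b X ⟶ summand σ y' X ⊗ Z₁) →+ M)
    (h : ∀ (a b : σ.Orbit → Fin R.card) (T : TwoSweeps (slotObj R y X) (slotObj R a X)
      (slotObj R b X) (slotObj R y' X) (.first i) (.second i) (.first j) (.second j) Z₁ Z₁ Z₂ Z₂),
      F a (sweepIn T.m₁ (.first i) (.second i) T.φ T.χ σ.word)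
        (sweepIn T.m₂ (.first j) (.second j) T.φ' T.χ' σ.word) =
      G b (sweepIn T.n₁ (.first j) (.second j) T.φn' T.χn' σ.word)
        (sweepIn T.n₂ (.first i) (.second i) T.φn T.χn σ.word)) :
    ∑ a, F a (component k σ i y a X Z₁) (component k σ j a y' X Z₂) =
      ∑ b, G b (component k σ j y b X Z₂) (component k σ i b y' X Z₁) := by
  rw [sum_intermediate k hij (fun a f g => F a f g) (by simp) (by simp),
    sum_intermediate k hij.symm (fun b f g => G b f g) (by simp) (by simp)]
  set a := Function.update y i (y' i) with ha_def
  set b := Function.update y j (y' j) with hb_def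
  have ha : ∀ l, l ≠ i → y l = a l := fun l hl => by rw [ha_def, Function.update_of_ne hl]
  have hb : ∀ l, l ≠ j → y l = b l := fun l hl => by rw [hb_def, Function.update_of_ne hl]
  have hai : a i = y' i := Function.update_self _ _ _
  have hbj : b j = y' j := Function.update_self _ _ _
  by_cases hy : ∀ l, l ≠ i → l ≠ j → y l = y' l
  · rw [component_transport k σ R i rfl hai, component_transport k σ R j (ha j hij.symm).symm rfl,
      component_transport k σ R j rfl hbj, component_transport k σ R i (hb i hij).symm rfl]
    simp only [map_sum, AddMonoidHom.finsetSum_apply]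
    rw [Finset.sum_comm]
    refine Finset.sum_congr rfl fun l' _ => Finset.sum_congr rfl fun l _ => ?_
    exact h a b (twoStrands σ R hij ha hai hb hbj X _ _ _ _)
  · push Not at hy
    obtain ⟨l, hli, hlj, hl⟩ := hy
    rw [component_eq_zero k σ R hlj (y := a) ((ha l hli) ▸ hl),
      component_eq_zero k σ R hli (y := b) ((hb l hlj) ▸ hl)]
    simp

end Handles

/-! ### Invertibility of half-braidings from rigidity -/

section HalfBraiding

variable {C : Type u} [Category.{v} C] [MonoidalCategory C]

/-- The candidate for the inverse of a half-braiding at an object `A` with a dual `B`. -/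
def halfBraidingInv {X : C} (γ : ∀ Z : C, Z ⊗ X ⟶ X ⊗ Z) (A B : C) [ExactPairing A B] :
    X ⊗ A ⟶ A ⊗ X :=
  (λ_ (X ⊗ A)).inv ≫ η_ A B ▷ (X ⊗ A) ≫ (α_ A B (X ⊗ A)).hom ≫ A ◁ (α_ B X A).inv ≫
    A ◁ γ B ▷ A ≫ A ◁ (α_ X B A).hom ≫ A ◁ X ◁ ε_ A B ≫ A ◁ (ρ_ X).hom

variable {X : C} {γ : ∀ Z : C, Z ⊗ X ⟶ X ⊗ Z}

/-- By the hexagon the two half-braidings combine to that of `B ⊗ A`; naturality at the evaluation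
reduces it to the one of `𝟙`, and a zigzag remains. -/
theorem hom_halfBraidingInv (nat : ∀ {Z W : C} (f : Z ⟶ W), f ▷ X ≫ γ W = γ Z ≫ X ◁ f)
    (hex : ∀ Z W : C, γ (Z ⊗ W) = stack (γ Z) (γ W))
    (unit : γ (𝟙_ C) = (λ_ X).hom ≫ (ρ_ X).inv) (A B : C) [ExactPairing A B] :
    γ A ≫ halfBraidingInv γ A B = 𝟙 _ := by
  have h := nat (ε_ A B)
  rw [hex, unit] at h
  calc
    _ = 𝟙 _ ⊗≫ (𝟙_ C ◁ γ A ≫ η_ A B ▷ (X ⊗ A)) ⊗≫ A ◁ γ B ▷ A ⊗≫ A ◁ X ◁ ε_ A B ⊗≫ 𝟙 _ := by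
      dsimp only [halfBraidingInv]
      monoidal
    _ = 𝟙 _ ⊗≫ η_ A B ▷ (A ⊗ X) ⊗≫ A ◁ (stack (γ B) (γ A) ≫ X ◁ ε_ A B) ⊗≫ 𝟙 _ := by
      rw [whisker_exchange]
      dsimp only [stack]
      monoidal
    _ = 𝟙 _ ⊗≫ (η_ A B ▷ A ⊗≫ A ◁ ε_ A B) ▷ X ⊗≫ 𝟙 _ := by
      rw [← h]
      monoidal
    _ = _ := by
      rw [ExactPairing.evaluation_coevaluation'']
      monoidal

theorem halfBraidingInv_hom (nat : ∀ {Z W : C} (f : Z ⟶ W), f ▷ X ≫ γ W = γ Z ≫ X ◁ f)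
    (hex : ∀ Z W : C, γ (Z ⊗ W) = stack (γ Z) (γ W))
    (unit : γ (𝟙_ C) = (λ_ X).hom ≫ (ρ_ X).inv) (A B : C) [ExactPairing A B] :
    halfBraidingInv γ A B ≫ γ A = 𝟙 _ := by
  have h := nat (η_ A B)
  rw [hex, unit] at h
  calc
    _ = 𝟙 _ ⊗≫ η_ A B ▷ (X ⊗ A) ⊗≫ A ◁ γ B ▷ A ⊗≫ ((A ⊗ X) ◁ ε_ A B ≫ γ A ▷ 𝟙_ C) ⊗≫ 𝟙 _ := by
      dsimp only [halfBraidingInv]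
      monoidal
    _ = 𝟙 _ ⊗≫ (η_ A B ▷ X ≫ stack (γ A) (γ B)) ▷ A ⊗≫ X ◁ A ◁ ε_ A B ⊗≫ 𝟙 _ := by
      rw [whisker_exchange]
      dsimp only [stack]
      monoidal
    _ = 𝟙 _ ⊗≫ X ◁ (η_ A B ▷ A ⊗≫ A ◁ ε_ A B) ⊗≫ 𝟙 _ := by
      rw [h]
      monoidal
    _ = _ := by
      rw [ExactPairing.evaluation_coevaluation'']
      monoidal

theorem isHalfBraiding_of_unit [RigidCategory C]
    (nat : ∀ {Z W : C} (f : Z ⟶ W), f ▷ X ≫ γ W = γ Z ≫ X ◁ f)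
    (hex : ∀ Z W : C, γ (Z ⊗ W) = stack (γ Z) (γ W))
    (unit : γ (𝟙_ C) = (λ_ X).hom ≫ (ρ_ X).inv) : IsHalfBraiding X γ where
  isIso Z := ⟨halfBraidingInv γ Z Zᘁ, hom_halfBraidingInv nat hex unit _ _,
    halfBraidingInv_hom nat hex unit _ _⟩
  naturality := nat
  hexagon := hex

theorem IsHalfBraiding.unit (h : IsHalfBraiding X γ) :
    γ (𝟙_ C) = (λ_ X).hom ≫ (ρ_ X).inv := by
  have := h.isIso
  have h1 := h.naturality (λ_ (𝟙_ C)).hom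
  rw [h.hexagon] at h1
  have h2 : stack (γ (𝟙_ C)) (γ (𝟙_ C)) ≫ X ◁ (λ_ (𝟙_ C)).hom =
      (λ_ (𝟙_ C)).hom ▷ X ≫ γ (𝟙_ C) ≫ (ρ_ X).hom ≫ (λ_ X).inv ≫ γ (𝟙_ C) := by
    dsimp only [stack]
    monoidal
  rw [h2, cancel_epi, ← cancel_epi (inv (γ (𝟙_ C)))] at h1
  simp only [IsIso.inv_hom_id, IsIso.inv_hom_id_assoc] at h1
  rw [← cancel_epi ((ρ_ X).hom ≫ (λ_ X).inv)]
  simpa using h1.symm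

end HalfBraiding

section Decomposition

theorem hom_ext_of_decomposition {C : Type u} [Category.{v} C] [Preadditive C] {ι κ : Type*}
    [Fintype ι] [Fintype κ] {A B : C} {S : ι → C} {T : κ → C} {p : ∀ a, A ⟶ S a} {q : ∀ a, S a ⟶ A}
    (h : ∑ a, p a ≫ q a = 𝟙 A) {p' : ∀ a, B ⟶ T a} {q' : ∀ a, T a ⟶ B}
    (h' : ∑ a, p' a ≫ q' a = 𝟙 B) {f g : A ⟶ B} (e : ∀ a b, q a ≫ f ≫ p' b = q a ≫ g ≫ p' b) :
    f = g := by
  have : ∀ f : A ⟶ B, f = ∑ a, ∑ b, p a ≫ (q a ≫ f ≫ p' b) ≫ q' b := fun f => by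
    conv_lhs => rw [← Category.id_comp f, ← Category.comp_id f, ← h, ← h']
    simp only [Preadditive.sum_comp, Preadditive.comp_sum, Category.assoc]
    exact Finset.sum_comm
  rw [this f, this g]
  simp only [e]

end Decomposition

/-- A biadditive map as a homomorphism into a group of homomorphisms. -/
def biadditive {A B M : Type*} [AddCommGroup A] [AddCommGroup B] [AddCommGroup M] (f : A → B → M)
    (h₁ : ∀ a a' b, f (a + a') b = f a b + f a' b) (h₂ : ∀ a b b', f a (b + b') = f a b + f a b') :
    A →+ B →+ M :=
  AddMonoidHom.mk' (fun a => AddMonoidHom.mk' (f a) (h₂ a)) fun a a' => by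
    ext b
    exact h₁ a a' b

theorem vstack_add_left {C : Type u} [Category.{v} C] [Preadditive C] [MonoidalCategory C]
    [MonoidalPreadditive C] {Z₁ Z₂ W₁ W₂ A B D : C} (a a' : Z₂ ⊗ B ⟶ D ⊗ W₂)
    (b : Z₁ ⊗ A ⟶ B ⊗ W₁) : vstack (a + a') b = vstack a b + vstack a' b := by
  simp [vstack]

theorem vstack_add_right {C : Type u} [Category.{v} C] [Preadditive C] [MonoidalCategory C]
    [MonoidalPreadditive C] {Z₁ Z₂ W₁ W₂ A B D : C} (a : Z₂ ⊗ B ⟶ D ⊗ W₂)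
    (b b' : Z₁ ⊗ A ⟶ B ⊗ W₁) : vstack a (b + b') = vstack a b + vstack a b' := by
  simp [vstack]

/-! ### The induced object is an object of the center -/

section Induced

variable (k : Type w) {C : Type u} [Field k] [IsAlgClosed k] [Category.{v} C] [Abelian C]
  [Linear k C] [MonoidalCategory C] [MonoidalPreadditive C] [MonoidalLinear k C]
  [BraidedCategory C] [RigidCategory C] [RibbonCategory C] [FusionCategory k C]
  {n : ℕ} (σ : AdmissibleGluing n) (R : SimpleReps C)

theorem inc_stack_prj (X : C) (i j : σ.Orbit) (Z₁ Z₂ : C) (y y' : σ.Orbit → Fin R.card) :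
    (Z₂ ⊗ Z₁) ◁ inc σ y X ≫ stack (inducedHalfBraiding k σ R X j Z₂)
        (inducedHalfBraiding k σ R X i Z₁) ≫ prj σ y' X ▷ (Z₂ ⊗ Z₁) =
      ∑ a : σ.Orbit → Fin R.card,
        vstack (component k σ j a y' X Z₂) (component k σ i y a X Z₁) := by
  rw [stack_eq_vstack, ← Category.assoc, whiskerLeft_vstack, vstack_whiskerRight, vstack_induced]
  simp only [Category.assoc, inc_inducedHalfBraiding_prj]

theorem inducedHalfBraiding_naturality (X : C) (i : σ.Orbit) {Z W : C} (f : Z ⟶ W) :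
    f ▷ inducedObj σ R X ≫ inducedHalfBraiding k σ R X i W =
      inducedHalfBraiding k σ R X i Z ≫ inducedObj σ R X ◁ f := by
  refine induced_hom_ext σ R fun y y' => ?_
  have h := component_naturality k σ R i y y' X f
  rw [← inc_inducedHalfBraiding_prj, ← inc_inducedHalfBraiding_prj] at h
  rw [Category.assoc, whisker_exchange_assoc, h, Category.assoc, Category.assoc, Category.assoc,
    whisker_exchange]

theorem inducedHalfBraiding_hexagon (X : C) (i : σ.Orbit) (Z W : C) :
    inducedHalfBraiding k σ R X i (Z ⊗ W) =
      stack (inducedHalfBraiding k σ R X i Z) (inducedHalfBraiding k σ R X i W) := by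
  refine induced_hom_ext σ R fun y y' => ?_
  rw [inc_stack_prj, inc_inducedHalfBraiding_prj, component_comp]

theorem inducedHalfBraiding_unit (X : C) (i : σ.Orbit) :
    inducedHalfBraiding k σ R X i (𝟙_ C) = (λ_ _).hom ≫ (ρ_ _).inv := by
  refine induced_hom_ext σ R fun y y' => ?_
  rw [inc_inducedHalfBraiding_prj]
  have h : 𝟙_ C ◁ inc σ y X ≫ ((λ_ _).hom ≫ (ρ_ _).inv) ≫ prj σ y' X ▷ 𝟙_ C =
    (λ_ _).hom ≫ (inc σ y X ≫ prj σ y' X) ≫ (ρ_ _).inv := by simp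
  rw [h]
  by_cases hy : y = y'
  · subst hy
    rw [component_unit_self, inc_prj_self, Category.id_comp]
  · rw [component_unit_ne k σ R i hy, inc_prj_ne σ R hy, zero_comp, comp_zero]

theorem inducedHalfBraiding_relation (X : C) {i j : σ.Orbit} (hij : i ≠ j)
    (r : ∀ Z₁ Z₂ : C, Z₂ ⊗ Z₁ ⟶ Z₁ ⊗ Z₂)
    (h : ∀ {O A B O' : Slot σ.Orbit → C} {Z₁ Z₂ : C} (T : TwoSweeps O A B O' (.first i) (.second i)
      (.first j) (.second j) Z₁ Z₁ Z₂ Z₂), T.RelBB (r Z₁ Z₂) σ.word) (Z₁ Z₂ : C) :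
    stack (inducedHalfBraiding k σ R X j Z₂) (inducedHalfBraiding k σ R X i Z₁) ≫ _ ◁ r Z₁ Z₂ =
      (β_ Z₁ Z₂).inv ▷ _ ≫ stack (inducedHalfBraiding k σ R X i Z₁)
        (inducedHalfBraiding k σ R X j Z₂) := by
  refine induced_hom_ext σ R fun y y' => ?_
  have h1 : ∑ a, vstack (component k σ j a y' X Z₂) (component k σ i y a X Z₁) ≫ _ ◁ r Z₁ Z₂ =
      ∑ b, (β_ Z₁ Z₂).inv ▷ _ ≫ vstack (component k σ i b y' X Z₁) (component k σ j y b X Z₂) :=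
    component_relation k hij y y'
      (fun a => biadditive (fun f g => vstack g f ≫ _ ◁ r Z₁ Z₂)
        (fun f f' g => by rw [vstack_add_right, Preadditive.add_comp])
        (fun f g g' => by rw [vstack_add_left, Preadditive.add_comp]))
      (fun b => biadditive (fun f g => (β_ Z₁ Z₂).inv ▷ _ ≫ vstack g f)
        (fun f f' g => by rw [vstack_add_right, Preadditive.comp_add])
        (fun f g g' => by rw [vstack_add_left, Preadditive.comp_add]))
      (fun a b T => h T)
  rw [← Preadditive.sum_comp, ← Preadditive.comp_sum, ← inc_stack_prj, ← inc_stack_prj] at h1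
  simp only [Category.assoc] at h1 ⊢
  rw [whisker_exchange, h1, ← whisker_exchange_assoc]

theorem sum_whiskerLeft_prj_inc (X Z : C) :
    ∑ y : σ.Orbit → Fin R.card, Z ◁ prj σ y X ≫ Z ◁ inc σ y X = 𝟙 (Z ⊗ inducedObj σ R X) := by
  simp only [← MonoidalCategory.whiskerLeft_comp, ← whiskerLeft_sum, sum_prj_inc,
    MonoidalCategory.whiskerLeft_id]

/-- Naturality of the braiding lets inclusions and projections pass the turned strand, so the claim
reduces to the components and there to `TwoSweeps.turn_in`. -/
theorem inducedHalfBraiding_turn (X : C) {i j : σ.Orbit} (hij : σ.hi i < σ.lo j) (Z₁ Z₂ : C) :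
    Z₂ ◁ (inducedHalfBraiding k σ R X i Z₁ ≫ (β_ _ Z₁).hom) ≫
        hcomp (cross Z₂ (𝟙 Z₁)) (inducedHalfBraiding k σ R X j Z₂) =
      hcomp (cross Z₂ (𝟙 Z₁)) (inducedHalfBraiding k σ R X j Z₂) ≫
        (inducedHalfBraiding k σ R X i Z₁ ≫ (β_ _ Z₁).hom) ▷ Z₂ := by
  have hne : i ≠ j := by
    rintro rfl
    exact lt_asymm hij (σ.lo_lt_hi i)
  have e1 : ∑ y : σ.Orbit → Fin R.card, Z₂ ◁ Z₁ ◁ prj σ y X ≫ Z₂ ◁ Z₁ ◁ inc σ y X =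
      𝟙 (Z₂ ⊗ (Z₁ ⊗ inducedObj σ R X)) := by
    simp only [← MonoidalCategory.whiskerLeft_comp, ← whiskerLeft_sum, sum_prj_inc,
      MonoidalCategory.whiskerLeft_id]
  have e2 : ∑ y : σ.Orbit → Fin R.card, (Z₁ ◁ prj σ y X) ▷ Z₂ ≫ (Z₁ ◁ inc σ y X) ▷ Z₂ =
      𝟙 ((Z₁ ⊗ inducedObj σ R X) ⊗ Z₂) := by
    simp only [← MonoidalCategory.whiskerLeft_comp, ← comp_whiskerRight, ← whiskerLeft_sum,
      ← sum_whiskerRight, sum_prj_inc, MonoidalCategory.whiskerLeft_id, id_whiskerRight]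
  refine hom_ext_of_decomposition e1 e2 fun y y' => ?_
  have h1 : ∑ a, Z₂ ◁ (component k σ i y a X Z₁ ≫ (β_ _ Z₁).hom) ≫
        hcomp (cross Z₂ (𝟙 Z₁)) (component k σ j a y' X Z₂) =
      ∑ b, hcomp (cross Z₂ (𝟙 Z₁)) (component k σ j y b X Z₂) ≫
        (component k σ i b y' X Z₁ ≫ (β_ _ Z₁).hom) ▷ Z₂ :=
    component_relation k hne y y'
      (fun a => biadditive (fun f g => Z₂ ◁ (f ≫ (β_ _ Z₁).hom) ≫ hcomp (cross Z₂ (𝟙 Z₁)) g)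
        (fun f f' g => by simp) (fun f g g' => by rw [hcomp_add_right, Preadditive.comp_add]))
      (fun b => biadditive (fun f g => hcomp (cross Z₂ (𝟙 Z₁)) f ≫ (g ≫ (β_ _ Z₁).hom) ▷ Z₂)
        (fun f f' g => by rw [hcomp_add_right, Preadditive.add_comp]) (fun f g g' => by simp))
      (fun a b T => T.turn_in σ.word (σ.pattern_separate hij))
  have h2 : ∀ a, Z₂ ◁ (component k σ i y a X Z₁ ≫ (β_ _ Z₁).hom) ≫
      hcomp (cross Z₂ (𝟙 Z₁)) (component k σ j a y' X Z₂) =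
      Z₂ ◁ (Z₁ ◁ inc σ y X ≫ inducedHalfBraiding k σ R X i Z₁ ≫ (β_ _ Z₁).hom) ≫
        (Z₂ ◁ Z₁ ◁ prj σ a X ≫ Z₂ ◁ Z₁ ◁ inc σ a X) ≫
        hcomp (cross Z₂ (𝟙 Z₁)) (inducedHalfBraiding k σ R X j Z₂) ≫
          (Z₁ ◁ prj σ y' X) ▷ Z₂ := fun a => by
    rw [← inc_inducedHalfBraiding_prj, ← inc_inducedHalfBraiding_prj,
      ← whiskerLeft_hcomp_whiskerRight]
    simp only [Category.assoc, BraidedCategory.braiding_naturality_left,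
      MonoidalCategory.whiskerLeft_comp]
  have h3 : ∀ a, hcomp (cross Z₂ (𝟙 Z₁)) (component k σ j y a X Z₂) ≫
      (component k σ i a y' X Z₁ ≫ (β_ _ Z₁).hom) ▷ Z₂ =
      (Z₂ ◁ Z₁ ◁ inc σ y X ≫ hcomp (cross Z₂ (𝟙 Z₁)) (inducedHalfBraiding k σ R X j Z₂)) ≫
        ((Z₁ ◁ prj σ a X) ▷ Z₂ ≫ (Z₁ ◁ inc σ a X) ▷ Z₂) ≫
        (inducedHalfBraiding k σ R X i Z₁ ≫ (β_ _ Z₁).hom ≫ Z₁ ◁ prj σ y' X) ▷ Z₂ := fun a => by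
    rw [← inc_inducedHalfBraiding_prj, ← inc_inducedHalfBraiding_prj,
      ← whiskerLeft_hcomp_whiskerRight]
    simp only [Category.assoc, BraidedCategory.braiding_naturality_left, comp_whiskerRight]
  simp only [h2, h3] at h1
  rw [← Preadditive.comp_sum, ← Preadditive.comp_sum, ← Preadditive.sum_comp,
    ← Preadditive.sum_comp, e1, e2] at h1
  simpa only [Category.assoc, Category.id_comp, MonoidalCategory.whiskerLeft_comp,
    comp_whiskerRight] using h1

theorem isSigmaPair_induced (X : C) :
    IsSigmaPair σ (inducedObj σ R X) (inducedHalfBraiding k σ R X) where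
  halfBraiding i := isHalfBraiding_of_unit (inducedHalfBraiding_naturality k σ R X i)
    (inducedHalfBraiding_hexagon k σ R X i) (inducedHalfBraiding_unit k σ R X i)
  comm₁ i j _ h _ := comm₁_of_turn (inducedHalfBraiding_turn k σ R X h)
  comm₂ i j h₁ h₂ h₃ Z₁ Z₂ := by
    have hij : i ≠ j := by rintro rfl; exact lt_irrefl _ h₁
    have h := inducedHalfBraiding_relation k σ R X hij (fun Z₁ Z₂ => (β_ Z₂ Z₁).hom)
      (fun T => T.relBB (fun t ht => T.relII_crossed t ht) _ (σ.pattern_crossed h₁ h₂ h₃)) Z₁ Z₂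
    rw [← reassoc_of% h]
    simp [← MonoidalCategory.whiskerLeft_comp]
  comm₃ i j h₁ _ h₃ Z₁ Z₂ := by
    have hij : i ≠ j := by rintro rfl; exact lt_irrefl _ h₁
    have h := inducedHalfBraiding_relation k σ R X hij (fun Z₁ Z₂ => (β_ Z₁ Z₂).inv)
      (fun T => T.relBB (fun t ht => T.relII_nested t ht) _ (σ.pattern_nested h₁ h₃)) Z₁ Z₂
    rw [← reassoc_of% h]
    simp [← MonoidalCategory.whiskerLeft_comp]

theorem slotMap_slotDelta (y y' : σ.Orbit → Fin R.card) {X Y : C} (f : X ⟶ Y)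
    (s : Slot σ.Orbit) : slotMap R y f s ≫ slotDelta R y y' Y s =
      slotDelta R y y' X s ≫ slotMap R y' f s := by
  cases s with
  | first i =>
    exact (Category.id_comp (delta R (y i) (y' i))).trans
      (Category.comp_id (delta R (y i) (y' i))).symm
  | second i =>
    exact (Category.id_comp (rightAdjointMate (delta R (y' i) (y i)))).trans
      (Category.comp_id (rightAdjointMate (delta R (y' i) (y i)))).symm
  | base => exact (Category.comp_id f).trans (Category.id_comp f).symm

theorem component_slotMap (i : σ.Orbit) (y y' : σ.Orbit → Fin R.card) {X Y : C} (f : X ⟶ Y)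
    (Z : C) : Z ◁ prodMap (slotMap R y f) σ.word ≫ component k σ i y y' Y Z =
      component k σ i y y' X Z ≫ prodMap (slotMap R y' f) σ.word ▷ Z := by
  rw [component, component, Preadditive.comp_sum, Preadditive.sum_comp]
  refine Finset.sum_congr rfl fun l _ => ?_
  rw [handle_apply, handle_apply, whiskerLeft_prodMap_sweepIn, sweepIn_prodMap_whiskerRight]
  have h1 : ∀ {P Q : C} (φ : Z ⊗ P ⟶ Q), Z ◁ 𝟙 P ≫ φ = φ ≫ 𝟙 Q := by simp
  have h2 : ∀ {P Q : C} (φ : P ⟶ Q ⊗ Z), 𝟙 P ≫ φ = φ ≫ (𝟙 Q) ▷ Z := by simp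
  congr 1
  · exact funext (slotMap_slotDelta σ R y y' f)
  · exact h1 _
  · exact h2 _

theorem inc_inducedMap (y : σ.Orbit → Fin R.card) {X Y : C} (f : X ⟶ Y) :
    inc σ y X ≫ inducedMap σ R f = prodMap (slotMap R y f) σ.word ≫ inc σ y Y := by
  have h : wordInc σ y X ≫ inducedMap σ R f = wordMap R y f σ.word ≫ wordInc σ y Y :=
    biproduct.ι_map (fun y : σ.Orbit → Fin R.card => wordMap R y f σ.word) y
  rw [inc, inc, Category.assoc, h, Iso.inv_comp_eq, ← Category.assoc (prodMap _ _),
    ← Category.assoc, ← Category.assoc, ← wordMap_wordIso, Category.assoc (wordMap R y f σ.word),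
    Iso.hom_inv_id, Category.comp_id]

theorem inducedMap_prj (y : σ.Orbit → Fin R.card) {X Y : C} (f : X ⟶ Y) :
    inducedMap σ R f ≫ prj σ y Y = prj σ y X ≫ prodMap (slotMap R y f) σ.word := by
  have h : inducedMap σ R f ≫ wordPrj σ y Y = wordPrj σ y X ≫ wordMap R y f σ.word :=
    biproduct.map_π (fun y : σ.Orbit → Fin R.card => wordMap R y f σ.word) y
  rw [prj, prj, Category.assoc, ← wordMap_wordIso, reassoc_of% h]

theorem isSigmaHom_inducedMap {X Y : C} (f : X ⟶ Y) :
    IsSigmaHom σ (inducedHalfBraiding k σ R X) (inducedHalfBraiding k σ R Y)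
      (inducedMap σ R f) := by
  intro i Z
  have e1 : ∑ y : σ.Orbit → Fin R.card, Z ◁ prj σ y X ≫ Z ◁ inc σ y X = 𝟙 _ :=
    sum_whiskerLeft_prj_inc σ R X Z
  have e2 : ∑ y : σ.Orbit → Fin R.card, prj σ y Y ▷ Z ≫ inc σ y Y ▷ Z =
      𝟙 (inducedObj σ R Y ⊗ Z) := by
    simp only [← comp_whiskerRight, ← sum_whiskerRight, sum_prj_inc, id_whiskerRight]
  refine hom_ext_of_decomposition e1 e2 fun y y' => ?_
  have h := component_slotMap k σ R i y y' f Z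
  rw [← inc_inducedHalfBraiding_prj, ← inc_inducedHalfBraiding_prj] at h
  simp only [Category.assoc] at h ⊢
  rw [← MonoidalCategory.whiskerLeft_comp_assoc, inc_inducedMap, ← comp_whiskerRight,
    inducedMap_prj, MonoidalCategory.whiskerLeft_comp, comp_whiskerRight, Category.assoc, h]

end Induced

/-! ### Loops around a morphism and strands leaving them -/

section Encircling

variable {C : Type u} [Category.{v} C] [MonoidalCategory C] [BraidedCategory C] [RigidCategory C]
  [RibbonCategory C]

/-- A strand `Z` can be pulled out of the loop of a partial trace. -/
theorem ptr_conj_of_slide {X Y A Z : C} (B : C) [ExactPairing A B] (s : A ⊗ Z ≅ Z ⊗ A)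
    (t : B ⊗ Z ⟶ Z ⊗ B)
    (h1 : Z ◁ η_ A B ≫ (α_ Z A B).inv ≫ s.inv ▷ B =
      (ρ_ Z).hom ≫ (λ_ Z).inv ≫ η_ A B ▷ Z ≫ (α_ A B Z).hom ≫ A ◁ t ≫ (α_ A Z B).inv)
    (h2 : A ◁ t ≫ (α_ A Z B).inv ≫ s.hom ▷ B ≫ (α_ Z A B).hom ≫ Z ◁ pivEv A B ≫ (ρ_ Z).hom =
      (α_ A B Z).inv ≫ pivEv A B ▷ Z ≫ (λ_ Z).hom) (N : X ⊗ A ⟶ Y ⊗ A) :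
    ptr B ((α_ X Z A).hom ≫ X ◁ s.inv ≫ (α_ X A Z).inv ≫ N ▷ Z ≫ (α_ Y A Z).hom ≫ Y ◁ s.hom ≫
      (α_ Y Z A).inv) = ptr B N ▷ Z := by
  unfold ptr
  calc
    _ = 𝟙 _ ⊗≫ X ◁ (Z ◁ η_ A B ≫ (α_ Z A B).inv ≫ s.inv ▷ B) ⊗≫ N ▷ (Z ⊗ B) ⊗≫
        Y ◁ (s.hom ▷ B ≫ (α_ Z A B).hom ≫ Z ◁ pivEv A B) ⊗≫ 𝟙 _ := by monoidal
    _ = 𝟙 _ ⊗≫ X ◁ η_ A B ▷ Z ⊗≫ ((X ⊗ A) ◁ t ≫ N ▷ (Z ⊗ B)) ⊗≫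
        Y ◁ (s.hom ▷ B ≫ (α_ Z A B).hom ≫ Z ◁ pivEv A B) ⊗≫ 𝟙 _ := by
      rw [h1]
      monoidal
    _ = 𝟙 _ ⊗≫ X ◁ η_ A B ▷ Z ⊗≫ N ▷ (B ⊗ Z) ⊗≫
        Y ◁ (A ◁ t ≫ (α_ A Z B).inv ≫ s.hom ▷ B ≫ (α_ Z A B).hom ≫ Z ◁ pivEv A B ≫ (ρ_ Z).hom) ⊗≫
          𝟙 _ := by
      rw [whisker_exchange]
      monoidal
    _ = _ := by
      rw [h2]
      monoidal

theorem ptr_conj_braiding {X Y A Z : C} (B : C) [ExactPairing A B] (N : X ⊗ A ⟶ Y ⊗ A) :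
    ptr B ((α_ X Z A).hom ≫ X ◁ (β_ A Z).inv ≫ (α_ X A Z).inv ≫ N ▷ Z ≫ (α_ Y A Z).hom ≫
      Y ◁ (β_ A Z).hom ≫ (α_ Y Z A).inv) = ptr B N ▷ Z := by
  refine ptr_conj_of_slide B (β_ A Z) (β_ B Z).hom ?_ ?_ N
  · have h := BraidedCategory.braiding_naturality_left (η_ A B) Z
    rw [BraidedCategory.braiding_tensor_left_hom, braiding_tensorUnit_left] at h
    rw [← cancel_mono ((β_ A Z).hom ▷ B), ← cancel_mono (α_ Z A B).hom]
    simp only [Category.assoc, inv_hom_whiskerRight, Category.comp_id, Iso.inv_hom_id] at h ⊢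
    rw [h]
    simp
  · have h := BraidedCategory.braiding_naturality_left (pivEv A B) Z
    rw [BraidedCategory.braiding_tensor_left_hom, braiding_tensorUnit_left] at h
    rw [← cancel_epi (α_ A B Z).hom, ← cancel_mono (ρ_ Z).inv]
    simp only [Category.assoc, Iso.hom_inv_id, Category.comp_id, Iso.hom_inv_id_assoc] at h ⊢
    rw [h]

theorem ptr_conj_braiding_inv {X Y A Z : C} (B : C) [ExactPairing A B] (N : X ⊗ A ⟶ Y ⊗ A) :
    ptr B ((α_ X Z A).hom ≫ X ◁ (β_ Z A).hom ≫ (α_ X A Z).inv ≫ N ▷ Z ≫ (α_ Y A Z).hom ≫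
      Y ◁ (β_ Z A).inv ≫ (α_ Y Z A).inv) = ptr B N ▷ Z := by
  refine ptr_conj_of_slide B (β_ Z A).symm (β_ Z B).inv ?_ ?_ N
  · have h := BraidedCategory.braiding_inv_naturality_left (η_ A B) Z
    rw [BraidedCategory.braiding_tensor_right_inv, braiding_inv_tensorUnit_right] at h
    rw [← cancel_mono ((β_ Z A).inv ▷ B), ← cancel_mono (α_ Z A B).hom]
    simp only [Iso.symm_inv, Category.assoc, hom_inv_whiskerRight, Category.comp_id,
      Iso.inv_hom_id] at h ⊢
    rw [← cancel_epi ((λ_ Z).hom ≫ (ρ_ Z).inv)]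
    simpa using h.symm
  · have h := BraidedCategory.braiding_inv_naturality_left (pivEv A B) Z
    rw [BraidedCategory.braiding_tensor_right_inv, braiding_inv_tensorUnit_right] at h
    rw [← cancel_epi (α_ A B Z).hom, ← cancel_mono (ρ_ Z).inv]
    simp only [Iso.symm_hom, Category.assoc, Iso.hom_inv_id, Category.comp_id,
      Iso.hom_inv_id_assoc] at h ⊢
    rw [h]

/-- The conjugate of a morphism by half-braidings. -/
def conjugate {X Y A : C} (g : A ⊗ X ⟶ X ⊗ A) [IsIso g] (g' : A ⊗ Y ⟶ Y ⊗ A) (f : X ⟶ Y) :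
    X ⊗ A ⟶ Y ⊗ A :=
  inv g ≫ A ◁ f ≫ g'

/-- `X` and `Y` satisfy the same commutative relation. The crossings `p` on the left cancel in the
conjugation, whereas `q` survives as a conjugation of the loop strand, which `ptr` can undo. -/
theorem conjugate_exchange {X Y A Z : C} {g : A ⊗ X ⟶ X ⊗ A} [IsIso g] {g' : A ⊗ Y ⟶ Y ⊗ A}
    {b : Z ⊗ X ⟶ X ⊗ Z} {b' : Z ⊗ Y ⟶ Y ⊗ Z} {p : Z ⊗ A ⟶ A ⊗ Z} {q : A ⊗ Z ≅ Z ⊗ A}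
    (hX : stack b g = p ▷ X ≫ stack g b ≫ X ◁ q.hom)
    (hY : stack b' g' = p ▷ Y ≫ stack g' b' ≫ Y ◁ q.hom) {f : X ⟶ Y}
    (hf : Z ◁ f ≫ b' = b ≫ f ▷ Z) :
    (α_ Z X A).hom ≫ Z ◁ conjugate g g' f ≫ (α_ Z Y A).inv ≫ b' ▷ A =
      b ▷ A ≫ (α_ X Z A).hom ≫ X ◁ q.inv ≫ (α_ X A Z).inv ≫ conjugate g g' f ▷ Z ≫
        (α_ Y A Z).hom ≫ Y ◁ q.hom ≫ (α_ Y Z A).inv := by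
  have hX' : stack b g ≫ X ◁ q.inv = p ▷ X ≫ stack g b := by
    rw [hX]
    simp [← MonoidalCategory.whiskerLeft_comp]
  have e1 : (Z ⊗ A) ◁ f ≫ stack b' g' =
      stack b g ≫ X ◁ q.inv ≫ (α_ X A Z).inv ≫ conjugate g g' f ▷ Z ≫ (α_ Y A Z).hom ≫
        Y ◁ q.hom := by
    rw [hY, reassoc_of% hX', whisker_exchange_assoc]
    have e2 : (A ⊗ Z) ◁ f ≫ stack g' b' =
        (α_ A Z X).hom ≫ A ◁ (Z ◁ f ≫ b') ≫ (α_ A Y Z).inv ≫ g' ▷ Z ≫ (α_ Y A Z).hom := by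
      dsimp only [stack]
      monoidal
    have e3 : stack g b ≫ (α_ X A Z).inv ≫ conjugate g g' f ▷ Z ≫ (α_ Y A Z).hom =
        (α_ A Z X).hom ≫ A ◁ (b ≫ f ▷ Z) ≫ (α_ A Y Z).inv ≫ g' ▷ Z ≫ (α_ Y A Z).hom := by
      simp [stack, conjugate]
    rw [reassoc_of% e2, hf, ← reassoc_of% e3]
  have e4 : (α_ Z X A).hom ≫ Z ◁ conjugate g g' f ≫ (α_ Z Y A).inv ≫ b' ▷ A =
      (α_ Z X A).hom ≫ Z ◁ inv g ≫ (α_ Z A X).inv ≫ ((Z ⊗ A) ◁ f ≫ stack b' g') ≫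
        (α_ Y Z A).inv := by
    simp [stack, conjugate]
  rw [e4, e1]
  simp only [stack, Category.assoc, Iso.inv_hom_id_assoc]
  rw [← MonoidalCategory.whiskerLeft_comp_assoc, IsIso.inv_hom_id]
  simp

theorem ptr_conjugate_exchange {X Y A Z : C} (B : C) [ExactPairing A B] {g : A ⊗ X ⟶ X ⊗ A}
    [IsIso g] {g' : A ⊗ Y ⟶ Y ⊗ A} {b : Z ⊗ X ⟶ X ⊗ Z} {b' : Z ⊗ Y ⟶ Y ⊗ Z} {p : Z ⊗ A ⟶ A ⊗ Z}
    {q : A ⊗ Z ≅ Z ⊗ A} (hq : q = β_ A Z ∨ q = (β_ Z A).symm)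
    (hX : stack b g = p ▷ X ≫ stack g b ≫ X ◁ q.hom)
    (hY : stack b' g' = p ▷ Y ≫ stack g' b' ≫ Y ◁ q.hom) {f : X ⟶ Y}
    (hf : Z ◁ f ≫ b' = b ≫ f ▷ Z) :
    Z ◁ ptr B (conjugate g g' f) ≫ b' = b ≫ ptr B (conjugate g g' f) ▷ Z := by
  have h : ptr B ((α_ X Z A).hom ≫ X ◁ q.inv ≫ (α_ X A Z).inv ≫ conjugate g g' f ▷ Z ≫
      (α_ Y A Z).hom ≫ Y ◁ q.hom ≫ (α_ Y Z A).inv) = ptr B (conjugate g g' f) ▷ Z := by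
    rcases hq with rfl | rfl
    · exact ptr_conj_braiding B _
    · exact ptr_conj_braiding_inv B _
  rw [← ptr_whiskerLeft, ← ptr_comp_right, ← h, ← ptr_comp_left]
  congr 1
  rw [← conjugate_exchange hX hY hf]
  simp

theorem doubleBraiding_eq (X A : C) : (β_ X A).hom ≫ (β_ A X).hom =
    (RibbonCategory.twist (X ⊗ A)).hom ≫
      ((RibbonCategory.twist X).inv ⊗ₘ (RibbonCategory.twist A).inv) := by
  rw [RibbonCategory.twist_tensor]
  simp

theorem tildeTwist_naturality {X Y Z : C} {g : Z ⊗ X ⟶ X ⊗ Z} {g' : Z ⊗ Y ⟶ Y ⊗ Z} {f : X ⟶ Y} :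
    Z ◁ f ≫ tildeTwist g' = tildeTwist g ≫ f ▷ Z ↔ Z ◁ f ≫ g' = g ≫ f ▷ Z := by
  have h : tildeTwist g ≫ f ▷ Z = (g ≫ f ▷ Z) ≫ (β_ Y Z).hom ≫ (β_ Z Y).hom := by
    simp [tildeTwist]
  rw [h, tildeTwist, ← Category.assoc, cancel_mono]

instance isIso_tildeTwist {X Z : C} (g : Z ⊗ X ⟶ X ⊗ Z) [IsIso g] : IsIso (tildeTwist g) := by
  unfold tildeTwist
  infer_instance

/-- The double braiding is the twist of `X ⊗ A` up to the twists of the factors. The first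
disappears by naturality, the twist of `A` cancels around the loop, and those of `X` and `Y` cancel
by naturality along the partial trace. -/
theorem ptr_conjugate_tildeTwist {X Y A : C} (B : C) [ExactPairing A B] (g : A ⊗ X ⟶ X ⊗ A)
    [IsIso g] (g' : A ⊗ Y ⟶ Y ⊗ A) (f : X ⟶ Y) :
    ptr B (conjugate (tildeTwist g) (tildeTwist g') f) = ptr B (conjugate g g' f) := by
  set N := conjugate g g' f with hN
  have h1 : conjugate (tildeTwist g) (tildeTwist g') f =
      (RibbonCategory.twist X).hom ▷ A ≫ (X ◁ (RibbonCategory.twist A).hom ≫ N ≫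
        Y ◁ (RibbonCategory.twist A).inv) ≫ (RibbonCategory.twist Y).inv ▷ A := by
    have e : conjugate (tildeTwist g) (tildeTwist g') f =
        inv ((β_ X A).hom ≫ (β_ A X).hom) ≫ N ≫ (β_ Y A).hom ≫ (β_ A Y).hom := by
      simp [conjugate, tildeTwist, hN]
    rw [e, IsIso.inv_comp_eq, doubleBraiding_eq, doubleBraiding_eq,
      reassoc_of% RibbonCategory.twist_naturality N, Category.assoc]
    congr 1
    rw [MonoidalCategory.tensorHom_def', MonoidalCategory.tensorHom_def']
    simp only [Category.assoc]
    rw [← comp_whiskerRight_assoc, Iso.inv_hom_id, id_whiskerRight, Category.id_comp,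
      ← MonoidalCategory.whiskerLeft_comp_assoc, Iso.inv_hom_id, MonoidalCategory.whiskerLeft_id,
      Category.id_comp]
  rw [h1, ptr_natural, ptr_slide B B, Category.assoc, ← MonoidalCategory.whiskerLeft_comp,
    Iso.inv_hom_id, MonoidalCategory.whiskerLeft_id, Category.comp_id,
    ← reassoc_of% RibbonCategory.twist_naturality (ptr B N), Iso.hom_inv_id, Category.comp_id]

theorem conjugate_naturality {X Y : C} {γ : ∀ Z : C, Z ⊗ X ⟶ X ⊗ Z} {β : ∀ Z : C, Z ⊗ Y ⟶ Y ⊗ Z}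
    (hγ : IsHalfBraiding X γ) (hβ : IsHalfBraiding Y β) [∀ Z, IsIso (γ Z)] (f : X ⟶ Y) {A B : C}
    (h : A ⟶ B) : X ◁ h ≫ conjugate (γ B) (β B) f = conjugate (γ A) (β A) f ≫ Y ◁ h := by
  have e : X ◁ h ≫ inv (γ B) = inv (γ A) ≫ h ▷ X := by
    rw [IsIso.eq_inv_comp, ← Category.assoc, IsIso.comp_inv_eq, hγ.naturality]
  rw [conjugate, reassoc_of% e, ← whisker_exchange_assoc, hβ.naturality]
  simp [conjugate]

theorem conjugate_tensor {X Y : C} {γ : ∀ Z : C, Z ⊗ X ⟶ X ⊗ Z} {β : ∀ Z : C, Z ⊗ Y ⟶ Y ⊗ Z}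
    (hγ : IsHalfBraiding X γ) (hβ : IsHalfBraiding Y β) [∀ Z, IsIso (γ Z)] (f : X ⟶ Y) (Z A : C) :
    (α_ X Z A).hom ≫ conjugate (γ (Z ⊗ A)) (β (Z ⊗ A)) f ≫ (α_ Y Z A).inv =
      inv (γ Z) ▷ A ≫ ((α_ Z X A).hom ≫ Z ◁ conjugate (γ A) (β A) f ≫ (α_ Z Y A).inv) ≫
        β Z ▷ A := by
  rw [← cancel_epi ((α_ Z A X).hom ≫ Z ◁ γ A ≫ (α_ Z X A).inv ≫ γ Z ▷ A)]
  have e : ((α_ Z A X).hom ≫ Z ◁ γ A ≫ (α_ Z X A).inv ≫ γ Z ▷ A) ≫ (α_ X Z A).hom =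
    γ (Z ⊗ A) := by
    rw [hγ.hexagon]
    simp [stack]
  simp only [Category.assoc] at e
  simp only [Category.assoc, reassoc_of% e]
  simp only [conjugate, IsIso.hom_inv_id_assoc, hβ.hexagon, stack, Category.assoc]
  rw [← comp_whiskerRight_assoc, IsIso.hom_inv_id]
  simp only [id_whiskerRight, Category.id_comp, Iso.inv_hom_id_assoc, Iso.hom_inv_id,
    Category.comp_id]
  rw [← MonoidalCategory.whiskerLeft_comp_assoc, IsIso.hom_inv_id_assoc]
  simp

theorem conjugate_unit {X Y : C} {γ : ∀ Z : C, Z ⊗ X ⟶ X ⊗ Z} {β : ∀ Z : C, Z ⊗ Y ⟶ Y ⊗ Z}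
    (hγ : IsHalfBraiding X γ) (hβ : IsHalfBraiding Y β) [∀ Z, IsIso (γ Z)] (f : X ⟶ Y) {U : C}
    (e : 𝟙_ C ≅ U) : conjugate (γ U) (β U) f = f ▷ U := by
  have h := conjugate_naturality hγ hβ f e.hom
  have h1 : conjugate (γ (𝟙_ C)) (β (𝟙_ C)) f = f ▷ 𝟙_ C := by
    rw [conjugate, IsIso.inv_comp_eq, hγ.unit, hβ.unit]
    simp
  rw [h1, ← whisker_exchange] at h
  exact (cancel_epi (X ◁ e.hom)).mp h

theorem conjugate_natural {X X' Y Y' A : C} {g₀ : A ⊗ X' ⟶ X' ⊗ A} {g : A ⊗ X ⟶ X ⊗ A} [IsIso g₀]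
    [IsIso g] {b : A ⊗ Y ⟶ Y ⊗ A} {b₀ : A ⊗ Y' ⟶ Y' ⊗ A} {x : X' ⟶ X} {y : Y ⟶ Y'}
    (hx : A ◁ x ≫ g = g₀ ≫ x ▷ A) (hy : A ◁ y ≫ b₀ = b ≫ y ▷ A) (f : X ⟶ Y) :
    conjugate g₀ b₀ (x ≫ f ≫ y) = x ▷ A ≫ conjugate g b f ≫ y ▷ A := by
  rw [conjugate, IsIso.inv_comp_eq, ← reassoc_of% hx, conjugate, Category.assoc, Category.assoc,
    ← hy]
  simp

theorem conjugate_of_hom {X Y A : C} {g : A ⊗ X ⟶ X ⊗ A} [IsIso g] {b : A ⊗ Y ⟶ Y ⊗ A} {f : X ⟶ Y}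
    (h : A ◁ f ≫ b = g ≫ f ▷ A) : conjugate g b f = f ▷ A := by
  rw [conjugate, h, IsIso.inv_hom_id_assoc]

end Encircling

/-! ### Averaging over one half-braiding -/

section Average

variable (k : Type w) {C : Type u} [Field k] [IsAlgClosed k] [Category.{v} C] [Abelian C]
  [Linear k C] [MonoidalCategory C] [MonoidalPreadditive C] [MonoidalLinear k C]
  [BraidedCategory C] [RigidCategory C] [RibbonCategory C] [FusionCategory k C]
  (R : SimpleReps C)

/-- The average of a morphism over the conjugates by half-braidings. -/
def average {X Y : C} (γ : ∀ Z : C, Z ⊗ X ⟶ X ⊗ Z) [∀ Z, IsIso (γ Z)] (β : ∀ Z : C, Z ⊗ Y ⟶ Y ⊗ Z) :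
    (X ⟶ Y) →ₗ[k] (X ⟶ Y) where
  toFun f := (globalDim k R)⁻¹ • ∑ a, qdim k (R.obj a) •
    ptr (R.obj a)ᘁ (conjugate (γ (R.obj a)) (β (R.obj a)) f)
  map_add' f g := by
    simp only [conjugate, MonoidalPreadditive.whiskerLeft_add, Preadditive.add_comp,
      Preadditive.comp_add, ptr_add, smul_add, Finset.sum_add_distrib]
  map_smul' c f := by
    simp only [conjugate, MonoidalLinear.whiskerLeft_smul, Linear.smul_comp, Linear.comp_smul,
      ptr_smul k, smul_comm _ c, RingHom.id_apply, ← Finset.smul_sum]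

variable {X Y : C} {γ : ∀ Z : C, Z ⊗ X ⟶ X ⊗ Z} {β : ∀ Z : C, Z ⊗ Y ⟶ Y ⊗ Z} [∀ Z, IsIso (γ Z)]

theorem average_apply (f : X ⟶ Y) : average k R γ β f = (globalDim k R)⁻¹ • ∑ a,
    qdim k (R.obj a) • ptr (R.obj a)ᘁ (conjugate (γ (R.obj a)) (β (R.obj a)) f) := rfl

/-- Conjugating the average by the half-braidings at `Z` replaces the loops `a` by `Z ⊗ a`, and the
handle slide says that this changes nothing. -/
theorem average_isHom (hγ : IsHalfBraiding X γ) (hβ : IsHalfBraiding Y β) (f : X ⟶ Y) (Z : C) :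
    Z ◁ average k R γ β f ≫ β Z = γ Z ≫ average k R γ β f ▷ Z := by
  have h := handle_slide k R Z (fun A => conjugate (γ A) (β A) f)
    (fun h => conjugate_naturality hγ hβ f h)
  simp only [conjugate_tensor hγ hβ, ptr_natural, ptr_whiskerLeft] at h
  rw [average_apply, MonoidalLinear.smul_whiskerRight, ← h]
  simp [whiskerLeft_sum, Preadditive.sum_comp, Preadditive.comp_sum]

theorem average_natural {X' Y' : C} {γ' : ∀ Z : C, Z ⊗ X' ⟶ X' ⊗ Z} [∀ Z, IsIso (γ' Z)]
    {β' : ∀ Z : C, Z ⊗ Y' ⟶ Y' ⊗ Z} {x : X' ⟶ X} {y : Y ⟶ Y'}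
    (hx : ∀ Z, Z ◁ x ≫ γ Z = γ' Z ≫ x ▷ Z) (hy : ∀ Z, Z ◁ y ≫ β' Z = β Z ≫ y ▷ Z) (f : X ⟶ Y) :
    average k R γ' β' (x ≫ f ≫ y) = x ≫ average k R γ β f ≫ y := by
  simp only [average_apply, conjugate_natural (hx _) (hy _), ptr_natural, Linear.smul_comp,
    Linear.comp_smul, Preadditive.sum_comp, Preadditive.comp_sum]

theorem average_of_hom [CharZero k] {f : X ⟶ Y} (h : ∀ Z, Z ◁ f ≫ β Z = γ Z ≫ f ▷ Z) :
    average k R γ β f = f := by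
  simp only [average_apply, conjugate_of_hom (h _), ptr_whiskerRight k, smul_smul,
    ← Finset.sum_smul]
  rw [← globalDim, inv_mul_cancel₀ (globalDim_ne_zero k R), one_smul]

theorem average_preserves {γ' : ∀ Z : C, Z ⊗ X ⟶ X ⊗ Z} {β' : ∀ Z : C, Z ⊗ Y ⟶ Y ⊗ Z} {f : X ⟶ Y}
    (h : ∀ A Z, Z ◁ ptr Aᘁ (conjugate (γ A) (β A) f) ≫ β' Z =
      γ' Z ≫ ptr Aᘁ (conjugate (γ A) (β A) f) ▷ Z) (Z : C) :
    Z ◁ average k R γ β f ≫ β' Z = γ' Z ≫ average k R γ β f ▷ Z := by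
  simp only [average_apply, MonoidalLinear.whiskerLeft_smul, MonoidalLinear.smul_whiskerRight,
    whiskerLeft_sum, sum_whiskerRight, Linear.smul_comp, Linear.comp_smul, Preadditive.sum_comp,
    Preadditive.comp_sum, h]

/-- Averaging over the half-braiding of one orbit preserves the compatibility with the half-braiding
of another one. -/
theorem average_isHom_of_ne {n : ℕ} {σ : AdmissibleGluing n} (x y : SigmaCenter C σ)
    {i j : σ.Orbit} (hij : i ≠ j) [∀ Z, IsIso (x.γ i Z)] {f : x.X ⟶ y.X}
    (hf : ∀ Z, Z ◁ f ≫ y.γ j Z = x.γ j Z ≫ f ▷ Z) (Z : C) :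
    Z ◁ average k R (x.γ i) (y.γ i) f ≫ y.γ j Z = x.γ j Z ≫ average k R (x.γ i) (y.γ i) f ▷ Z := by
  refine average_preserves k R (fun A Z => ?_) Z
  have swap : ∀ {X Z₁ Z₂ : C} {a : Z₂ ⊗ X ⟶ X ⊗ Z₂} {b : Z₁ ⊗ X ⟶ X ⊗ Z₁} (q : Z₁ ⊗ Z₂ ≅ Z₂ ⊗ Z₁),
      stack a b = (β_ Z₁ Z₂).inv ▷ X ≫ stack b a ≫ X ◁ q.hom →
      stack b a = (β_ Z₁ Z₂).hom ▷ X ≫ stack a b ≫ X ◁ q.symm.hom := fun q h => by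
    rw [h]
    simp [← MonoidalCategory.whiskerLeft_comp, ← comp_whiskerRight_assoc]
  have hlo : ∀ {a b : σ.Orbit}, σ.lo a = σ.lo b → a = b := fun h => Subtype.ext h
  have hx := x.isSigmaPair
  have hy := y.isSigmaPair
  rcases lt_or_gt_of_ne (fun e => hij (hlo e) : σ.lo i ≠ σ.lo j) with h | h
  · rcases lt_trichotomy (σ.hi i) (σ.lo j) with h' | h' | h'
    · have h1 := hx.comm₁ i j (σ.lo_lt_hi i) h' (σ.lo_lt_hi j) A Z
      have h2 := hy.comm₁ i j (σ.lo_lt_hi i) h' (σ.lo_lt_hi j) A Z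
      -- The first relation involves the twisted half-braiding of the averaged orbit, which has the
      -- same loops.
      rw [← ptr_conjugate_tildeTwist]
      exact ptr_conjugate_exchange _ (q := β_ A Z) (Or.inl rfl) h1 h2 (hf Z)
    · have := congrArg σ.slot h'
      rw [σ.slot_hi, σ.slot_lo] at this
      cases this
    · rcases lt_trichotomy (σ.hi i) (σ.hi j) with h'' | h'' | h''
      · exact ptr_conjugate_exchange _ (q := (β_ Z A).symm) (Or.inr rfl)
          (hx.comm₂ i j h h' h'' A Z) (hy.comm₂ i j h h' h'' A Z) (hf Z)
      · have := congrArg σ.slot h''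
        rw [σ.slot_hi, σ.slot_hi] at this
        exact absurd (Slot.second.inj this) hij
      · exact ptr_conjugate_exchange _ (q := β_ A Z) (Or.inl rfl)
          (hx.comm₃ i j h (σ.lo_lt_hi j) h'' A Z) (hy.comm₃ i j h (σ.lo_lt_hi j) h'' A Z) (hf Z)
  · rcases lt_trichotomy (σ.hi j) (σ.lo i) with h' | h' | h'
    · have h1 := swap (β_ Z A) (hx.comm₁ j i (σ.lo_lt_hi j) h' (σ.lo_lt_hi i) Z A)
      have h2 := swap (β_ Z A) (hy.comm₁ j i (σ.lo_lt_hi j) h' (σ.lo_lt_hi i) Z A)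
      -- Here the twisted half-braiding belongs to the other orbit; compatibility with it and with
      -- the untwisted one are equivalent.
      rw [← tildeTwist_naturality]
      exact ptr_conjugate_exchange _ (q := (β_ Z A).symm) (Or.inr rfl) h1 h2
        (tildeTwist_naturality.mpr (hf Z))
    · have := congrArg σ.slot h'
      rw [σ.slot_hi, σ.slot_lo] at this
      cases this
    · rcases lt_trichotomy (σ.hi j) (σ.hi i) with h'' | h'' | h''
      · exact ptr_conjugate_exchange _ (q := β_ A Z) (Or.inl rfl)
          (swap (β_ A Z).symm (hx.comm₂ j i h h' h'' Z A))
          (swap (β_ A Z).symm (hy.comm₂ j i h h' h'' Z A)) (hf Z)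
      · have := congrArg σ.slot h''
        rw [σ.slot_hi, σ.slot_hi] at this
        exact absurd (Slot.second.inj this).symm hij
      · exact ptr_conjugate_exchange _ (q := (β_ Z A).symm) (Or.inr rfl)
          (swap (β_ Z A) (hx.comm₃ j i h (σ.lo_lt_hi i) h'' Z A))
          (swap (β_ Z A) (hy.comm₃ j i h (σ.lo_lt_hi i) h'' Z A)) (hf Z)

end Average

/-! ### The projection onto morphisms of the center -/

section Projection

variable (k : Type w) {C : Type u} [Field k] [IsAlgClosed k] [Category.{v} C] [Abelian C]
  [Linear k C] [MonoidalCategory C] [MonoidalPreadditive C] [MonoidalLinear k C]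
  [BraidedCategory C] [RigidCategory C] [RibbonCategory C] [FusionCategory k C]
  (R : SimpleReps C) {n : ℕ} {σ : AdmissibleGluing n}

instance SigmaCenter.isIso_γ (x : SigmaCenter C σ) (i : σ.Orbit) (Z : C) : IsIso (x.γ i Z) :=
  (x.isSigmaPair.halfBraiding i).isIso Z

/-- The average over the half-braidings of a list of orbits. -/
def iteratedAverage (x y : SigmaCenter C σ) : List σ.Orbit → ((x.X ⟶ y.X) →ₗ[k] (x.X ⟶ y.X))
  | [] => LinearMap.id
  | i :: L => average k R (x.γ i) (y.γ i) ∘ₗ iteratedAverage x y L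

variable {x y : SigmaCenter C σ}

theorem iteratedAverage_cons (i : σ.Orbit) (L : List σ.Orbit) (f : x.X ⟶ y.X) :
    iteratedAverage k R x y (i :: L) f =
      average k R (x.γ i) (y.γ i) (iteratedAverage k R x y L f) := rfl

theorem iteratedAverage_isHom {L : List σ.Orbit} {i : σ.Orbit} (hi : i ∈ L) (f : x.X ⟶ y.X) (Z : C) :
    Z ◁ iteratedAverage k R x y L f ≫ y.γ i Z = x.γ i Z ≫ iteratedAverage k R x y L f ▷ Z := by
  induction L generalizing Z with
  | nil => simp at hi
  | cons j L ih =>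
    by_cases h : j = i
    · subst h
      exact average_isHom k R (x.isSigmaPair.halfBraiding j) (y.isSigmaPair.halfBraiding j) _ Z
    · exact average_isHom_of_ne k R x y h
        (fun Z => ih ((List.mem_cons.mp hi).resolve_left (Ne.symm h)) Z) Z

theorem iteratedAverage_of_hom [CharZero k] {L : List σ.Orbit} {f : x.X ⟶ y.X}
    (hf : ∀ i ∈ L, ∀ Z, Z ◁ f ≫ y.γ i Z = x.γ i Z ≫ f ▷ Z) : iteratedAverage k R x y L f = f := by
  induction L with
  | nil => rfl
  | cons i L ih =>
    rw [iteratedAverage_cons, ih fun j hj => hf j (by simp [hj]),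
      average_of_hom k R (hf i (by simp))]

theorem iteratedAverage_natural {x' y' : SigmaCenter C σ} {L : List σ.Orbit} {a : x'.X ⟶ x.X}
    {b : y.X ⟶ y'.X} (ha : ∀ i ∈ L, ∀ Z, Z ◁ a ≫ x.γ i Z = x'.γ i Z ≫ a ▷ Z)
    (hb : ∀ i ∈ L, ∀ Z, Z ◁ b ≫ y'.γ i Z = y.γ i Z ≫ b ▷ Z) (f : x.X ⟶ y.X) :
    iteratedAverage k R x' y' L (a ≫ f ≫ b) = a ≫ iteratedAverage k R x y L f ≫ b := by
  induction L with
  | nil => rfl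
  | cons i L ih =>
    rw [iteratedAverage_cons, ih (fun j hj => ha j (by simp [hj])) (fun j hj => hb j (by simp [hj])),
      average_natural k R (ha i (by simp)) (hb i (by simp)), iteratedAverage_cons]

theorem iteratedAverage_natural_left {x' : SigmaCenter C σ} {L : List σ.Orbit} {a : x'.X ⟶ x.X}
    (ha : ∀ i ∈ L, ∀ Z, Z ◁ a ≫ x.γ i Z = x'.γ i Z ≫ a ▷ Z) (f : x.X ⟶ y.X) :
    iteratedAverage k R x' y L (a ≫ f) = a ≫ iteratedAverage k R x y L f := by
  simpa using iteratedAverage_natural k R ha (b := 𝟙 y.X) (by simp) f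

theorem iteratedAverage_natural_right {y' : SigmaCenter C σ} {L : List σ.Orbit}
    {b : y.X ⟶ y'.X} (hb : ∀ i ∈ L, ∀ Z, Z ◁ b ≫ y'.γ i Z = y.γ i Z ≫ b ▷ Z) (f : x.X ⟶ y.X) :
    iteratedAverage k R x y' L (f ≫ b) = iteratedAverage k R x y L f ≫ b := by
  simpa using iteratedAverage_natural k R (a := 𝟙 x.X) (by simp) hb f

variable (x y)

/-- The projection of the morphisms of `C` onto the morphisms of `Z_σ(C)`. -/
def sigmaProjection : (x.X ⟶ y.X) →ₗ[k] (x.X ⟶ y.X) := iteratedAverage k R x y Finset.univ.toList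

variable {x y}

theorem isSigmaHom_sigmaProjection (f : x.X ⟶ y.X) :
    IsSigmaHom σ x.γ y.γ (sigmaProjection k R x y f) :=
  fun _ Z => iteratedAverage_isHom k R (by simp) f Z

theorem sigmaProjection_of_hom [CharZero k] (f : x ⟶ y) : sigmaProjection k R x y f.f = f.f :=
  iteratedAverage_of_hom k R fun i _ Z => f.isSigmaHom i Z

theorem sigmaProjection_natural {x' y' : SigmaCenter C σ} (g : x' ⟶ x) (f : x.X ⟶ y.X) (h : y ⟶ y') :
    sigmaProjection k R x' y' (g.f ≫ f ≫ h.f) = g.f ≫ sigmaProjection k R x y f ≫ h.f :=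
  iteratedAverage_natural k R (fun i _ Z => g.isSigmaHom i Z) (fun i _ Z => h.isSigmaHom i Z) f

theorem sigmaProjection_natural_left {x' : SigmaCenter C σ} (g : x' ⟶ x) (f : x.X ⟶ y.X) :
    sigmaProjection k R x' y (g.f ≫ f) = g.f ≫ sigmaProjection k R x y f :=
  iteratedAverage_natural_left k R (fun i _ Z => g.isSigmaHom i Z) f

theorem sigmaProjection_natural_right {y' : SigmaCenter C σ} (f : x.X ⟶ y.X) (h : y ⟶ y') :
    sigmaProjection k R x y' (f ≫ h.f) = sigmaProjection k R x y f ≫ h.f :=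
  iteratedAverage_natural_right k R (fun i _ Z => h.isSigmaHom i Z) f

end Projection

/-! ### Averages through a projection orthogonal to its translates -/

section Isotypic

variable (k : Type w) {C : Type u} [Field k] [IsAlgClosed k] [Category.{v} C] [Abelian C]
  [Linear k C] [MonoidalCategory C] [MonoidalPreadditive C] [MonoidalLinear k C]
  [BraidedCategory C] [RigidCategory C] [RibbonCategory C] [FusionCategory k C]
  (R : SimpleReps C)

/-- An endomorphism that is annihilated by all half-braidings except the one of the unit object. -/
theorem comp_average_comp {X Y : C} {γ : ∀ Z : C, Z ⊗ X ⟶ X ⊗ Z} {β : ∀ Z : C, Z ⊗ Y ⟶ Y ⊗ Z}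
    [∀ Z, IsIso (γ Z)] (hγ : IsHalfBraiding X γ) (hβ : IsHalfBraiding Y β) {u : Fin R.card}
    (e : 𝟙_ C ≅ R.obj u) {p : X ⟶ X} (hp : ∀ a, a ≠ u → p ▷ R.obj a ≫ inv (γ (R.obj a)) ≫ R.obj a ◁ p = 0)
    (f : X ⟶ Y) : p ≫ average k R γ β (p ≫ f) = (globalDim k R)⁻¹ • (p ≫ p ≫ f) := by
  rw [average_apply, Linear.comp_smul, Preadditive.comp_sum, Finset.sum_eq_single u]
  · rw [conjugate_unit hγ hβ _ e, ptr_whiskerRight k, ← qdim_iso k e, qdim_unit, one_smul, one_smul]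
  · intro a _ ha
    rw [Linear.comp_smul, ← ptr_comp_left, conjugate, MonoidalCategory.whiskerLeft_comp,
      Category.assoc, reassoc_of% hp a ha, zero_comp, ← zero_smul k (0 : X ⊗ R.obj a ⟶ Y ⊗ R.obj a),
      ptr_smul k, zero_smul, smul_zero]
  · simp

theorem average_comp_comp {X Y : C} {γ : ∀ Z : C, Z ⊗ X ⟶ X ⊗ Z} {β : ∀ Z : C, Z ⊗ Y ⟶ Y ⊗ Z}
    [∀ Z, IsIso (γ Z)] (hγ : IsHalfBraiding X γ) (hβ : IsHalfBraiding Y β) {u : Fin R.card}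
    (e : 𝟙_ C ≅ R.obj u) {p : Y ⟶ Y} (hp : ∀ a, a ≠ u → R.obj a ◁ p ≫ β (R.obj a) ≫ p ▷ R.obj a = 0)
    (f : X ⟶ Y) : average k R γ β (f ≫ p) ≫ p = (globalDim k R)⁻¹ • ((f ≫ p) ≫ p) := by
  rw [average_apply, Linear.smul_comp, Preadditive.sum_comp, Finset.sum_eq_single u]
  · rw [conjugate_unit hγ hβ _ e, ptr_whiskerRight k, ← qdim_iso k e, qdim_unit, one_smul, one_smul]
  · intro a _ ha
    rw [Linear.smul_comp, ← ptr_comp_right, conjugate, MonoidalCategory.whiskerLeft_comp,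
      Category.assoc, Category.assoc, Category.assoc, hp a ha, comp_zero, comp_zero,
      ← zero_smul k (0 : X ⊗ R.obj a ⟶ Y ⊗ R.obj a), ptr_smul k, zero_smul, smul_zero]
  · simp

theorem inv_eq_halfBraidingInv {X : C} {γ : ∀ Z : C, Z ⊗ X ⟶ X ⊗ Z} [∀ Z, IsIso (γ Z)]
    (hγ : IsHalfBraiding X γ) (A B : C) [ExactPairing A B] : inv (γ A) = halfBraidingInv γ A B := by
  rw [IsIso.inv_eq_of_hom_inv_id]
  exact hom_halfBraidingInv hγ.naturality hγ.hexagon hγ.unit A B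

/-- The inverse at `A` is the half-braiding at the dual with bent strands, so orthogonality at `B`
passes to the inverse at `A`. -/
theorem whiskerRight_inv_whiskerLeft {X : C} {γ : ∀ Z : C, Z ⊗ X ⟶ X ⊗ Z} [∀ Z, IsIso (γ Z)]
    (hγ : IsHalfBraiding X γ) {p : X ⟶ X} (A B : C) [ExactPairing A B]
    (h : B ◁ p ≫ γ B ≫ p ▷ B = 0) : p ▷ A ≫ inv (γ A) ≫ A ◁ p = 0 := by
  rw [inv_eq_halfBraidingInv hγ A B]
  calc
    _ = (λ_ (X ⊗ A)).inv ≫ (𝟙_ C ◁ p ▷ A ≫ η_ A B ▷ (X ⊗ A)) ≫ (α_ A B (X ⊗ A)).hom ≫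
        A ◁ (α_ B X A).inv ≫ A ◁ γ B ▷ A ≫ A ◁ (α_ X B A).hom ≫
        A ◁ (X ◁ ε_ A B ≫ p ▷ 𝟙_ C) ≫ A ◁ (ρ_ X).hom := by
      dsimp only [halfBraidingInv]
      monoidal
    _ = (λ_ (X ⊗ A)).inv ≫ η_ A B ▷ (X ⊗ A) ≫ (α_ A B (X ⊗ A)).hom ≫
        A ◁ (α_ B X A).inv ≫ A ◁ (B ◁ p ≫ γ B ≫ p ▷ B) ▷ A ≫ A ◁ (α_ X B A).hom ≫
        A ◁ X ◁ ε_ A B ≫ A ◁ (ρ_ X).hom := by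
      rw [whisker_exchange, whisker_exchange]
      monoidal
    _ = 0 := by
      rw [h]
      simp

end Isotypic

/-! ### Projections by colors of the induced object -/

section Colorings

variable (k : Type w) {C : Type u} [Field k] [IsAlgClosed k] [Category.{v} C] [Abelian C]
  [Linear k C] [MonoidalCategory C] [MonoidalPreadditive C] [MonoidalLinear k C]
  [BraidedCategory C] [RigidCategory C] [RibbonCategory C] [FusionCategory k C]
  {n : ℕ} (σ : AdmissibleGluing n) (R : SimpleReps C)

variable {R} in
/-- The projection of `X_σ` onto the sum of the summands for a set of colorings. -/
def colorProj (X : C) (s : Finset (σ.Orbit → Fin R.card)) : inducedObj σ R X ⟶ inducedObj σ R X :=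
  ∑ y ∈ s, prj σ y X ≫ inc σ y X

theorem colorProj_univ (X : C) : colorProj σ X (Finset.univ : Finset (σ.Orbit → Fin R.card)) = 𝟙 _ :=
  sum_prj_inc σ R X

theorem inc_colorProj (X : C) (s : Finset (σ.Orbit → Fin R.card)) (y : σ.Orbit → Fin R.card) :
    inc σ y X ≫ colorProj σ X s = if y ∈ s then inc σ y X else 0 := by
  rw [colorProj, Preadditive.comp_sum]
  split_ifs with h
  · rw [Finset.sum_eq_single_of_mem y h fun b _ hb => by rw [reassoc_of% inc_prj_ne σ R hb.symm, zero_comp],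
      reassoc_of% inc_prj_self]
  · refine Finset.sum_eq_zero fun b hb => ?_
    rw [reassoc_of% inc_prj_ne σ R (fun e : y = b => h (e ▸ hb)), zero_comp]

theorem colorProj_prj (X : C) (s : Finset (σ.Orbit → Fin R.card)) (y : σ.Orbit → Fin R.card) :
    colorProj σ X s ≫ prj σ y X = if y ∈ s then prj σ y X else 0 := by
  rw [colorProj, Preadditive.sum_comp]
  simp only [Category.assoc]
  split_ifs with h
  · rw [Finset.sum_eq_single_of_mem y h fun b _ hb => by rw [inc_prj_ne σ R hb, comp_zero],
      inc_prj_self, Category.comp_id]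
  · refine Finset.sum_eq_zero fun b hb => ?_
    rw [inc_prj_ne σ R (fun e : b = y => h (e ▸ hb)), comp_zero]

theorem inc_hom_ext {X Y : C} {f g : inducedObj σ R X ⟶ Y}
    (h : ∀ y : σ.Orbit → Fin R.card, inc σ y X ≫ f = inc σ y X ≫ g) : f = g := by
  rw [← Category.id_comp f, ← Category.id_comp g, ← sum_prj_inc σ R X]
  simp only [Preadditive.sum_comp, Category.assoc, h]

theorem colorProj_comp (X : C) (s t : Finset (σ.Orbit → Fin R.card)) :
    colorProj σ X s ≫ colorProj σ X t = colorProj σ X (s ∩ t) := by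
  refine inc_hom_ext σ R fun y => ?_
  rw [← Category.assoc, inc_colorProj, inc_colorProj]
  simp only [Finset.mem_inter]
  split_ifs <;> simp_all [inc_colorProj]

/-- The object `I_σ(X)` of `Z_σ(C)`. -/
def induced (X : C) : SigmaCenter C σ :=
  ⟨inducedObj σ R X, inducedHalfBraiding k σ R X, isSigmaPair_induced k σ R X⟩

theorem colorProj_isHom (X : C) {s : Finset (σ.Orbit → Fin R.card)} {j : σ.Orbit}
    (hs : ∀ y y', (∀ l, l ≠ j → y l = y' l) → (y ∈ s ↔ y' ∈ s)) (Z : C) :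
    Z ◁ colorProj σ X s ≫ inducedHalfBraiding k σ R X j Z =
      inducedHalfBraiding k σ R X j Z ≫ colorProj σ X s ▷ Z := by
  refine induced_hom_ext σ R fun y y' => ?_
  have e1 : Z ◁ inc σ y X ≫ (Z ◁ colorProj σ X s ≫ inducedHalfBraiding k σ R X j Z) ≫
      prj σ y' X ▷ Z = if y ∈ s then component k σ j y y' X Z else 0 := by
    rw [Category.assoc, ← MonoidalCategory.whiskerLeft_comp_assoc, inc_colorProj]
    split_ifs
    · rw [inc_inducedHalfBraiding_prj]
    · simp
  have e2 : Z ◁ inc σ y X ≫ (inducedHalfBraiding k σ R X j Z ≫ colorProj σ X s ▷ Z) ≫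
      prj σ y' X ▷ Z = if y' ∈ s then component k σ j y y' X Z else 0 := by
    rw [Category.assoc, ← comp_whiskerRight, colorProj_prj]
    split_ifs
    · rw [inc_inducedHalfBraiding_prj]
    · simp
  rw [e1, e2]
  by_cases h : ∀ l, l ≠ j → y l = y' l
  · simp only [hs y y' h]
  · push Not at h
    obtain ⟨l, hl, h⟩ := h
    rw [component_eq_zero k σ R hl h, ite_self, ite_self]

theorem component_eq_zero_of_hom {i : σ.Orbit} {y y' : σ.Orbit → Fin R.card} {X Z : C}
    (h : ∀ f : Z ⊗ R.obj (y i) ⟶ R.obj (y' i), f = 0) : component k σ i y y' X Z = 0 := by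
  refine Finset.sum_eq_zero fun l _ => ?_
  rw [h ((R.bases k (Z ⊗ R.obj (y i)) (y' i)).φ l), map_zero, LinearMap.zero_apply]

theorem tensor_unit_hom_eq_zero {u : Fin R.card} (e : 𝟙_ C ≅ R.obj u) {a b c : Fin R.card}
    (hab : a ≠ b) (hc : c = u) (f : R.obj a ⊗ R.obj c ⟶ R.obj b) : f = 0 := by
  subst hc
  rw [← cancel_epi (R.obj a ◁ e.hom), ← cancel_epi (ρ_ (R.obj a)).inv,
    R.hom_eq_zero hab ((ρ_ (R.obj a)).inv ≫ R.obj a ◁ e.hom ≫ f)]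
  simp

theorem dual_tensor_unit_hom_eq_zero {u : Fin R.card} (e : 𝟙_ C ≅ R.obj u) {a c d : Fin R.card}
    (ha : a ≠ u) (hc : c = u) (hd : d = u) (f : (R.obj a)ᘁ ⊗ R.obj c ⟶ R.obj d) : f = 0 := by
  subst hc
  subst hd
  obtain ⟨g, rfl⟩ := (tensorLeftHomEquiv (R.obj d) (R.obj a) (R.obj a)ᘁ (R.obj d)).symm.surjective f
  have : g = 0 := by
    rw [← cancel_mono (R.obj a ◁ e.inv), ← cancel_mono (ρ_ (R.obj a)).hom,
      R.hom_eq_zero (Ne.symm ha) ((g ≫ _) ≫ _)]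
    simp
  rw [this]
  simp [tensorLeftHomEquiv]

/-- The colorings that are trivial on a list of orbits. -/
def trivialOn (u : Fin R.card) (L : List σ.Orbit) : Finset (σ.Orbit → Fin R.card) :=
  Finset.univ.filter fun y => ∀ j ∈ L, y j = u

theorem whiskerLeft_colorProj_inducedHalfBraiding (X Z : C) (i : σ.Orbit) (u : Fin R.card)
    (h : ∀ {c d : Fin R.card}, c = u → d = u → ∀ f : Z ⊗ R.obj c ⟶ R.obj d, f = 0) :
    Z ◁ colorProj σ X (trivialOn σ R u [i]) ≫ inducedHalfBraiding k σ R X i Z ≫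
      colorProj σ X (trivialOn σ R u [i]) ▷ Z = 0 := by
  refine induced_hom_ext σ R fun y y' => ?_
  rw [Category.assoc, Category.assoc, ← MonoidalCategory.whiskerLeft_comp_assoc, inc_colorProj,
    ← comp_whiskerRight, colorProj_prj]
  split_ifs with h1 h2
  · rw [inc_inducedHalfBraiding_prj, component_eq_zero_of_hom]
    · simp
    · exact h (by simpa [trivialOn] using h1) (by simpa [trivialOn] using h2)
  all_goals simp

end Colorings

/-! ### The trivially colored summands generate -/

section Generation

variable (k : Type w) {C : Type u} [Field k] [IsAlgClosed k] [Category.{v} C] [Abelian C]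
  [Linear k C] [MonoidalCategory C] [MonoidalPreadditive C] [MonoidalLinear k C]
  [BraidedCategory C] [RigidCategory C] [RibbonCategory C] [FusionCategory k C]
  {n : ℕ} (σ : AdmissibleGluing n) (R : SimpleReps C) {u : Fin R.card}

/-- From a trivial color the strand `y i` is absorbed by the unitor alone. After bending the exit,
the component is an isomorphism from the trivially colored summand, with the strand and its dual at
its sides, to the summand `y`. -/
theorem isIso_bend_component {i : σ.Orbit} {y₀ y : σ.Orbit → Fin R.card} (e : 𝟙_ C ≅ R.obj (y₀ i))
    (h : ∀ l, l ≠ i → y₀ l = y l) (X : C) :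
    IsIso (bend (pivEv (R.obj (y i)) (R.obj (y i))ᘁ)
      (component k σ i y₀ y X (R.obj (y i)))) := by
  have hc := (R.bases k (R.obj (y i) ⊗ R.obj (y₀ i)) (y i)).sum_eq_of_complete (ι := Unit)
    (fun _ => R.obj (y i) ◁ e.inv ≫ (ρ_ _).hom) (fun _ => (ρ_ _).inv ≫ R.obj (y i) ◁ e.hom)
    (fun x => by simp [← MonoidalCategory.whiskerLeft_comp])
    (handle k σ i y₀ y X (R.obj (y i)))
  rw [component, ← hc, Fintype.sum_unique, handle_apply]
  have h1 : IsIso (absorbAt (R := R) (y := y₀) (y' := y) (i := i) X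
      (R.obj (y i) ◁ e.inv ≫ (ρ_ _).hom)) :=
    inferInstanceAs (IsIso (R.obj (y i) ◁ e.inv ≫ (ρ_ _).hom))
  refine isIso_bend_sweepIn _ (L := [.first i, .second i]) (fun s hs => isIso_slotDelta R X ?_)
    (by simp) (by simp) _ _ (isIso_bend_emission e) _ (σ.pattern_pair i)
  rintro j (rfl | rfl)
  all_goals exact h j (by rintro rfl; simp at hs)

variable {R}

/-- Sending the strand `y i` from the summand with color `i` trivialised reaches only the summand
`y`. Compatibility of `f` then makes the component followed by `f` zero, and the bent component is
invertible. -/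
theorem eq_zero_of_colorProj_comp (e : 𝟙_ C ≅ R.obj u) {X Y : C} {i : σ.Orbit}
    {β : ∀ Z : C, Z ⊗ Y ⟶ Y ⊗ Z} {f : inducedObj σ R X ⟶ Y}
    (hf : ∀ Z, Z ◁ f ≫ β Z = inducedHalfBraiding k σ R X i Z ≫ f ▷ Z)
    (h0 : colorProj σ X (trivialOn σ R u [i]) ≫ f = 0) : f = 0 := by
  refine inc_hom_ext σ R fun y => ?_
  rw [comp_zero]
  set y₀ := Function.update y i u with hy₀
  have hi : y₀ i = u := Function.update_self _ _ _
  have e₀ : 𝟙_ C ≅ R.obj (y₀ i) := by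
    rw [hi]
    exact e
  have hne : ∀ l, l ≠ i → y₀ l = y l := fun l hl => Function.update_of_ne hl _ _
  have h1 : inc σ y₀ X ≫ f = 0 := by
    have := inc_colorProj σ R X (trivialOn σ R u [i]) y₀
    rw [if_pos (by simpa [trivialOn] using hi)] at this
    rw [← this, Category.assoc, h0, comp_zero]
  have h2 := congrArg (fun g => R.obj (y i) ◁ inc σ y₀ X ≫ g) (hf (R.obj (y i)))
  simp only [← MonoidalCategory.whiskerLeft_comp_assoc, h1, MonoidalPreadditive.whiskerLeft_zero,
    zero_comp] at h2
  have h3 : R.obj (y i) ◁ inc σ y₀ X ≫ inducedHalfBraiding k σ R X i (R.obj (y i)) ≫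
      f ▷ R.obj (y i) = component k σ i y₀ y X (R.obj (y i)) ≫ (inc σ y X ≫ f) ▷ R.obj (y i) := by
    have h4 : f ▷ R.obj (y i) = ∑ y' : σ.Orbit → Fin R.card,
        prj σ y' X ▷ R.obj (y i) ≫ (inc σ y' X ≫ f) ▷ R.obj (y i) := by
      simp only [← comp_whiskerRight, ← sum_whiskerRight, ← Category.assoc, ← Preadditive.sum_comp,
        sum_prj_inc, Category.id_comp]
    have h5 : ∀ y', R.obj (y i) ◁ inc σ y₀ X ≫ inducedHalfBraiding k σ R X i (R.obj (y i)) ≫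
        prj σ y' X ▷ R.obj (y i) ≫ (inc σ y' X ≫ f) ▷ R.obj (y i) =
        component k σ i y₀ y' X (R.obj (y i)) ≫ (inc σ y' X ≫ f) ▷ R.obj (y i) := fun y' => by
      rw [← inc_inducedHalfBraiding_prj]
      simp only [Category.assoc]
    rw [h4, Preadditive.comp_sum, Preadditive.comp_sum]
    simp only [h5]
    refine Finset.sum_eq_single y (fun y' _ hy' => ?_) (by simp)
    obtain ⟨l, hl⟩ := Function.ne_iff.mp hy'
    by_cases hli : l = i
    · subst hli
      rw [component_eq_zero_of_hom, zero_comp]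
      exact tensor_unit_hom_eq_zero R e (Ne.symm hl) hi
    · rw [component_eq_zero k σ R hli (fun h => hl (h.symm.trans (hne l hli))), zero_comp]
  rw [h3] at h2
  have h6 := congrArg (bend (pivEv (R.obj (y i)) (R.obj (y i))ᘁ)) h2.symm
  rw [bend_comp] at h6
  have := isIso_bend_component k σ R e₀ hne X
  rw [← cancel_epi (bend (pivEv (R.obj (y i)) (R.obj (y i))ᘁ)
      (component k σ i y₀ y X (R.obj (y i)))), h6]
  simp [bend]

theorem trivialOn_cons (i : σ.Orbit) (L : List σ.Orbit) :
    trivialOn σ R u (i :: L) = trivialOn σ R u [i] ∩ trivialOn σ R u L := by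
  ext y
  simp [trivialOn]

end Generation

/-! ### Averages through the trivially colored summand -/

section HandleProjections

variable (k : Type w) {C : Type u} [Field k] [IsAlgClosed k] [Category.{v} C] [Abelian C]
  [Linear k C] [MonoidalCategory C] [MonoidalPreadditive C] [MonoidalLinear k C]
  [BraidedCategory C] [RigidCategory C] [RibbonCategory C] [FusionCategory k C]
  {n : ℕ} {σ : AdmissibleGluing n} {R : SimpleReps C} {u : Fin R.card}

/-- Commuting projections `p i`, for the orbits `i`, which are compatible with the half-braidings
of the other orbits, are orthogonal to their translates by the nontrivial simple objects, and
generate. Here `p L` is the product of the projections for the orbits in the list `L`. -/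
structure HandleProjections (z : SigmaCenter C σ) (u : Fin R.card)
    (p : List σ.Orbit → (z.X ⟶ z.X)) : Prop where
  nil : p [] = 𝟙 _
  cons : ∀ i L, p (i :: L) = p [i] ≫ p L
  cons' : ∀ i L, p (i :: L) = p L ≫ p [i]
  idem : ∀ i, p [i] ≫ p [i] = p [i]
  isHom : ∀ i j, i ≠ j → ∀ Z, Z ◁ p [i] ≫ z.γ j Z = z.γ j Z ≫ p [i] ▷ Z
  orthogonal : ∀ i a, a ≠ u → R.obj a ◁ p [i] ≫ z.γ i (R.obj a) ≫ p [i] ▷ R.obj a = 0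
  orthogonal_inv : ∀ i a, a ≠ u → p [i] ▷ R.obj a ≫ inv (z.γ i (R.obj a)) ≫ R.obj a ◁ p [i] = 0
  generates : ∀ i (f : z.X ⟶ z.X), (∀ Z, Z ◁ f ≫ z.γ i Z = z.γ i Z ≫ f ▷ Z) → p [i] ≫ f = 0 → f = 0

namespace HandleProjections

variable {z : SigmaCenter C σ} {p : List σ.Orbit → (z.X ⟶ z.X)}

-- Both sides are compatible with the half-braiding of `i` and agree after `p [i]`, by
-- `comp_average_comp`. As `p [i]` generates, they agree.
include k in
theorem average_self (h : HandleProjections z u p) (e : 𝟙_ C ≅ R.obj u) (i : σ.Orbit) :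
    average k R (z.γ i) (z.γ i) (p [i]) = (globalDim k R)⁻¹ • 𝟙 z.X := by
  have hb := z.isSigmaPair.halfBraiding i
  rw [← sub_eq_zero]
  refine h.generates i _ (fun Z => ?_) ?_
  · have h1 := average_isHom k R hb hb (p [i]) Z
    rw [sub_eq_add_neg, ← neg_smul]
    simp [h1, -neg_smul]
  · have h1 := comp_average_comp k R hb hb e (h.orthogonal_inv i) (𝟙 _)
    rw [Category.comp_id, h.idem] at h1
    rw [Preadditive.comp_sub, sub_eq_zero, Linear.comp_smul, Category.comp_id, h1]

theorem isHom_of_notMem (h : HandleProjections z u p) {i : σ.Orbit} {L : List σ.Orbit}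
    (hi : i ∉ L) : ∀ j ∈ L, ∀ Z, Z ◁ p [i] ≫ z.γ j Z = z.γ j Z ≫ p [i] ▷ Z :=
  fun j hj => h.isHom i j fun e : i = j => hi (e ▸ hj)

theorem iteratedAverage_self (h : HandleProjections z u p) (e : 𝟙_ C ≅ R.obj u)
    {L : List σ.Orbit} (hL : L.Nodup) :
    iteratedAverage k R z z L (p L) = (globalDim k R)⁻¹ ^ L.length • 𝟙 z.X := by
  induction L with
  | nil => rw [h.nil, List.length_nil, pow_zero, one_smul]; rfl
  | cons i L ih =>
    obtain ⟨hi, hL⟩ := List.nodup_cons.mp hL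
    rw [iteratedAverage_cons, h.cons, iteratedAverage_natural_left k R (h.isHom_of_notMem hi),
      ih hL, Linear.comp_smul, map_smul, Category.comp_id, h.average_self k e, smul_smul,
      List.length_cons, pow_succ]

theorem comp_iteratedAverage (h : HandleProjections z u p) (e : 𝟙_ C ≅ R.obj u)
    {y : SigmaCenter C σ} {L : List σ.Orbit} (hL : L.Nodup) (f : z.X ⟶ y.X) :
    p L ≫ iteratedAverage k R z y L (p L ≫ f) =
      (globalDim k R)⁻¹ ^ L.length • (p L ≫ f) := by
  induction L with
  | nil =>
    rw [h.nil, List.length_nil, pow_zero, one_smul, Category.id_comp, Category.id_comp]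
    rfl
  | cons i L ih =>
    obtain ⟨hi, hL⟩ := List.nodup_cons.mp hL
    have h1 := comp_average_comp k R (z.isSigmaPair.halfBraiding i)
      (y.isSigmaPair.halfBraiding i) e (h.orthogonal_inv i)
      (iteratedAverage k R z y L (p L ≫ f))
    have h2 : p (i :: L) ≫ f = p [i] ≫ p L ≫ f := by rw [h.cons, Category.assoc]
    rw [h2, iteratedAverage_cons, iteratedAverage_natural_left k R (h.isHom_of_notMem hi), h.cons',
      Category.assoc, h1, ← Category.assoc (p [i]) (p [i]), h.idem, Linear.comp_smul,
      ← Category.assoc, ← h.cons', h.cons, Category.assoc, ih hL, Linear.comp_smul, smul_smul,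
      List.length_cons, pow_succ']

theorem iteratedAverage_comp (h : HandleProjections z u p) (e : 𝟙_ C ≅ R.obj u)
    {x : SigmaCenter C σ} {L : List σ.Orbit} (hL : L.Nodup) (f : x.X ⟶ z.X) :
    iteratedAverage k R x z L (f ≫ p L) ≫ p L =
      (globalDim k R)⁻¹ ^ L.length • (f ≫ p L) := by
  induction L with
  | nil =>
    rw [h.nil, List.length_nil, pow_zero, one_smul, Category.comp_id, Category.comp_id]
    rfl
  | cons i L ih =>
    obtain ⟨hi, hL⟩ := List.nodup_cons.mp hL
    have h1 := average_comp_comp k R (x.isSigmaPair.halfBraiding i)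
      (z.isSigmaPair.halfBraiding i) e (h.orthogonal i)
      (iteratedAverage k R x z L (f ≫ p L))
    have h2 : f ≫ p (i :: L) = (f ≫ p L) ≫ p [i] := by rw [h.cons', Category.assoc]
    rw [h2, iteratedAverage_cons, iteratedAverage_natural_right k R (h.isHom_of_notMem hi),
      h.cons i L, reassoc_of% h1, Linear.smul_comp, Category.assoc, Category.assoc, ← Category.assoc (p [i]),
      h.idem, ← h.cons, h.cons', ← Category.assoc, ih hL, Linear.smul_comp, smul_smul,
      List.length_cons, pow_succ']

end HandleProjections

end HandleProjections

section Induced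

variable (k : Type w) {C : Type u} [Field k] [IsAlgClosed k] [Category.{v} C] [Abelian C]
  [Linear k C] [MonoidalCategory C] [MonoidalPreadditive C] [MonoidalLinear k C]
  [BraidedCategory C] [RigidCategory C] [RibbonCategory C] [FusionCategory k C]
  {n : ℕ} (σ : AdmissibleGluing n) {R : SimpleReps C} {u : Fin R.card}

theorem handleProjections_induced (e : 𝟙_ C ≅ R.obj u) (X : C) :
    HandleProjections (induced k σ R X) u fun L => colorProj σ X (trivialOn σ R u L) where
  nil := by
    have h : trivialOn σ R u [] = Finset.univ := by simp [trivialOn]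
    exact (congrArg _ h).trans (colorProj_univ σ R X)
  cons i L := by
    have h := colorProj_comp σ R X (trivialOn σ R u [i]) (trivialOn σ R u L)
    rw [← trivialOn_cons] at h
    exact h.symm
  cons' i L := by
    have h := colorProj_comp σ R X (trivialOn σ R u L) (trivialOn σ R u [i])
    rw [Finset.inter_comm, ← trivialOn_cons] at h
    exact h.symm
  idem i := by
    have h := colorProj_comp σ R X (trivialOn σ R u [i]) (trivialOn σ R u [i])
    rw [Finset.inter_self] at h
    exact h
  isHom i j hij Z := colorProj_isHom k σ R X (fun y y' h => by simp [trivialOn, h i hij]) Z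
  orthogonal i a ha := whiskerLeft_colorProj_inducedHalfBraiding k σ R X _ i u fun hc hd =>
    tensor_unit_hom_eq_zero R e (fun h => ha (h.trans hd)) hc
  orthogonal_inv i a ha :=
    whiskerRight_inv_whiskerLeft ((induced k σ R X).isSigmaPair.halfBraiding i) _ (R.obj a)ᘁ
      (whiskerLeft_colorProj_inducedHalfBraiding k σ R X _ i u fun hc hd =>
        dual_tensor_unit_hom_eq_zero R e ha hc hd)
  generates i f hf h0 := eq_zero_of_colorProj_comp k σ e hf h0

end Induced

/-! ### The summand with trivial colors as a copy of the object -/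

section TrivialWord

variable {C : Type u} [Category.{v} C] [Preadditive C] [MonoidalCategory C] [RigidCategory C]
  {R : SimpleReps C} {K : Type} {u : Fin R.card} (e : 𝟙_ C ≅ R.obj u) (d : 𝟙_ C ≅ (R.obj u)ᘁ)
  (X : C)

/-- The trivial color in the slots of the orbits. -/
def trivialSlot : ∀ s : Slot K, 𝟙_ C ⟶ slotObj R (fun _ => u) X s
  | .first _ => e.hom
  | .second _ => d.hom
  | .base => 0

/-- The unit object as a word with trivial colors. -/
def trivialUnit : ∀ t : List (Slot K), 𝟙_ C ⟶ prodObj (slotObj R (fun _ => u) X) t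
  | [] => 𝟙 (𝟙_ C)
  | s :: t => (λ_ (𝟙_ C)).inv ≫ (trivialSlot e d X s ⊗ₘ trivialUnit t)

/-- An object as a word with trivial colors. -/
def trivialWord : ∀ t : List (Slot K), X ⟶ prodObj (slotObj R (fun _ => u) X) t
  | [] => 0
  | .base :: t => (ρ_ X).inv ≫ X ◁ trivialUnit e d X t
  | .first i :: t => (λ_ X).inv ≫ (trivialSlot e d X (.first i) ⊗ₘ trivialWord t)
  | .second i :: t => (λ_ X).inv ≫ (trivialSlot e d X (.second i) ⊗ₘ trivialWord t)

theorem trivialWord_cons {s : Slot K} (hs : s ≠ .base) (t : List (Slot K)) :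
    trivialWord e d X (s :: t) = (λ_ X).inv ≫ (trivialSlot e d X s ⊗ₘ trivialWord e d X t) := by
  cases s with
  | first i => rfl
  | second i => rfl
  | base => exact absurd rfl hs

theorem isIso_trivialSlot {s : Slot K} (hs : s ≠ .base) : IsIso (trivialSlot e d X s) := by
  cases s with
  | first i => exact inferInstanceAs (IsIso e.hom)
  | second i => exact inferInstanceAs (IsIso d.hom)
  | base => exact absurd rfl hs

theorem isIso_trivialUnit {t : List (Slot K)} (ht : Slot.base ∉ t) :
    IsIso (trivialUnit e d X t) := by
  induction t with
  | nil => exact inferInstanceAs (IsIso (𝟙 (𝟙_ C)))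
  | cons s t ih =>
    simp only [List.mem_cons, not_or] at ht
    have := ih ht.2
    have := isIso_trivialSlot e d X (Ne.symm ht.1)
    rw [trivialUnit]
    infer_instance

theorem isIso_trivialWord {t t' : List (Slot K)} (ht : Slot.base ∉ t) (ht' : Slot.base ∉ t') :
    IsIso (trivialWord e d X (t ++ .base :: t')) := by
  induction t with
  | nil =>
    have := isIso_trivialUnit e d X ht'
    exact inferInstanceAs (IsIso ((ρ_ X).inv ≫ X ◁ trivialUnit e d X t'))
  | cons s t ih =>
    simp only [List.mem_cons, not_or] at ht
    have := ih ht.2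
    have := isIso_trivialSlot e d X (Ne.symm ht.1)
    rw [List.cons_append, trivialWord_cons e d X (Ne.symm ht.1)]
    infer_instance

variable {X} [MonoidalPreadditive C] {Y : C} (f : X ⟶ Y)

theorem trivialSlot_slotMap (s : Slot K) :
    trivialSlot e d X s ≫ slotMap R (fun _ => u) f s = trivialSlot e d Y s := by
  cases s with
  | first i => exact Category.comp_id e.hom
  | second i => exact Category.comp_id d.hom
  | base => exact zero_comp

theorem trivialUnit_prodMap (t : List (Slot K)) :
    trivialUnit e d X t ≫ prodMap (slotMap R (fun _ => u) f) t = trivialUnit e d Y t := by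
  induction t with
  | nil => exact Category.comp_id _
  | cons s t ih =>
    rw [trivialUnit, trivialUnit, prodMap_cons, Category.assoc, tensorHom_comp_tensorHom, ih,
      trivialSlot_slotMap]

theorem trivialWord_prodMap (t : List (Slot K)) :
    trivialWord e d X t ≫ prodMap (slotMap R (fun _ => u) f) t = f ≫ trivialWord e d Y t := by
  induction t with
  | nil =>
    have : (0 : X ⟶ 𝟙_ C) ≫ 𝟙 _ = f ≫ 0 := by simp
    exact this
  | cons s t ih =>
    by_cases hs : s = .base
    · subst hs
      have : ((ρ_ X).inv ≫ X ◁ trivialUnit e d X t) ≫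
          (f ⊗ₘ prodMap (slotMap R (fun _ => u) f) t) = f ≫ (ρ_ Y).inv ≫ Y ◁ trivialUnit e d Y t := by
        rw [← id_tensorHom, Category.assoc, tensorHom_comp_tensorHom, trivialUnit_prodMap,
          Category.id_comp, MonoidalCategory.tensorHom_def]
        simp
      exact this
    · rw [trivialWord_cons e d X hs, trivialWord_cons e d Y hs, prodMap_cons, Category.assoc,
        tensorHom_comp_tensorHom, ih, trivialSlot_slotMap, leftUnitor_inv_naturality_assoc,
        ← id_tensorHom, tensorHom_comp_tensorHom, Category.id_comp]

end TrivialWord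

section Unit

variable (k : Type w) {C : Type u} [Field k] [IsAlgClosed k] [Category.{v} C] [Abelian C]
  [Linear k C] [MonoidalCategory C] [MonoidalPreadditive C] [MonoidalLinear k C]
  [BraidedCategory C] [RigidCategory C] [RibbonCategory C] [FusionCategory k C]
  {n : ℕ} (σ : AdmissibleGluing n) {R : SimpleReps C} {u : Fin R.card} (e : 𝟙_ C ≅ R.obj u)

include e in
theorem exists_dual_iso : Nonempty (𝟙_ C ≅ (R.obj u)ᘁ) :=
  have := isIso_comp_pivEv e
  ⟨(asIso ((λ_ (R.obj u)ᘁ).inv ≫ e.hom ▷ (R.obj u)ᘁ ≫ pivEv (R.obj u) (R.obj u)ᘁ)).symm⟩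

theorem AdmissibleGluing.base_notMem (l : List (Fin (2 * n))) : Slot.base ∉ l.map σ.slot := by
  intro h
  obtain ⟨p, -, hp⟩ := List.mem_map.mp h
  unfold AdmissibleGluing.slot at hp
  split_ifs at hp

variable (d : 𝟙_ C ≅ (R.obj u)ᘁ)

instance isIso_trivialWord_word (X : C) : IsIso (trivialWord e d X σ.word) := by
  rw [AdmissibleGluing.word, ← List.map_take, ← List.map_drop]
  exact isIso_trivialWord e d X (σ.base_notMem _) (σ.base_notMem _)

/-- The inclusion of `X` as the summand of `X_σ` with trivial colors. -/
def trivialInc (X : C) : X ⟶ inducedObj σ R X :=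
  trivialWord e d X σ.word ≫ inc σ (fun _ => u) X

/-- The projection to the summand of `X_σ` with trivial colors. -/
def trivialPrj (X : C) : inducedObj σ R X ⟶ X :=
  prj σ (fun _ => u) X ≫ inv (trivialWord e d X σ.word)

theorem trivialInc_trivialPrj (X : C) : trivialInc σ e d X ≫ trivialPrj σ e d X = 𝟙 X := by
  rw [trivialInc, trivialPrj, Category.assoc, reassoc_of% inc_prj_self, IsIso.hom_inv_id]

theorem trivialPrj_trivialInc (X : C) : trivialPrj σ e d X ≫ trivialInc σ e d X =
    colorProj σ X (trivialOn σ R u Finset.univ.toList) := by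
  have h : trivialOn σ R u Finset.univ.toList = {fun _ => u} := by
    ext y
    simp [trivialOn, funext_iff]
  rw [h, trivialInc, trivialPrj, Category.assoc, IsIso.inv_hom_id_assoc, colorProj,
    Finset.sum_singleton]

theorem trivialInc_naturality {X Y : C} (f : X ⟶ Y) :
    f ≫ trivialInc σ e d Y = trivialInc σ e d X ≫ inducedMap σ R f := by
  rw [trivialInc, trivialInc, Category.assoc, inc_inducedMap, ← Category.assoc,
    ← trivialWord_prodMap, Category.assoc]

theorem trivialPrj_naturality {X Y : C} (f : X ⟶ Y) :
    trivialPrj σ e d X ≫ f = inducedMap σ R f ≫ trivialPrj σ e d Y := by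
  rw [trivialPrj, trivialPrj, ← Category.assoc (inducedMap σ R f), inducedMap_prj, Category.assoc,
    Category.assoc]
  congr 1
  rw [IsIso.inv_comp_eq, ← Category.assoc, IsIso.eq_comp_inv, trivialWord_prodMap]

end Unit

/-! ### Averaged retracts and the ambidextrous adjunction -/

section Splitting

variable (k : Type w) {C : Type u} [Field k] [IsAlgClosed k] [Category.{v} C] [Abelian C]
  [Linear k C] [MonoidalCategory C] [MonoidalPreadditive C] [MonoidalLinear k C]
  [BraidedCategory C] [RigidCategory C] [RibbonCategory C] [FusionCategory k C]
  {n : ℕ} {σ : AdmissibleGluing n} (R : SimpleReps C)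

/-- The projection of a morphism of `C` to a morphism of `Z_σ(C)`. -/
def sigmaHom {x y : SigmaCenter C σ} (f : x.X ⟶ y.X) : x ⟶ y :=
  ⟨sigmaProjection k R x y f, isSigmaHom_sigmaProjection k R f⟩

/-- The normalised projection of a morphism of `C` to a morphism of `Z_σ(C)`. -/
def scaledSigmaHom (c : k) {x y : SigmaCenter C σ} (f : x.X ⟶ y.X) : x ⟶ y :=
  ⟨c⁻¹ • sigmaProjection k R x y f,
    (sigmaHomSubmodule k x y).smul_mem _ (isSigmaHom_sigmaProjection k R f)⟩

/-- `X` is a retract of the underlying object of `z` such that, up to the scalar `c`, the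
averaged morphisms from and to `z` are determined by their restrictions to `X`. -/
structure IsAveragedRetract {X : C} (z : SigmaCenter C σ) (c : k) (ι : X ⟶ z.X)
    (ϖ : z.X ⟶ X) : Prop where
  self : sigmaProjection k R z z (ϖ ≫ ι) = c • 𝟙 z.X
  desc : ∀ {y : SigmaCenter C σ} (f : X ⟶ y.X),
    ι ≫ sigmaProjection k R z y (ϖ ≫ f) = c • f
  lift : ∀ {x : SigmaCenter C σ} (f : x.X ⟶ X),
    sigmaProjection k R x z (f ≫ ι) ≫ ϖ = c • f

variable {R}

theorem HandleProjections.isAveragedRetract {u : Fin R.card} {z : SigmaCenter C σ}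
    {p : List σ.Orbit → (z.X ⟶ z.X)} (h : HandleProjections z u p) (e : 𝟙_ C ≅ R.obj u) {X : C}
    {ι : X ⟶ z.X} {ϖ : z.X ⟶ X} (hι : ι ≫ ϖ = 𝟙 X) (hp : ϖ ≫ ι = p Finset.univ.toList) :
    IsAveragedRetract k R z ((globalDim k R)⁻¹ ^ (Finset.univ : Finset σ.Orbit).toList.length)
      ι ϖ where
  self := by
    rw [hp]
    exact h.iteratedAverage_self k e (Finset.nodup_toList Finset.univ)
  desc {y} f := by
    have h1 := h.comp_iteratedAverage k e (y := y) (Finset.nodup_toList Finset.univ) (ϖ ≫ f)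
    rw [← hp, Category.assoc ϖ ι (ϖ ≫ f), reassoc_of% hι] at h1
    -- The relation holds after ϖ on the left, which is a split epimorphism with section ι.
    have h2 := congrArg (fun g => ι ≫ g) h1
    simp only [Category.assoc, Linear.comp_smul, reassoc_of% hι] at h2
    exact h2
  lift {x} f := by
    have h1 := h.iteratedAverage_comp k e (x := x) (Finset.nodup_toList Finset.univ) (f ≫ ι)
    rw [← hp, Category.assoc f ι (ϖ ≫ ι), reassoc_of% hι] at h1
    have h2 := congrArg (fun g => g ≫ ϖ) h1
    simp only [Category.assoc, Linear.smul_comp, hι, Category.comp_id] at h2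
    exact h2

namespace IsAveragedRetract

variable {X : C} {z : SigmaCenter C σ} {c : k} {ι : X ⟶ z.X} {ϖ : z.X ⟶ X}
  (h : IsAveragedRetract k R z c ι ϖ) (hc : c ≠ 0)
include h hc

theorem scaledSigmaHom_comp {y : SigmaCenter C σ} (g : z ⟶ y) :
    scaledSigmaHom k R c (ϖ ≫ ι ≫ g.f) = g := by
  refine SigmaCenter.Hom.ext ?_
  change c⁻¹ • sigmaProjection k R z y (ϖ ≫ ι ≫ g.f) = g.f
  rw [← Category.assoc, sigmaProjection_natural_right, h.self, Linear.smul_comp, Category.id_comp,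
    smul_smul, inv_mul_cancel₀ hc, one_smul]

theorem comp_scaledSigmaHom {y : SigmaCenter C σ} (f : X ⟶ y.X) :
    ι ≫ (scaledSigmaHom k R c (ϖ ≫ f)).f = f := by
  change ι ≫ (c⁻¹ • sigmaProjection k R z y (ϖ ≫ f)) = f
  rw [Linear.comp_smul, h.desc, smul_smul, inv_mul_cancel₀ hc, one_smul]

theorem sigmaHom_comp {x : SigmaCenter C σ} (g : x ⟶ z) :
    sigmaHom k R ((c⁻¹ • (g.f ≫ ϖ)) ≫ ι) = g := by
  refine SigmaCenter.Hom.ext ?_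
  change sigmaProjection k R x z ((c⁻¹ • (g.f ≫ ϖ)) ≫ ι) = g.f
  rw [Linear.smul_comp, Category.assoc, map_smul, sigmaProjection_natural_left, h.self,
    Linear.comp_smul, Category.comp_id, smul_smul, inv_mul_cancel₀ hc, one_smul]

theorem smul_sigmaHom_comp {x : SigmaCenter C σ} (f : x.X ⟶ X) :
    c⁻¹ • ((sigmaHom k R (f ≫ ι)).f ≫ ϖ) = f := by
  change c⁻¹ • (sigmaProjection k R x z (f ≫ ι) ≫ ϖ) = f
  rw [h.lift, smul_smul, inv_mul_cancel₀ hc, one_smul]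

end IsAveragedRetract

/-- The second factor is a morphism of the center and can be moved under the projection, where ι
followed by it is the identity. The scalar occurs in just one of the two factors, so the result is
the projection itself. -/
theorem IsAveragedRetract.sigmaHom_comp_scaledSigmaHom {x y z : SigmaCenter C σ} {c : k}
    {ι : y.X ⟶ z.X} {ϖ : z.X ⟶ y.X} (h : IsAveragedRetract k R z c ι ϖ) (hc : c ≠ 0)
    (f : x.X ⟶ y.X) :
    sigmaHom k R (f ≫ ι) ≫ scaledSigmaHom k R c ϖ = sigmaHom k R f := by
  refine SigmaCenter.Hom.ext ?_
  have h1 := h.comp_scaledSigmaHom k hc (𝟙 y.X)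
  rw [Category.comp_id] at h1
  refine (sigmaProjection_natural_right k R (f ≫ ι) (scaledSigmaHom k R c ϖ)).symm.trans ?_
  rw [Category.assoc, h1, Category.comp_id]
  rfl

theorem sigmaHom_of_hom [CharZero k] {x y : SigmaCenter C σ} (f : x ⟶ y) :
    sigmaHom k R f.f = f :=
  SigmaCenter.Hom.ext (sigmaProjection_of_hom k R f)

theorem isProj_sigmaProjection [CharZero k] (x y : SigmaCenter C σ) :
    LinearMap.IsProj (sigmaHomSubmodule k x y) (sigmaProjection k R x y) where
  map_mem f := isSigmaHom_sigmaProjection k R f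
  map_id f hf := sigmaProjection_of_hom k R (⟨f, hf⟩ : x ⟶ y)

variable (R) in
/-- A functor to `Z_σ(C)` whose values have the given objects as averaged retracts, naturally. -/
structure AveragedInduction (I : C ⥤ SigmaCenter C σ) where
  scalar : k
  scalar_ne_zero : scalar ≠ 0
  ι : ∀ X, X ⟶ (I.obj X).X
  ϖ : ∀ X, (I.obj X).X ⟶ X
  isAveragedRetract : ∀ X, IsAveragedRetract k R (I.obj X) scalar (ι X) (ϖ X)
  ι_naturality : ∀ {X Y : C} (f : X ⟶ Y), f ≫ ι Y = ι X ≫ (I.map f).f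
  ϖ_naturality : ∀ {X Y : C} (f : X ⟶ Y), ϖ X ≫ f = (I.map f).f ≫ ϖ Y

namespace AveragedInduction

variable {k} {I : C ⥤ SigmaCenter C σ} (A : AveragedInduction k R I)

theorem scaledSigmaHom_naturality {X' X : C} {y : SigmaCenter C σ} (f : X' ⟶ X) (g : X ⟶ y.X) :
    scaledSigmaHom k R A.scalar (A.ϖ X' ≫ f ≫ g) =
      I.map f ≫ scaledSigmaHom k R A.scalar (A.ϖ X ≫ g) := by
  refine SigmaCenter.Hom.ext ?_
  change A.scalar⁻¹ • sigmaProjection k R _ _ (A.ϖ X' ≫ f ≫ g) =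
    (I.map f).f ≫ (A.scalar⁻¹ • sigmaProjection k R _ _ (A.ϖ X ≫ g))
  rw [← Category.assoc, A.ϖ_naturality, Category.assoc, sigmaProjection_natural_left,
    Linear.comp_smul]

theorem sigmaHom_naturality {x : SigmaCenter C σ} {Y Y' : C} (f : x.X ⟶ Y) (g : Y ⟶ Y') :
    sigmaHom k R ((f ≫ g) ≫ A.ι Y') = sigmaHom k R (f ≫ A.ι Y) ≫ I.map g := by
  refine SigmaCenter.Hom.ext ?_
  change sigmaProjection k R _ _ ((f ≫ g) ≫ A.ι Y') =
    sigmaProjection k R _ _ (f ≫ A.ι Y) ≫ (I.map g).f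
  rw [Category.assoc, A.ι_naturality, ← Category.assoc, sigmaProjection_natural_right]

theorem smul_comp_ϖ {x' x : SigmaCenter C σ} {Y : C} (f : x' ⟶ x) (g : x ⟶ I.obj Y) :
    A.scalar⁻¹ • ((f ≫ g).f ≫ A.ϖ Y) = f.f ≫ (A.scalar⁻¹ • (g.f ≫ A.ϖ Y)) := by
  change A.scalar⁻¹ • ((f.f ≫ g.f) ≫ A.ϖ Y) = f.f ≫ (A.scalar⁻¹ • (g.f ≫ A.ϖ Y))
  rw [Linear.comp_smul, Category.assoc]

/-- Averaged induction is left adjoint to the forgetful functor. -/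
def leftAdjunction : I ⊣ forgetful C σ :=
  Adjunction.mkOfHomEquiv
    { homEquiv X y :=
        { toFun g := A.ι X ≫ SigmaCenter.Hom.f g
          invFun f := scaledSigmaHom k R A.scalar (x := I.obj X) (y := y) (A.ϖ X ≫ f)
          left_inv g := (A.isAveragedRetract X).scaledSigmaHom_comp k A.scalar_ne_zero g
          right_inv f :=
            (A.isAveragedRetract X).comp_scaledSigmaHom k A.scalar_ne_zero (y := y) f }
      homEquiv_naturality_left_symm {_ _ y} f g := A.scaledSigmaHom_naturality (y := y) f g
      homEquiv_naturality_right _ _ := (Category.assoc _ _ _).symm }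

/-- Averaged induction is right adjoint to the forgetful functor. -/
def rightAdjunction : forgetful C σ ⊣ I :=
  Adjunction.mkOfHomEquiv
    { homEquiv x Y :=
        { toFun f := sigmaHom k R (x := x) (y := I.obj Y) (f ≫ A.ι Y)
          invFun g := A.scalar⁻¹ • (SigmaCenter.Hom.f g ≫ A.ϖ Y)
          left_inv f :=
            (A.isAveragedRetract Y).smul_sigmaHom_comp k A.scalar_ne_zero (x := x) f
          right_inv g := (A.isAveragedRetract Y).sigmaHom_comp k A.scalar_ne_zero g }
      homEquiv_naturality_left_symm f g := A.smul_comp_ϖ f g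
      homEquiv_naturality_right {x _ _} f g := A.sigmaHom_naturality (x := x) f g }

/-- Averaged induction and the forgetful functor are ambidextrous adjoint. -/
def ambidextrousAdjunction : AmbidextrousAdjunction I (forgetful C σ) where
  left := A.leftAdjunction
  right := A.rightAdjunction

theorem leftAdjunction_counit (y : SigmaCenter C σ) :
    A.leftAdjunction.counit.app y = scaledSigmaHom k R A.scalar (A.ϖ y.X) := by
  have h : A.leftAdjunction.counit.app y =
    scaledSigmaHom k R A.scalar (x := I.obj y.X) (y := y) (A.ϖ y.X ≫ 𝟙 y.X) := rfl
  rw [h, Category.comp_id]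

theorem ambidextrousAdjunction_proj (x y : SigmaCenter C σ) (f : x.X ⟶ y.X) :
    A.ambidextrousAdjunction.proj x y f = sigmaHom k R f := by
  rw [← (A.isAveragedRetract y.X).sigmaHom_comp_scaledSigmaHom k A.scalar_ne_zero]
  have h : A.rightAdjunction.homEquiv x y.X f =
      sigmaHom k R (x := x) (y := I.obj y.X) (f ≫ A.ι y.X) := by
    rw [rightAdjunction, Adjunction.mkOfHomEquiv_homEquiv]
    rfl
  exact congrArg₂ (fun g g' => g ≫ g') h (A.leftAdjunction_counit y)

theorem ambidextrousAdjunction_hasUnityTrace [CharZero k] :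
    A.ambidextrousAdjunction.HasUnityTrace := by
  intro x
  -- The unit corresponds to the identity under the adjunction, so the trace is the projection of
  -- the identity, which is already a morphism of the center.
  have h : A.ambidextrousAdjunction.proj x x (𝟙 x.X) =
      A.ambidextrousAdjunction.right.toMonad.η.app x ≫
        A.ambidextrousAdjunction.left.toComonad.ε.app x :=
    congrArg (fun g => g ≫ A.leftAdjunction.counit.app x) (A.rightAdjunction.homEquiv_id x)
  rw [← h, ambidextrousAdjunction_proj]
  exact sigmaHom_of_hom k (𝟙 x)

end AveragedInduction

variable (σ) {u : Fin R.card} (e : 𝟙_ C ≅ R.obj u) (d : 𝟙_ C ≅ (R.obj u)ᘁ)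

/-- The functor `I_σ` as an averaged induction. -/
def averagedInduction [CharZero k] : AveragedInduction k R
    (induction k σ R (isSigmaPair_induced k σ R) (isSigmaHom_inducedMap k σ R)) where
  scalar := (globalDim k R)⁻¹ ^ (Finset.univ : Finset σ.Orbit).toList.length
  scalar_ne_zero := pow_ne_zero _ (inv_ne_zero (globalDim_ne_zero k R))
  ι X := trivialInc σ e d X
  ϖ X := trivialPrj σ e d X
  isAveragedRetract X := (handleProjections_induced k σ e X).isAveragedRetract k e
    (trivialInc_trivialPrj σ e d X) (trivialPrj_trivialInc σ e d X)
  ι_naturality f := trivialInc_naturality σ e d f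
  ϖ_naturality f := trivialPrj_naturality σ e d f

end Splitting

end HigherGenera

end

open HigherGenera in
theorem mainTheorem3 {k : Type*} [Field k] [IsAlgClosed k] [CharZero k]
    {C : Type*} [Category C] [Abelian C] [Linear k C] [MonoidalCategory C]
    [MonoidalPreadditive C] [MonoidalLinear k C] [BraidedCategory C] [RigidCategory C]
    [RibbonCategory C] [FusionCategory k C]
    {n : ℕ} (σ : AdmissibleGluing n) (R : SimpleReps C) :
    ∃ (hobj : ∀ X : C, IsSigmaPair σ (inducedObj σ R X) (inducedHalfBraiding k σ R X))
      (hmap : ∀ {X Y : C} (f : X ⟶ Y), IsSigmaHom σ (inducedHalfBraiding k σ R X)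
        (inducedHalfBraiding k σ R Y) (inducedMap σ R f))
      (A : AmbidextrousAdjunction (induction k σ R hobj hmap) (forgetful C σ)),
      A.HasUnityTrace ∧
      ∃ π : ∀ x y : SigmaCenter C σ, (x.X ⟶ y.X) →ₗ[k] (x.X ⟶ y.X),
        (∀ (x y : SigmaCenter C σ) (f : x.X ⟶ y.X), π x y f = (A.proj x y f).f) ∧
        (∀ x y : SigmaCenter C σ, LinearMap.IsProj (sigmaHomSubmodule k x y) (π x y)) ∧
        (∀ {x' x y y' : SigmaCenter C σ} (g : x' ⟶ x) (f : x.X ⟶ y.X) (h : y ⟶ y'),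
          π x' y' (g.f ≫ f ≫ h.f) = g.f ≫ π x y f ≫ h.f) := by
  obtain ⟨u, ⟨e⟩⟩ := R.exists_unit k
  obtain ⟨d⟩ := exists_dual_iso e
  let A := averagedInduction k σ e d
  exact ⟨isSigmaPair_induced k σ R, fun f => isSigmaHom_inducedMap k σ R f,
    A.ambidextrousAdjunction, A.ambidextrousAdjunction_hasUnityTrace, sigmaProjection k R,
    fun x y f => (congrArg SigmaCenter.Hom.f (A.ambidextrousAdjunction_proj x y f)).symm,
    isProj_sigmaProjection k, fun g f h => sigmaProjection_natural k R g f h⟩
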